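/- **Setting.** Let $d\in\{2,3\}$ and let $\Omega\subset\mathbb R^d$ be a bounded polyhedral domain lying on one side of its boundary, with outer unit normal $\vec{\rm n}$, and $\partial\Omega=\partial_1\Omega\cup\partial_2\Omega$ a disjoint (measurable) splitting. Let $\rho_\pm\ge0$, $\mu_\pm>0$, $\beta\ge0$, $\gamma>0$, forcings $\vec f_1,\vec f_2$, and $0=t_0<\dots<t_M$ with $\tau_m=t_{m+1}-t_m$ be given. $(\cdot,\cdot)$ is the $L^2$ inner product on $\Omega$, $D(\vec u)=\frac12(\nabla\vec u+(\nabla\vec u)^T)$, $\mathcal H^{d-1}$ is the Hausdorff measure, and $\langle\vec u,\vec\xi\rangle_{\partial_2\Omega,\vec{\rm t}}=\sum_{i=1}^{d-1}\int_{\partial_2\Omega}(\vec u\cdot\vec{\rm t}_i)(\vec\xi\cdot\vec{\rm t}_i)\,d\mathcal H^{d-1}$ with $\{\vec{\rm t}_i\}$ an orthonormal basis of $\{\vec{\rm n}\}^\perp$. For $m=0,\dots,M-1$ let $\mathcal T^m$ be a finite conforming partitioning of $\Omega$ into open simplices. $S^m_0$ is the space of piecewise constants and $S^m_2$ the space of continuous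 piecewise quadratics on $\mathcal T^m$; $I^m_0$ (elementwise mean value) and $I^m_2$ (Lagrange interpolation at vertices and edge midpoints, componentwise) are the standard operators onto them. Let $\mathbb U^m$ be a space of continuous vector-valued piecewise polynomials of bounded degree on $\mathcal T^m$ with $\vec\xi=\vec0$ on $\partial_1\Omega$ and $\vec\xi\cdot\vec{\rm n}=0$ a.e. on $\partial_2\Omega$, let $\mathbb P^m\subset L^2(\Omega)$ be a space of (possibly discontinuous) piecewise polynomials of bounded degree, $\widehat{\mathbb P}^m=\{\varphi\in\mathbb P^m:\int_\Omega\varphi=0\}$, and assume the inf-sup condition: with a constant $C_0>0$ independent of $m$, and $\|\vec\xi\|_1=\|\vec\xi\|_0+\|\nabla\vec\xi\|_0$, $$\inf_{0\ne\varphi\in\widehat{\mathbb P}^m}\ \sup_{\vec\xi\in\mathbb U^m}\frac{(\varphi,\nabla\cdot\vec\xi)}{\|\varphi\|_0\|\vec\xi\|_1}\ \ge\ C_0 .$$ Let $\Gamma^m=\bigcup_j\overline{\sigma^m_j}$ be a closed polyhedral surface without self-intersections: a finite union of $(d-1)$-simplices $\sigma^m_j$ without hanging vertices, with vertices $\vec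 q^m_k$, that is the common boundary of its bounded interior $\Omega^m_-$ and its exterior $\Omega^m_+$; $\vec\nu^m$ is its piecewise constant unit normal pointing into $\Omega^m_+$. Let $W(\Gamma^m)$ and $\underline V(\Gamma^m)=[W(\Gamma^m)]^d$ be the spaces of continuous functions on $\Gamma^m$ that are affine on each $\sigma^m_j$, $\langle\cdot,\cdot\rangle_{\Gamma^m}$ the $L^2$ inner product on $\Gamma^m$ and $\langle v,w\rangle^h_{\Gamma^m}=\frac1d\sum_j\mathcal H^{d-1}(\sigma^m_j)\sum_{k=1}^d\lim_{\sigma^m_j\ni\vec p\to\vec q^m_{j_k}}(v\cdot w)(\vec p)$, where $\vec q^m_{j_1},\dots,\vec q^m_{j_d}$ are the vertices of $\sigma^m_j$. The vertex normal at $\vec q^m_k$ is $\vec\omega^m_k=\mathcal H^{d-1}(\Lambda^m_k)^{-1}\sum_{\overline{\sigma^m_j}\ni\vec q^m_k}\mathcal H^{d-1}(\sigma^m_j)\,\vec\nu^m_j$, with $\vec\nu^m_j=\vec\nu^m|_{\sigma^m_j}$ and $\Lambda^m_k$ the union of the $\overline{\sigma^m_j}$ that contain $\vec q^m_k$. The discrete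 density $\rho^m\in S^m_0$ takes the value $\rho_\mp$ on elements contained in $\Omega^m_\mp$; on the other elements $o$ it is either $\frac12(\rho_-+\rho_+)$ or $v_-\rho_-+(1-v_-)\rho_+$ with $v_-=\mathcal L^d(o\cap\Omega^m_-)/\mathcal L^d(o)$ (the same choice throughout); the discrete viscosity $\mu^m$ is defined in the same way from $\mu_\pm$. Set $\rho^{-1}=\rho^0$ and $\vec f^{m+1}_i=I^m_2\vec f_i(\cdot,t_{m+1})$. Let $\vec X^m$ be the identity on $\Gamma^m$, and let $\vec U^0\in\mathbb U^0$ and $\vec U^{m}\in\mathbb U^{m-1}$ ($1\le m\le M-1$) be given, e.g. by the previous time steps. **Assumption ($\mathcal A$).** For $m=0,\dots,M-1$: $\mathcal H^{d-1}(\sigma^m_j)>0$ for all $j$; $\Gamma^m\subset\overline\Omega$; and $\dim\operatorname{span}\{\vec\omega^m_k\}_k=d$. Moreover $\vec\omega^m_k\ne\vec0$ for all $k$, and if $\Gamma^m$ is not connected, the spanning condition holds on each of its connected components. **Theorem.** Under these assumptions, for every $m=0,\dots,M-1$ there is a unique $(\vec U^{m+1},P^{m+1},\vec X^{m+1},\kappa^{m+1})\in\mathbb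 U^m\times\widehat{\mathbb P}^m\times\underline V(\Gamma^m)\times W(\Gamma^m)$ such that, for all $\vec\xi\in\mathbb U^m$, $\varphi\in\widehat{\mathbb P}^m$, $\chi\in W(\Gamma^m)$, $\vec\eta\in\underline V(\Gamma^m)$, $$\begin{aligned} &\tfrac12\Big(\tfrac{\rho^m\vec U^{m+1}-(I^m_0\rho^{m-1})I^m_2\vec U^m}{\tau_m}+(I^m_0\rho^{m-1})\tfrac{\vec U^{m+1}-I^m_2\vec U^m}{\tau_m},\vec\xi\Big)+2\big(\mu^mD(\vec U^{m+1}),D(\vec\xi)\big)\\ &\quad+\tfrac12\big(\rho^m,[(I^m_2\vec U^m\cdot\nabla)\vec U^{m+1}]\cdot\vec\xi-[(I^m_2\vec U^m\cdot\nabla)\vec\xi]\cdot\vec U^{m+1}\big)-(P^{m+1},\nabla\cdot\vec\xi)\\ &\quad+\beta\langle\vec U^{m+1},\vec\xi\rangle_{\partial_2\Omega,\vec{\rm t}}-\gamma\langle\kappa^{m+1}\vec\nu^m,\vec\xi\rangle_{\Gamma^m}=(\rho^m\vec f^{m+1}_1+\vec f^{m+1}_2,\vec\xi),\\ &(\nabla\cdot\vec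 U^{m+1},\varphi)=0,\\ &\Big\langle\tfrac{\vec X^{m+1}-\vec X^m}{\tau_m},\chi\,\vec\nu^m\Big\rangle^h_{\Gamma^m}-\langle\vec U^{m+1},\chi\,\vec\nu^m\rangle_{\Gamma^m}=0,\\ &\langle\kappa^{m+1}\vec\nu^m,\vec\eta\rangle^h_{\Gamma^m}+\langle\nabla_s\vec X^{m+1},\nabla_s\vec\eta\rangle_{\Gamma^m}=0 . \end{aligned}$$ Moreover, with $\Gamma^{m+1}=\vec X^{m+1}(\Gamma^m)$ and $\mathcal E(\xi,\vec V,\mathcal M)=\frac12(\xi\vec V,\vec V)+\gamma\,\mathcal H^{d-1}(\mathcal M)$, the solution satisfies $$\begin{aligned} &\mathcal E(\rho^m,\vec U^{m+1},\Gamma^{m+1})+\tfrac12\big((I^m_0\rho^{m-1})(\vec U^{m+1}-I^m_2\vec U^m),\vec U^{m+1}-I^m_2\vec U^m\big)\\ &\quad+2\tau_m\big(\mu^mD(\vec U^{m+1}),D(\vec U^{m+1})\big)+\tau_m\,\beta\,\langle\vec U^{m+1},\vec U^{m+1}\rangle_{\partial_2\Omega,\vec{\rm t}}\\ &\qquad\le\mathcal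 E(I^m_0\rho^{m-1},I^m_2\vec U^m,\Gamma^m)+\tau_m(\rho^m\vec f^{m+1}_1+\vec f^{m+1}_2,\vec U^{m+1}). \end{aligned}$$ -/

import Mathlib

open MeasureTheory Filter Topology

noncomputable section

namespace TwoPhase

/-- The ambient Euclidean space `ℝ^d`. -/
abbrev Sp (d : ℕ) := EuclideanSpace ℝ (Fin d)

/-! ### The continuous problem -/

/-- Data of the two-phase Navier--Stokes problem: a bounded domain `Ω` lying on one side of its
boundary, the splitting of `∂Ω` into the no-slip part `∂₁Ω` and the slip part `∂₂Ω`, densities,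
viscosities, slip coefficient, surface tension and the forcings `f₁`, `f₂` (time, then space).
That `Ω` is polyhedral is expressed by the existence of a `BulkMesh` of `Ω`. -/
structure FlowProblem (d : ℕ) where
  Ω : Set (Sp d)
  isOpen_Ω : IsOpen Ω
  isConnected_Ω : IsConnected Ω
  isBounded_Ω : Bornology.IsBounded Ω
  interior_closure_Ω : interior (closure Ω) = Ω
  bd₁ : Set (Sp d)
  bd₂ : Set (Sp d)
  measurableSet_bd₁ : MeasurableSet bd₁
  measurableSet_bd₂ : MeasurableSet bd₂
  disjoint_bd : Disjoint bd₁ bd₂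
  union_bd : bd₁ ∪ bd₂ = frontier Ω
  rhoMinus : ℝ
  rhoPlus : ℝ
  rhoMinus_nonneg : 0 ≤ rhoMinus
  rhoPlus_nonneg : 0 ≤ rhoPlus
  muMinus : ℝ
  muPlus : ℝ
  muMinus_pos : 0 < muMinus
  muPlus_pos : 0 < muPlus
  β : ℝ
  β_nonneg : 0 ≤ β
  γ : ℝ
  γ_pos : 0 < γ
  f₁ : ℝ → Sp d → Sp d
  f₂ : ℝ → Sp d → Sp d

/-- `n` is the outer unit normal of `Ω` at `x`: near `x`, the set `Ω` is the open half space
`{y : n ⬝ (y - x) < 0}`. For a polyhedral domain such an `n` exists, and is unique, at every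
boundary point off the edges and corners. -/
def IsOuterNormal {d : ℕ} (Ω : Set (Sp d)) (x n : Sp d) : Prop :=
  ‖n‖ = 1 ∧ ∀ᶠ y in 𝓝 x, (y ∈ Ω ↔ inner ℝ n (y - x) < 0)

open Classical in
/-- The outer unit normal field on `∂Ω`. -/
def outerNormal {d : ℕ} (Ω : Set (Sp d)) (x : Sp d) : Sp d :=
  if h : ∃ n, IsOuterNormal Ω x n then h.choose else 0

/-! ### Differential operators (classical derivatives, which exist almost everywhere for piecewise
polynomial functions and are the weak ones when the function is continuous) -/

/-- `(∇u)ᵢⱼ = ∂ⱼ uᵢ`. -/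
def grad {d : ℕ} (u : Sp d → Sp d) (x : Sp d) : Matrix (Fin d) (Fin d) ℝ :=
  Matrix.of fun i j => (fderiv ℝ u x (EuclideanSpace.single j 1)) i

/-- The divergence `∇ ⬝ u`. -/
def divergence {d : ℕ} (u : Sp d → Sp d) (x : Sp d) : ℝ := (grad u x).trace

/-- The rate of deformation tensor `D(u) = (∇u + (∇u)ᵀ) / 2`. -/
def deform {d : ℕ} (u : Sp d → Sp d) (x : Sp d) : Matrix (Fin d) (Fin d) ℝ :=
  (1 / 2 : ℝ) • (grad u x + (grad u x).transpose)

/-- The inner product `A : B = ∑ᵢⱼ Aᵢⱼ Bᵢⱼ` of matrices. -/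
def frob {d : ℕ} (A B : Matrix (Fin d) (Fin d) ℝ) : ℝ := ∑ i, ∑ j, A i j * B i j

/-- The convective derivative `(v ⬝ ∇) w`. -/
def convect {d : ℕ} (v w : Sp d → Sp d) (x : Sp d) : Sp d := fderiv ℝ w x (v x)

namespace FlowProblem

variable {d : ℕ} (pb : FlowProblem d)

/-- The boundary conditions in the velocity space `𝕌`: `φ = 0` on `∂₁Ω` (in the sense of traces)
and `φ ⬝ n = 0` a.e. on `∂₂Ω`. -/
def BoundaryConditions (φ : Sp d → Sp d) : Prop :=
  (∀ᵐ x ∂((μHE[d - 1] : Measure (Sp d)).restrict pb.bd₁), φ x = 0) ∧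
  (∀ᵐ x ∂((μHE[d - 1] : Measure (Sp d)).restrict pb.bd₂),
    inner ℝ (φ x) (outerNormal pb.Ω x) = 0)

/-- The `L²(Ω)` inner product of vector fields. -/
def ip (v w : Sp d → Sp d) : ℝ := ∫ x in pb.Ω, inner ℝ (v x) (w x)

/-- `⟨u, ξ⟩_{∂₂Ω, t} = ∫_{∂₂Ω} ∑ᵢ (u ⬝ tᵢ) (ξ ⬝ tᵢ) dH^{d-1}`, where the `tᵢ` are an orthonormal
basis of the orthogonal complement of the outer normal. -/
def slip (u ξ : Sp d → Sp d) : ℝ :=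
  ∫ x in pb.bd₂,
    (∑ i, inner ℝ (u x) (stdOrthonormalBasis ℝ (ℝ ∙ outerNormal pb.Ω x)ᗮ i : Sp d) *
      inner ℝ (ξ x) (stdOrthonormalBasis ℝ (ℝ ∙ outerNormal pb.Ω x)ᗮ i : Sp d))
    ∂(μHE[d - 1] : Measure (Sp d))

/-- The `H¹(Ω)` norm `‖ξ‖₀ + ‖∇ξ‖₀`. -/
def h1norm (ξ : Sp d → Sp d) : ℝ :=
  Real.sqrt (pb.ip ξ ξ) + Real.sqrt (∫ x in pb.Ω, frob (grad ξ x) (grad ξ x))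

/-- The pressure space `L²(Ω)`. -/
abbrev Pressure := Lp ℝ 2 (volume.restrict pb.Ω)

/-- `(φ, ∇ ⬝ ξ)`. -/
def divPair (φ : pb.Pressure) (ξ : Sp d → Sp d) : ℝ := ∫ x in pb.Ω, φ x * divergence ξ x

/-- The energy `½ (ξ V, V) + γ H^{d-1}(S)`. -/
def energy (ξ : Sp d → ℝ) (V : Sp d → Sp d) (S : Set (Sp d)) : ℝ :=
  1 / 2 * pb.ip (fun x => ξ x • V x) V + pb.γ * ((μHE[d - 1] : Measure (Sp d)) S).toReal

end FlowProblem

/-! ### Bulk meshes -/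

/-- A finite conforming partitioning of `Ω` into `d`-simplices. -/
structure BulkMesh {d : ℕ} (Ω : Set (Sp d)) where
  complex : Geometry.SimplicialComplex ℝ (Sp d)
  finite_faces : complex.faces.Finite
  pure : ∀ s ∈ complex.faces, ∃ o ∈ complex.faces, s ⊆ o ∧ o.card = d + 1
  space_eq : complex.space = closure Ω

/-- The open `d`-simplex with vertex set `o`. -/
def openSimplex {d : ℕ} (o : Finset (Sp d)) : Set (Sp d) := interior (convexHull ℝ (o : Set (Sp d)))

namespace BulkMesh

variable {d : ℕ} {Ω : Set (Sp d)} (T : BulkMesh Ω)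

open Classical in
/-- The elements of the mesh, given by their vertex sets. -/
def elements : Finset (Finset (Sp d)) := T.finite_faces.toFinset.filter fun o => o.card = d + 1

/-- `χ ∈ S_k` for `k ≥ 1`: continuous on the closure of `Ω` and a polynomial of degree at most `k`
on each element. A function on the closure of `Ω` is represented by its extension by zero. -/
def MemS (k : ℕ) (χ : Sp d → ℝ) : Prop :=
  (∀ x ∉ closure Ω, χ x = 0) ∧ ContinuousOn χ (closure Ω) ∧
  ∀ o ∈ T.elements, ∃ p : MvPolynomial (Fin d) ℝ, p.totalDegree ≤ k ∧
    ∀ x ∈ openSimplex o, χ x = MvPolynomial.eval (fun i => x i) p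

/-- `V ∈ [S_k]^d`. -/
def MemSVec (k : ℕ) (V : Sp d → Sp d) : Prop := ∀ i, T.MemS k fun x => V x i

/-- `V` is the element of `[S_2]^d` that agrees with `η` at the degrees of freedom of `S_2`, i.e.
at the vertices and at the midpoints of the edges of the elements. -/
def IsInterp₂ (η V : Sp d → Sp d) : Prop :=
  T.MemSVec 2 V ∧ ∀ o ∈ T.elements, ∀ a ∈ o, ∀ b ∈ o, V (midpoint ℝ a b) = η (midpoint ℝ a b)

open Classical in
/-- The standard interpolation operator `I_2` (componentwise). On a conforming mesh the
interpolant always exists and is unique. -/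
def interp₂ (η : Sp d → Sp d) : Sp d → Sp d :=
  if h : ∃ V, T.IsInterp₂ η V then h.choose else 0

/-- The element of `S_0` with value `c o` on the element `o`. -/
def pwConst (c : Finset (Sp d) → ℝ) (x : Sp d) : ℝ :=
  ∑ o ∈ T.elements, (openSimplex o).indicator (fun _ => c o) x

/-- The projection `I_0` onto `S_0`: the mean value on each element. -/
def proj₀ (η : Sp d → ℝ) : Sp d → ℝ := T.pwConst fun o => ⨍ x in openSimplex o, η x

/-- `φ ∈ L²(Ω)` is, on each element, (a.e.) a polynomial of degree at most `k`. -/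
def MemDiscontinuous (k : ℕ) (φ : Lp ℝ 2 (volume.restrict Ω)) : Prop :=
  ∀ o ∈ T.elements, ∃ p : MvPolynomial (Fin d) ℝ, p.totalDegree ≤ k ∧
    ∀ᵐ x ∂(volume.restrict (openSimplex o)), φ x = MvPolynomial.eval (fun i => x i) p

end BulkMesh

/-! ### Polyhedral surfaces -/

/-- A closed polyhedral surface `Γ` without self-intersections, oriented by its unit normal.
It is a union of nondegenerate `(d-1)`-simplices without hanging vertices (a pure
`(d-1)`-dimensional simplicial complex) which is the common boundary of its bounded interior `Ω₋`
and of its exterior `Ω₊ = ℝ^d \ closure Ω₋`. On each facet the normal is the unit vector orthogonal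
to the facet (i.e. plus or minus the normalized wedge product of the edge vectors) that points into
the exterior. -/
structure Surface (d : ℕ) where
  complex : Geometry.SimplicialComplex ℝ (Sp d)
  finite_faces : complex.faces.Finite
  pure : ∀ s ∈ complex.faces, ∃ σ ∈ complex.faces, s ⊆ σ ∧ σ.card = d
  inside : Set (Sp d)
  isOpen_inside : IsOpen inside
  isBounded_inside : Bornology.IsBounded inside
  frontier_inside : frontier inside = complex.space
  closure_inter_closure : closure inside ∩ closure (closure inside)ᶜ = complex.space
  normal : Finset (Sp d) → Sp d
  norm_normal : ∀ σ ∈ complex.faces, σ.card = d → ‖normal σ‖ = 1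
  normal_orthogonal : ∀ σ ∈ complex.faces, σ.card = d →
    ∀ v ∈ vectorSpan ℝ (σ : Set (Sp d)), inner ℝ (normal σ) v = 0
  normal_outward : ∀ σ ∈ complex.faces, σ.card = d →
    ∀ x ∈ intrinsicInterior ℝ (convexHull ℝ (σ : Set (Sp d))),
      ∀ᶠ ε in 𝓝[>] (0 : ℝ), x + ε • normal σ ∈ (closure inside)ᶜ

/-- The closed simplex with vertex set `σ`. -/
def closedSimplex {d : ℕ} (σ : Finset (Sp d)) : Set (Sp d) := convexHull ℝ (σ : Set (Sp d))

/-- The measure `H^{d-1}(σ)` of a `(d-1)`-simplex. -/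
def area {d : ℕ} (σ : Finset (Sp d)) : ℝ := ((μHE[d - 1] : Measure (Sp d)) (closedSimplex σ)).toReal

/-- The surface gradient `∇ₛ X` at a point `x` of the facet `σ`: the derivative at `x` of the
extension of `X` that is constant in the direction normal to `σ`. -/
def surfGrad {d : ℕ} (σ : Finset (Sp d)) (X : Sp d → Sp d) (x : Sp d) : Matrix (Fin d) (Fin d) ℝ :=
  grad (fun v => X (x + (vectorSpan ℝ (σ : Set (Sp d))).starProjection v)) 0

namespace Surface

variable {d : ℕ} (Γ : Surface d)

/-- The surface as a point set. -/
def carrier : Set (Sp d) := Γ.complex.space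

/-- The exterior `Ω₊` of the surface. -/
def outside : Set (Sp d) := (closure Γ.inside)ᶜ

open Classical in
/-- The `(d-1)`-simplices of the surface, given by their vertex sets. -/
def facets : Finset (Finset (Sp d)) := Γ.finite_faces.toFinset.filter fun σ => σ.card = d

/-- `X ∈ V(Γ)`: continuous on `Γ` and affine on each facet. A function on `Γ` is represented by its
extension by zero. -/
def MemV (X : Sp d → Sp d) : Prop :=
  (∀ x ∉ Γ.carrier, X x = 0) ∧ ContinuousOn X Γ.carrier ∧
  ∀ σ ∈ Γ.facets, ∃ g : Sp d →ᵃ[ℝ] Sp d, ∀ x ∈ closedSimplex σ, X x = g x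

/-- `χ ∈ W(Γ)`: the scalar version of `V(Γ)`. -/
def MemW (χ : Sp d → ℝ) : Prop :=
  (∀ x ∉ Γ.carrier, χ x = 0) ∧ ContinuousOn χ Γ.carrier ∧
  ∀ σ ∈ Γ.facets, ∃ g : Sp d →ᵃ[ℝ] ℝ, ∀ x ∈ closedSimplex σ, χ x = g x

/-- `⟨v, w⟩_Γ`, for `v`, `w` given facet by facet. -/
def ip (v w : Finset (Sp d) → Sp d → Sp d) : ℝ :=
  ∑ σ ∈ Γ.facets, ∫ x in closedSimplex σ, inner ℝ (v σ x) (w σ x) ∂(μHE[d - 1] : Measure (Sp d))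

/-- The mass lumped inner product `⟨v, w⟩^h_Γ`. Here `v σ`, `w σ` are the continuous extensions to
the closed facet `σ` of the restrictions of `v`, `w` to the open one, so that `v σ q` is the limit
of `v` at the vertex `q` from within `σ`. -/
def lumped (v w : Finset (Sp d) → Sp d → Sp d) : ℝ :=
  1 / (d : ℝ) * ∑ σ ∈ Γ.facets, area σ * ∑ q ∈ σ, inner ℝ (v σ q) (w σ q)

/-- `⟨∇ₛ X, ∇ₛ η⟩_Γ`. -/
def gradIp (X η : Sp d → Sp d) : ℝ :=
  ∑ σ ∈ Γ.facets, ∫ x in closedSimplex σ, frob (surfGrad σ X x) (surfGrad σ η x)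
    ∂(μHE[d - 1] : Measure (Sp d))

open Classical in
/-- The facets that have `q` as a vertex (as the surface has no hanging vertices, these are the
facets whose closure contains the vertex `q`). -/
def star (q : Sp d) : Finset (Finset (Sp d)) := Γ.facets.filter fun σ => q ∈ closedSimplex σ

/-- The vertex normal `ω` at the vertex `q`. -/
def vertexNormal (q : Sp d) : Sp d :=
  ((μHE[d - 1] : Measure (Sp d)) (⋃ σ ∈ Γ.star q, closedSimplex σ)).toReal⁻¹ •
    ∑ σ ∈ Γ.star q, area σ • Γ.normal σ

/-- Assumption (𝒜) for one surface: the facets are nondegenerate, `Γ` lies in the closure of `Ω`,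
and the vertex normals span `ℝ^d`. -/
def AssumptionA (Ω : Set (Sp d)) : Prop :=
  (∀ σ ∈ Γ.facets, 0 < area σ) ∧ Γ.carrier ⊆ closure Ω ∧
  Module.finrank ℝ (Submodule.span ℝ (Γ.vertexNormal '' Γ.complex.vertices)) = d

/-- On every connected component of `Γ` the vertex normals span `ℝ^d`. For a connected surface this
is the spanning condition of Assumption (𝒜). -/
def SpanOnComponents : Prop :=
  ∀ q ∈ Γ.complex.vertices, Module.finrank ℝ (Submodule.span ℝ
    (Γ.vertexNormal '' (Γ.complex.vertices ∩ connectedComponentIn Γ.carrier q))) = d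

end Surface

/-! ### The discretization -/

/-- The two ways of defining density and viscosity on the elements cut by the interface:
arithmetic mean, or weighting by volume fractions. -/
inductive CutRule
  | mean
  | volumeFraction

open Classical in
/-- The value on the element `o` of the discrete coefficient with phase values `cMinus` (inside of
`Γ`) and `cPlus` (outside of `Γ`). -/
def CutRule.coeff {d : ℕ} (r : CutRule) (Γ : Surface d) (cMinus cPlus : ℝ)
    (o : Finset (Sp d)) : ℝ :=
  match r with
  | .mean =>
    if openSimplex o ⊆ Γ.inside then cMinus
    else if openSimplex o ⊆ Γ.outside then cPlus
    else 1 / 2 * (cMinus + cPlus)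
  | .volumeFraction =>
    let vMinus := volume.real (openSimplex o ∩ Γ.inside) / volume.real (openSimplex o)
    vMinus * cMinus + (1 - vMinus) * cPlus

/-- Data of the fully discrete scheme: time levels `0 = t₀ < … < t_M`, and for each level `m` a
mesh, finite element spaces `𝕌^m ⊆ 𝕌` (continuous piecewise polynomials satisfying the boundary
conditions; these belong to `H¹`) and `ℙ^m ⊆ L²(Ω)` on the mesh, a surface `Γ^m`, and
a velocity `U^m`, with `U^0 ∈ 𝕌^0` and `U^{m+1} ∈ 𝕌^m`. Only the levels `m < M` matter. -/
structure Discretization {d : ℕ} (pb : FlowProblem d) where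
  M : ℕ
  t : ℕ → ℝ
  t_zero : t 0 = 0
  t_lt : ∀ m < M, t m < t (m + 1)
  rule : CutRule
  mesh : ℕ → BulkMesh pb.Ω
  velSpace : ℕ → Submodule ℝ (Sp d → Sp d)
  velSpace_poly : ∀ m < M, ∃ k, ∀ V ∈ velSpace m, (mesh m).MemSVec k V
  velSpace_bc : ∀ m < M, ∀ V ∈ velSpace m, pb.BoundaryConditions V
  presSpace : ℕ → Submodule ℝ pb.Pressure
  presSpace_poly : ∀ m < M, ∃ k, ∀ φ ∈ presSpace m, (mesh m).MemDiscontinuous k φ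
  surf : ℕ → Surface d
  vel : ℕ → Sp d → Sp d
  vel_zero : vel 0 ∈ velSpace 0
  vel_succ : ∀ m, m + 1 < M → vel (m + 1) ∈ velSpace m

/-- A candidate `(U^{m+1}, P^{m+1}, X^{m+1}, κ^{m+1})` for the new time level. -/
structure State {d : ℕ} (pb : FlowProblem d) where
  U : Sp d → Sp d
  P : pb.Pressure
  X : Sp d → Sp d
  κ : Sp d → ℝ

namespace Discretization

variable {d : ℕ} {pb : FlowProblem d} (D : Discretization pb)

/-- The time step size `τ_m`. -/
def τ (m : ℕ) : ℝ := D.t (m + 1) - D.t m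

/-- The discrete density `ρ^m`. -/
def rho (m : ℕ) : Sp d → ℝ :=
  (D.mesh m).pwConst (D.rule.coeff (D.surf m) pb.rhoMinus pb.rhoPlus)

/-- The discrete viscosity `μ^m`. -/
def mu (m : ℕ) : Sp d → ℝ :=
  (D.mesh m).pwConst (D.rule.coeff (D.surf m) pb.muMinus pb.muPlus)

/-- The previous density `ρ^{m-1}`, where `ρ^{-1} = ρ^0`. -/
def rhoPrev : ℕ → Sp d → ℝ
  | 0 => D.rho 0
  | m + 1 => D.rho m

/-- `I₀^m ρ^{m-1}`. -/
def rhoOld (m : ℕ) : Sp d → ℝ := (D.mesh m).proj₀ (D.rhoPrev m)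

/-- `I₂^m U^m`. -/
def velOld (m : ℕ) : Sp d → Sp d := (D.mesh m).interp₂ (D.vel m)

/-- The discrete forcing `ρ^m f₁^{m+1} + f₂^{m+1}`, where `fᵢ^{m+1} = I₂^m fᵢ(⬝, t_{m+1})`. -/
def force (m : ℕ) (x : Sp d) : Sp d :=
  D.rho m x • (D.mesh m).interp₂ (pb.f₁ (D.t (m + 1))) x +
    (D.mesh m).interp₂ (pb.f₂ (D.t (m + 1))) x

/-- The pressures in `ℙ^m` with mean value zero. -/
def presHat (m : ℕ) : Set pb.Pressure := {φ | φ ∈ D.presSpace m ∧ ∫ x in pb.Ω, φ x = 0}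

/-- The inf-sup condition on level `m` with constant `C₀`. -/
def LBB (m : ℕ) (C₀ : ℝ) : Prop :=
  (C₀ : EReal) ≤ ⨅ φ ∈ {φ | φ ∈ D.presHat m ∧ φ ≠ 0}, ⨆ ξ ∈ D.velSpace m,
    ((pb.divPair φ ξ / (‖φ‖ * pb.h1norm ξ) : ℝ) : EReal)

/-- `s = (U^{m+1}, P^{m+1}, X^{m+1}, κ^{m+1})` solves the linear system of time step `m`. -/
structure IsSolution (m : ℕ) (s : State pb) : Prop where
  mem_U : s.U ∈ D.velSpace m
  mem_P : s.P ∈ D.presHat m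
  mem_X : (D.surf m).MemV s.X
  mem_κ : (D.surf m).MemW s.κ
  momentum : ∀ ξ ∈ D.velSpace m,
    1 / 2 * pb.ip (fun x =>
        (D.τ m)⁻¹ • (D.rho m x • s.U x - D.rhoOld m x • D.velOld m x) +
        D.rhoOld m x • ((D.τ m)⁻¹ • (s.U x - D.velOld m x))) ξ
      + 2 * (∫ x in pb.Ω, D.mu m x * frob (deform s.U x) (deform ξ x))
      + 1 / 2 * (∫ x in pb.Ω, D.rho m x *
          (inner ℝ (convect (D.velOld m) s.U x) (ξ x) -
            inner ℝ (convect (D.velOld m) ξ x) (s.U x)))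
      - pb.divPair s.P ξ
      + pb.β * pb.slip s.U ξ
      - pb.γ * (D.surf m).ip (fun σ x => s.κ x • (D.surf m).normal σ) (fun _ => ξ)
    = pb.ip (D.force m) ξ
  incompressibility : ∀ φ ∈ D.presHat m, pb.divPair φ s.U = 0
  motion : ∀ χ, (D.surf m).MemW χ →
    (D.surf m).lumped (fun _ x => (D.τ m)⁻¹ • (s.X x - x))
        (fun σ x => χ x • (D.surf m).normal σ)
      - (D.surf m).ip (fun _ => s.U) (fun σ x => χ x • (D.surf m).normal σ) = 0
  curvature : ∀ η, (D.surf m).MemV η →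
    (D.surf m).lumped (fun σ x => s.κ x • (D.surf m).normal σ) (fun _ => η)
      + (D.surf m).gradIp s.X η = 0

end Discretization

end TwoPhase

end

/-! Each time step is a linear system whose unknowns and test functions range over the same four
finite-dimensional spaces, so unique solvability reduces to injectivity (`existsUnique_saddle`). For
a homogeneous solution, test with the velocity, the pressure, the curvature and the position. The
pressure and coupling terms cancel, leaving `a(U,U) + (γ/τ) |∇ₛX|² = 0`. Both terms are nonnegative,
hence zero, and the unknowns vanish one after another.

Velocity: the densities and `β` may be zero, so only viscosity is available, and it gives `D(U) = 0`
on every element. Then `U` is a rigid motion of `Ω` (`exists_rigid_of_deform_eq_zero`). The normal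
component of `U` vanishes on the whole boundary, and the outer normals of a bounded polyhedral
domain span the space, which excludes all nonzero rigid motions
(`exists_isOuterNormal_inner_ne_zero`, `eq_zero_of_rigid`). This replaces Korn's inequality and
needs no part of the boundary to be no-slip. Position: zero Dirichlet energy makes `X` constant on
each component of `Γ`; the motion equation makes it orthogonal to the vertex normals there, and
these span (`eq_zero_of_gradIp_of_lumped`). Curvature: the last equation, tested at one vertex in
the direction of its nonzero normal, gives `κ = 0` (`eq_zero_of_lumped`). Pressure: the inf-sup
condition (`eq_zero_of_divPair_eq_zero`).

The energy estimate uses the same test functions, with displacement in place of position. The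
convective form is skew, the inertia terms combine by completing a square, and the Dirichlet form
against the displacement bounds the growth of area (`measure_image_sub_measure_le`). The last point
is an inequality between the area factor of a linear map and its Hilbert–Schmidt norm that holds for
facets of dimension one and two; this is where `d = 2` or `d = 3` enters. -/

noncomputable section

namespace TwoPhase

section

/-! ### Barycentric coordinates -/

section Simplices

variable {E : Type*} [NormedAddCommGroup E] [NormedSpace ℝ E]

-- The vertices extend to an affine basis of the whole space, whose coordinate functions do the job.
-- Having the coordinates defined off the simplex allows one treatment of bulk elements and of
-- lower-dimensional facets.
open Classical in
theorem exists_affine_extension_of_barycentric_coords {σ : Finset E}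
    (hσ : AffineIndependent ℝ ((↑) : σ → E)) :
    ∃ b : E → E →ᵃ[ℝ] ℝ, ∀ q ∈ σ, ∀ r ∈ σ, b q r = if q = r then 1 else 0 := by
  obtain ⟨t, hst, ht, htop⟩ := exists_subset_affineIndependent_affineSpan_eq_top
    (k := ℝ) (s := (σ : Set E)) hσ
  let B : AffineBasis t ℝ E := ⟨(↑), ht, by simpa using htop⟩
  refine ⟨fun q => if h : q ∈ t then B.coord ⟨q, h⟩ else 0, fun q hq r hr => ?_⟩
  have hq' : q ∈ t := hst hq
  have hr' : r ∈ t := hst hr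
  have := B.coord_apply ⟨q, hq'⟩ ⟨r, hr'⟩
  simp only [hq', dif_pos]
  change B.coord ⟨q, hq'⟩ (B ⟨r, hr'⟩) = _
  rw [this]
  simp

open Classical in
/-- An affine function on the whole space that restricts to the barycentric coordinate of the
vertex `q` on the simplex with vertex set `σ`. -/
def bary (σ : Finset E) (q : E) : E →ᵃ[ℝ] ℝ :=
  if h : ∃ b : E → E →ᵃ[ℝ] ℝ, ∀ q ∈ σ, ∀ r ∈ σ, b q r = if q = r then 1 else 0
  then h.choose q else 0

open Classical in
theorem bary_apply {σ : Finset E} (hσ : AffineIndependent ℝ ((↑) : σ → E)) {q r : E}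
    (hq : q ∈ σ) (hr : r ∈ σ) : bary σ q r = if q = r then 1 else 0 := by
  have h := exists_affine_extension_of_barycentric_coords hσ
  rw [bary, dif_pos h]
  exact h.choose_spec q hq r hr

theorem affine_apply_sum_smul {σ : Finset E} {w : E → ℝ} (hw : ∑ q ∈ σ, w q = 1) {F : Type*}
    [AddCommGroup F] [Module ℝ F] (g : E →ᵃ[ℝ] F) :
    g (∑ q ∈ σ, w q • q) = ∑ q ∈ σ, w q • g q := by
  have := Finset.map_affineCombination σ (fun y : E => y) w hw g
  rw [Finset.affineCombination_eq_linear_combination _ _ _ hw,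
    Finset.affineCombination_eq_linear_combination _ _ _ hw] at this
  simpa using this

theorem exists_weights_of_mem_affineSpan {σ : Finset E} {x : E}
    (hx : x ∈ affineSpan ℝ (σ : Set E)) :
    ∃ w : E → ℝ, ∑ q ∈ σ, w q = 1 ∧ x = ∑ q ∈ σ, w q • q := by
  have hr : (σ : Set E) = Set.range ((↑) : σ → E) := by simp
  rw [hr] at hx
  obtain ⟨w, hw, hxw⟩ := eq_affineCombination_of_mem_affineSpan_of_fintype hx
  classical
  refine ⟨fun q => if h : q ∈ σ then w ⟨q, h⟩ else 0, ?_, ?_⟩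
  · rw [← hw, ← Finset.sum_coe_sort σ]
    exact Finset.sum_congr rfl fun i _ => by simp
  · rw [hxw, Finset.affineCombination_eq_linear_combination _ _ _ hw, ← Finset.sum_coe_sort σ]
    exact Finset.sum_congr rfl fun i _ => by simp

/-- If a point has weights with respect to `s ⊆ σ`, then its barycentric coordinates in
`σ` are these weights, extended by zero. -/
theorem bary_of_weights {σ s : Finset E} (hσ : AffineIndependent ℝ ((↑) : σ → E)) (hs : s ⊆ σ)
    {w : E → ℝ} (hw : ∑ q ∈ s, w q = 1) {q : E} (hq : q ∈ σ) [Decidable (q ∈ s)] :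
    bary σ q (∑ q ∈ s, w q • q) = if q ∈ s then w q else 0 := by
  classical
  rw [affine_apply_sum_smul hw,
    Finset.sum_congr rfl fun y hy => by rw [bary_apply hσ hq (hs hy)]]
  simp

/-- An affine map is determined on a simplex by its values at the vertices. -/
theorem affine_apply_eq_sum_bary {σ : Finset E} (hσ : AffineIndependent ℝ ((↑) : σ → E)) {x : E}
    (hx : x ∈ affineSpan ℝ (σ : Set E)) {F : Type*} [AddCommGroup F] [Module ℝ F]
    (g : E →ᵃ[ℝ] F) : g x = ∑ q ∈ σ, bary σ q x • g q := by
  classical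
  obtain ⟨w, hw, rfl⟩ := exists_weights_of_mem_affineSpan hx
  rw [affine_apply_sum_smul hw]
  refine Finset.sum_congr rfl fun q hq => ?_
  rw [bary_of_weights hσ subset_rfl hw hq, if_pos hq]

theorem sum_bary {σ : Finset E} (hσ : AffineIndependent ℝ ((↑) : σ → E)) {x : E}
    (hx : x ∈ affineSpan ℝ (σ : Set E)) : ∑ q ∈ σ, bary σ q x = 1 := by
  have := affine_apply_eq_sum_bary hσ hx (AffineMap.const ℝ E (1 : ℝ))
  simpa using this.symm

theorem sum_bary_smul {σ : Finset E} (hσ : AffineIndependent ℝ ((↑) : σ → E)) {x : E}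
    (hx : x ∈ affineSpan ℝ (σ : Set E)) : ∑ q ∈ σ, bary σ q x • q = x := by
  have := affine_apply_eq_sum_bary hσ hx (AffineMap.id ℝ E)
  simpa using this.symm

theorem mem_convexHull_iff_bary {σ : Finset E} (hσ : AffineIndependent ℝ ((↑) : σ → E)) {x : E} :
    x ∈ convexHull ℝ (σ : Set E) ↔
      x ∈ affineSpan ℝ (σ : Set E) ∧ ∀ q ∈ σ, 0 ≤ bary σ q x := by
  classical
  constructor
  · intro h
    refine ⟨convexHull_subset_affineSpan _ h, fun q hq => ?_⟩
    obtain ⟨w, hw0, hw1, rfl⟩ := Finset.mem_convexHull'.1 h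
    rw [bary_of_weights hσ subset_rfl hw1 hq, if_pos hq]
    exact hw0 q hq
  · rintro ⟨h, h0⟩
    exact Finset.mem_convexHull'.2 ⟨fun q => bary σ q x, h0, sum_bary hσ h, sum_bary_smul hσ h⟩

/-- A point of a simplex lies in the face spanned by the vertices with positive barycentric
coordinate, and has positive coordinates there. -/
theorem exists_face_bary_pos {σ : Finset E} (hσ : AffineIndependent ℝ ((↑) : σ → E)) {x : E}
    (hx : x ∈ convexHull ℝ (σ : Set E)) :
    ∃ s ⊆ σ, s.Nonempty ∧ ∃ w : E → ℝ, (∀ q ∈ s, 0 < w q) ∧ ∑ q ∈ s, w q = 1 ∧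
      ∑ q ∈ s, w q • q = x := by
  classical
  obtain ⟨h, h0⟩ := (mem_convexHull_iff_bary hσ).1 hx
  have hs1 : ∑ q ∈ σ with 0 < bary σ q x, bary σ q x = 1 := by
    rw [← sum_bary hσ h]
    refine Finset.sum_subset (Finset.filter_subset _ _) fun q hq hq' => ?_
    simp only [Finset.mem_filter, hq, true_and, not_lt] at hq'
    exact le_antisymm hq' (h0 q hq)
  refine ⟨σ.filter fun q => 0 < bary σ q x, Finset.filter_subset _ _, ?_, fun q => bary σ q x,
    fun q hq => (Finset.mem_filter.1 hq).2, hs1, ?_⟩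
  · by_contra hne
    rw [Finset.not_nonempty_iff_eq_empty] at hne
    rw [hne] at hs1
    simp at hs1
  · conv_rhs => rw [← sum_bary_smul hσ h]
    refine Finset.sum_subset (Finset.filter_subset _ _) fun q hq hq' => ?_
    simp only [Finset.mem_filter, hq, true_and, not_lt] at hq'
    change bary σ q x • q = 0
    rw [le_antisymm hq' (h0 q hq), zero_smul]

theorem continuous_bary [FiniteDimensional ℝ E] (σ : Finset E) (q : E) : Continuous (bary σ q) :=
  AffineMap.continuous_of_finiteDimensional _

theorem affineSpan_eq_top_of_card [FiniteDimensional ℝ E] {σ : Finset E}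
    (hσ : AffineIndependent ℝ ((↑) : σ → E)) (hc : σ.card = Module.finrank ℝ E + 1) :
    affineSpan ℝ (σ : Set E) = ⊤ := by
  have := hσ.affineSpan_eq_top_iff_card_eq_finrank_add_one
  rw [show (σ : Set E) = Set.range ((↑) : σ → E) by simp, this]
  simpa using hc

theorem finrank_vectorSpan_of_card {σ : Finset E} (hσ : AffineIndependent ℝ ((↑) : σ → E)) {n : ℕ}
    (hc : σ.card = n + 1) : Module.finrank ℝ (vectorSpan ℝ (σ : Set E)) = n := by
  have := hσ.finrank_vectorSpan (n := n) (by simpa using hc)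
  rwa [show Set.range ((↑) : σ → E) = (σ : Set E) by simp] at this

theorem finrank_vectorSpan_convexHull_le {s : Finset E} {n : ℕ} (hs : s.card ≤ n + 1) :
    Module.finrank ℝ (vectorSpan ℝ (convexHull ℝ (s : Set E))) ≤ n := by
  classical
  rw [← direction_affineSpan, affineSpan_convexHull, direction_affineSpan]
  rcases s.eq_empty_or_nonempty with rfl | h
  · rw [Finset.coe_empty, vectorSpan_empty, finrank_bot]
    exact Nat.zero_le n
  · obtain ⟨k, hk⟩ : ∃ k, s.card = k + 1 := ⟨s.card - 1, by have := h.card_pos; omega⟩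
    have := finrank_vectorSpan_image_finset_le ℝ (id : E → E) s hk
    rw [Finset.image_id] at this
    omega

theorem isCompact_convexHull_finset (s : Finset E) : IsCompact (convexHull ℝ (s : Set E)) :=
  s.finite_toSet.isCompact_convexHull ℝ

end Simplices

/-! ### Hausdorff measure of simplices and of their affine images -/

section HausdorffMeasure

variable {E : Type*} [NormedAddCommGroup E] [MeasurableSpace E] [BorelSpace E]

theorem euclideanHausdorffMeasure_eq_zero_of_dimH_lt {k : ℕ} {s : Set E} (h : dimH s < k) :
    (μHE[k] : Measure E) s = 0 := by
  rw [Measure.euclideanHausdorffMeasure_def, Measure.smul_apply]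
  have := hausdorffMeasure_of_dimH_lt (s := s) (d := (k : NNReal)) (by simpa using h)
  simp only [NNReal.coe_natCast] at this
  rw [this, smul_zero]

theorem euclideanHausdorffMeasure_add_image (k : ℕ) (x : E) (S : Set E) :
    (μHE[k] : Measure E) ((fun y => x + y) '' S) = μHE[k] S :=
  (isometry_add_left x).euclideanHausdorffMeasure_image S

variable [InnerProductSpace ℝ E] [FiniteDimensional ℝ E]

/-- At most `k` points span an affine subspace of dimension below `k`. This makes the overlaps of
distinct elements or facets, and the relative boundaries of facets, negligible. -/
theorem euclideanHausdorffMeasure_convexHull_eq_zero {k : ℕ} (s : Finset E) (hs : s.card ≤ k) :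
    (μHE[k] : Measure E) (convexHull ℝ (s : Set E)) = 0 := by
  rcases s.eq_empty_or_nonempty with rfl | h
  · simp
  have hk : 0 < k := h.card_pos.trans_le hs
  apply euclideanHausdorffMeasure_eq_zero_of_dimH_lt
  rw [Real.Convex.dimH_eq_finrank_vectorSpan (convex_convexHull ℝ _) (h.to_set.convexHull)]
  have := finrank_vectorSpan_convexHull_le (s := s) (n := k - 1) (by omega)
  exact_mod_cast (by omega : Module.finrank ℝ (vectorSpan ℝ (convexHull ℝ (s : Set E))) < k)

/-- The `k`-dimensional measure of a set in a `k`-dimensional linear subspace. -/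
theorem euclideanHausdorffMeasure_subtype_image (W : Submodule ℝ E) (S : Set W) :
    (μHE[Module.finrank ℝ W] : Measure E) (Subtype.val '' S) = volume S := by
  rw [isometry_subtype_coe.euclideanHausdorffMeasure_image,
    InnerProductSpace.euclideanHausdorffMeasure_eq_volume]

/-- On a translate of `W` the measure is Lebesgue measure of `W`, which is finite on bounded sets.
-/
theorem euclideanHausdorffMeasure_lt_top {k : ℕ} {S : Set E} (hb : Bornology.IsBounded S)
    {x : E} {W : Submodule ℝ E} (hW : Module.finrank ℝ W = k) (hS : ∀ y ∈ S, y - x ∈ W) :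
    (μHE[k] : Measure E) S < ⊤ := by
  subst hW
  have : S = (fun y => x + y) '' (Subtype.val '' {w : W | x + (w : E) ∈ S}) := by
    ext y
    simp only [Set.mem_image, Set.mem_ofPred_eq, Subtype.exists, exists_and_left, exists_prop]
    constructor
    · exact fun hy => ⟨y - x, ⟨y - x, by simpa using hy, hS y hy, rfl⟩, by simp⟩
    · rintro ⟨_, ⟨w, hw, -, rfl⟩, rfl⟩
      exact hw
  rw [this, euclideanHausdorffMeasure_add_image, euclideanHausdorffMeasure_subtype_image]
  refine Bornology.IsBounded.measure_lt_top ?_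
  obtain ⟨R, hR⟩ := hb.subset_closedBall x
  refine (Metric.isBounded_closedBall (x := (0 : W)) (r := R)).subset fun w hw => ?_
  have := hR hw
  simpa [dist_eq_norm] using this

theorem euclideanHausdorffMeasure_convexHull_lt_top {k : ℕ} {s : Finset E}
    (hs' : AffineIndependent ℝ ((↑) : s → E)) (hs : s.card ≤ k + 1) :
    (μHE[k] : Measure E) (convexHull ℝ (s : Set E)) < ⊤ := by
  rcases hs.lt_or_eq with h | h
  · rw [euclideanHausdorffMeasure_convexHull_eq_zero s (by omega)]
    simp
  · obtain ⟨q, hq⟩ : s.Nonempty := Finset.card_pos.1 (by omega)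
    refine euclideanHausdorffMeasure_lt_top (x := q) (isCompact_convexHull_finset s).isBounded
      (finrank_vectorSpan_of_card hs' h) fun y hy => ?_
    rw [← direction_affineSpan]
    exact AffineSubspace.vsub_mem_direction (convexHull_subset_affineSpan _ hy)
      (subset_affineSpan ℝ _ hq)

/-- The area formula for an affine image of a set of codimension zero in an affine subspace. -/
theorem euclideanHausdorffMeasure_linear_image {F : Type*} [NormedAddCommGroup F]
    [InnerProductSpace ℝ F] [MeasurableSpace F] [BorelSpace F] (W : Submodule ℝ E) (T : E →ₗ[ℝ] F)
    (x : E) (z : F) {S : Set E} (hS : ∀ y ∈ S, y - x ∈ W) :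
    (μHE[Module.finrank ℝ W] : Measure F) ((fun y => z + T (y - x)) '' S) =
      ENNReal.ofReal (T ∘ₗ W.subtype).normDet * (μHE[Module.finrank ℝ W] : Measure E) S := by
  have h1 : S = (fun y => x + y) '' (Subtype.val '' {w : W | x + (w : E) ∈ S}) := by
    ext y
    simp only [Set.mem_image, Set.mem_ofPred_eq, Subtype.exists, exists_and_left, exists_prop]
    constructor
    · exact fun hy => ⟨y - x, ⟨y - x, by simpa using hy, hS y hy, rfl⟩, by simp⟩
    · rintro ⟨_, ⟨w, hw, -, rfl⟩, rfl⟩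
      exact hw
  have h2 : (fun y => z + T (y - x)) '' S =
      (fun y => z + y) '' ((T ∘ₗ W.subtype) '' {w : W | x + (w : E) ∈ S}) := by
    conv_lhs => rw [h1]
    simp only [Set.image_image]
    refine Set.image_congr fun w _ => ?_
    simp
  have h3 : (μHE[Module.finrank ℝ W] : Measure F)
      ((fun y => z + y) '' ((T ∘ₗ W.subtype) '' {w : W | x + (w : E) ∈ S})) =
      (μHE[Module.finrank ℝ W] : Measure F) ((T ∘ₗ W.subtype) '' {w : W | x + (w : E) ∈ S}) :=
    (isometry_add_left z).euclideanHausdorffMeasure_image _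
  rw [h2, h3]
  conv_rhs => rw [h1]
  have h4 : (μHE[Module.finrank ℝ W] : Measure E) (Subtype.val '' {w : W | x + (w : E) ∈ S}) =
      μHE[Module.finrank ℝ W] {w : W | x + (w : E) ∈ S} :=
    isometry_subtype_coe.euclideanHausdorffMeasure_image _
  rw [euclideanHausdorffMeasure_add_image, h4]
  -- The normalizing constant relative to the plain Hausdorff measure depends only on the dimension,
  -- so it is the same on both sides.
  simp only [Measure.euclideanHausdorffMeasure_def, Measure.smul_apply]
  rw [LinearMap.hausdorffMeasure_image, ENNReal.smul_def, ENNReal.smul_def, smul_eq_mul,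
    smul_eq_mul, mul_left_comm]

end HausdorffMeasure

end

/-! ### Bulk meshes: the geometry of the elements -/

section

theorem isOpen_openSimplex {d : ℕ} (o : Finset (Sp d)) : IsOpen (openSimplex o) :=
  isOpen_interior

namespace BulkMesh

section Basic

variable {d : ℕ} {Ω : Set (Sp d)} {T : BulkMesh Ω} {o : Finset (Sp d)}

theorem mem_elements : o ∈ T.elements ↔ o ∈ T.complex.faces ∧ o.card = d + 1 := by
  classical
  simp [elements]

theorem affineIndependent (ho : o ∈ T.elements) : AffineIndependent ℝ ((↑) : o → Sp d) :=
  T.complex.indep (mem_elements.1 ho).1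

theorem mem_affineSpan (ho : o ∈ T.elements) (x : Sp d) : x ∈ affineSpan ℝ (o : Set (Sp d)) := by
  rw [affineSpan_eq_top_of_card (affineIndependent ho) (by simp [(mem_elements.1 ho).2])]
  trivial

/-- The set is open, being cut out by finitely many strict inequalities, and it lies in the closed
simplex. -/
theorem setOf_bary_pos_subset (ho : o ∈ T.elements) :
    {x | ∀ q ∈ o, 0 < bary o q x} ⊆ openSimplex o := by
  refine interior_maximal (fun x hx => ?_) ?_
  · exact (mem_convexHull_iff_bary (affineIndependent ho)).2
      ⟨mem_affineSpan ho x, fun q hq => (hx q hq).le⟩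
  · have : {x : Sp d | ∀ q ∈ o, 0 < bary o q x} = ⋂ q ∈ o, {x | 0 < bary o q x} := by
      ext; simp
    rw [this]
    exact isOpen_biInter_finset fun q _ => isOpen_lt continuous_const (continuous_bary o q)

theorem openSimplex_nonempty (ho : o ∈ T.elements) : (openSimplex o).Nonempty := by
  classical
  have hc : (o.card : ℝ) ≠ 0 := by rw [(mem_elements.1 ho).2]; positivity
  have hw : ∑ q ∈ o, (fun _ : Sp d => (o.card : ℝ)⁻¹) q = 1 := by
    simp [hc]
  refine ⟨∑ q ∈ o, (o.card : ℝ)⁻¹ • q, setOf_bary_pos_subset ho fun q hq => ?_⟩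
  rw [bary_of_weights (affineIndependent ho) subset_rfl hw hq, if_pos hq]
  rw [(mem_elements.1 ho).2]
  positivity

theorem convexHull_subset_closure_openSimplex (ho : o ∈ T.elements) :
    convexHull ℝ (o : Set (Sp d)) ⊆ closure (openSimplex o) := by
  rw [openSimplex, (convex_convexHull ℝ _).closure_interior_eq_closure_of_nonempty_interior
    (openSimplex_nonempty ho)]
  exact subset_closure

theorem closure_eq : closure Ω = ⋃ o ∈ T.elements, convexHull ℝ (o : Set (Sp d)) := by
  rw [← T.space_eq]
  ext x
  simp only [Geometry.SimplicialComplex.mem_space_iff, Set.mem_iUnion, exists_prop]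
  constructor
  · rintro ⟨s, hs, hx⟩
    obtain ⟨o, ho, hso, hc⟩ := T.pure s hs
    exact ⟨o, mem_elements.2 ⟨ho, hc⟩, convexHull_mono (by exact_mod_cast hso) hx⟩
  · rintro ⟨o, ho, hx⟩
    exact ⟨o, (mem_elements.1 ho).1, hx⟩

theorem convexHull_subset_closure (ho : o ∈ T.elements) :
    convexHull ℝ (o : Set (Sp d)) ⊆ closure Ω := by
  rw [closure_eq (T := T)]
  exact Set.subset_biUnion_of_mem (u := fun o : Finset (Sp d) => convexHull ℝ (o : Set (Sp d))) ho

theorem openSimplex_subset_closure (ho : o ∈ T.elements) : openSimplex o ⊆ closure Ω :=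
  interior_subset.trans (convexHull_subset_closure ho)

/-- Conformity confines the intersection to the hull of at most `d` common vertices, a null set; an
open null set is empty. -/
theorem openSimplex_disjoint {o' : Finset (Sp d)} (ho : o ∈ T.elements)
    (ho' : o' ∈ T.elements) (h : o ≠ o') : Disjoint (openSimplex o) (openSimplex o') := by
  classical
  rw [Set.disjoint_iff_inter_eq_empty]
  have hcard : (o ∩ o').card ≤ d := by
    have h1 := (mem_elements.1 ho).2
    have h2 := (mem_elements.1 ho').2
    by_contra hlt
    have e1 : o ∩ o' = o := Finset.eq_of_subset_of_card_le Finset.inter_subset_left (by omega)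
    have e2 : o ∩ o' = o' := Finset.eq_of_subset_of_card_le Finset.inter_subset_right (by omega)
    exact h (e1.symm.trans e2)
  have hsub : openSimplex o ∩ openSimplex o' ⊆ convexHull ℝ ((o ∩ o' : Finset (Sp d)) : Set (Sp d)) := by
    intro x hx
    rw [Finset.coe_inter]
    exact T.complex.inter_subset_convexHull (mem_elements.1 ho).1 (mem_elements.1 ho').1
      ⟨interior_subset hx.1, interior_subset hx.2⟩
  have h0 : volume (openSimplex o ∩ openSimplex o') = 0 := by
    refine measure_mono_null hsub ?_
    rw [← EuclideanSpace.euclideanHausdorffMeasure_eq_volume]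
    exact euclideanHausdorffMeasure_convexHull_eq_zero _ hcard
  exact (isOpen_interior.inter isOpen_interior).measure_eq_zero_iff volume |>.1 h0

theorem pwConst_apply (c : Finset (Sp d) → ℝ) (ho : o ∈ T.elements) {x : Sp d}
    (hx : x ∈ openSimplex o) : T.pwConst c x = c o := by
  rw [pwConst, Finset.sum_eq_single o]
  · rw [Set.indicator_of_mem hx]
  · intro o' ho' hne
    rw [Set.indicator_of_notMem]
    exact fun hx' => Set.disjoint_left.1 (openSimplex_disjoint ho' ho hne) hx' hx
  · exact fun h => absurd ho h

end Basic

variable {d : ℕ} {pb : FlowProblem d} {T : BulkMesh pb.Ω} {o : Finset (Sp d)}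

/-- The mesh only knows the closure of `Ω`. That `Ω` lies on one side of its boundary,
`interior_closure_Ω`, brings open subsets of the closure back into `Ω`. -/
theorem openSimplex_subset (ho : o ∈ T.elements) : openSimplex o ⊆ pb.Ω := by
  rw [← pb.interior_closure_Ω]
  exact interior_maximal (openSimplex_subset_closure ho) isOpen_interior

/-- The closed elements cover `Ω`, and boundaries of convex sets are null. -/
theorem ae_mem_openSimplex (T : BulkMesh pb.Ω) :
    ∀ᵐ x ∂(volume.restrict pb.Ω), ∃ o ∈ T.elements, x ∈ openSimplex o := by
  rw [ae_restrict_iff' pb.isOpen_Ω.measurableSet]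
  have h : ∀ᵐ x : Sp d, ∀ o ∈ T.elements, x ∉ frontier (convexHull ℝ (o : Set (Sp d))) := by
    rw [Filter.eventually_all_finset]
    exact fun o _ => measure_eq_zero_iff_ae_notMem.1
      ((convex_convexHull ℝ _).addHaar_frontier volume)
  filter_upwards [h] with x hx hxΩ
  have := subset_closure hxΩ
  rw [closure_eq (T := T)] at this
  simp only [Set.mem_iUnion, exists_prop] at this
  obtain ⟨o, ho, hxo⟩ := this
  refine ⟨o, ho, ?_⟩
  by_contra hni
  exact hx o ho ⟨subset_closure hxo, hni⟩

/-! ### Piecewise continuous and piecewise smooth functions -/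

section PiecewiseContinuous

variable {F G : Type*} [NormedAddCommGroup F] [NormedAddCommGroup G]

/-- On every element, `u` is the restriction of a continuous function. -/
def PwC {F : Type*} [TopologicalSpace F] (T : BulkMesh pb.Ω) (u : Sp d → F) : Prop :=
  ∀ o ∈ T.elements, ∃ g : Sp d → F, Continuous g ∧ Set.EqOn u g (openSimplex o)

theorem PwC.comp {F G : Type*} [TopologicalSpace F] [TopologicalSpace G] {u : Sp d → F}
    (hu : T.PwC u) {φ : F → G} (hφ : Continuous φ) : T.PwC fun x => φ (u x) := fun o ho => by
  obtain ⟨g, hg, hug⟩ := hu o ho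
  exact ⟨fun x => φ (g x), hφ.comp hg, fun x hx => congrArg φ (hug hx)⟩

theorem PwC.prodMk {F G : Type*} [TopologicalSpace F] [TopologicalSpace G] {u : Sp d → F}
    {v : Sp d → G} (hu : T.PwC u) (hv : T.PwC v) : T.PwC fun x => (u x, v x) := fun o ho => by
  obtain ⟨g, hg, hug⟩ := hu o ho
  obtain ⟨k, hk, hvk⟩ := hv o ho
  exact ⟨fun x => (g x, k x), hg.prodMk hk, fun x hx => Prod.ext (hug hx) (hvk hx)⟩

theorem PwC.integrableOn {u : Sp d → F} (hu : T.PwC u) : IntegrableOn u pb.Ω := by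
  have h1 : IntegrableOn u (⋃ o ∈ T.elements, openSimplex o) := by
    rw [integrableOn_finset_iUnion]
    intro o ho
    obtain ⟨g, hg, hug⟩ := hu o ho
    have : IntegrableOn g (openSimplex o) :=
      (hg.continuousOn.integrableOn_compact (isCompact_convexHull_finset o)).mono_set
        interior_subset
    exact this.congr_fun hug.symm isOpen_interior.measurableSet
  refine h1.mono_set_ae ?_
  have := T.ae_mem_openSimplex
  rw [ae_restrict_iff' pb.isOpen_Ω.measurableSet] at this
  filter_upwards [this] with x hx hxΩ
  obtain ⟨o, ho, hxo⟩ := hx hxΩ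
  exact Set.mem_biUnion ho hxo

/-- A vanishing integral gives zero almost everywhere; continuity on each open element upgrades this
to every point. -/
theorem PwC.eqOn_zero {u : Sp d → ℝ} (hu : T.PwC u)
    (h0 : ∀ o ∈ T.elements, ∀ x ∈ openSimplex o, 0 ≤ u x) (hi : ∫ x in pb.Ω, u x = 0)
    (ho : o ∈ T.elements) : ∀ x ∈ openSimplex o, u x = 0 := by
  have hae : 0 ≤ᵐ[volume.restrict pb.Ω] u := by
    filter_upwards [T.ae_mem_openSimplex] with x ⟨o, ho, hx⟩ using h0 o ho x hx
  rw [integral_eq_zero_iff_of_nonneg_ae hae hu.integrableOn] at hi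
  obtain ⟨g, hg, hug⟩ := hu o ho
  have h1 : u =ᵐ[volume.restrict (openSimplex o)] 0 :=
    ae_restrict_of_ae_restrict_of_subset (openSimplex_subset ho) hi
  have h2 : g =ᵐ[volume.restrict (openSimplex o)] (fun _ => (0 : ℝ)) := by
    filter_upwards [h1, ae_restrict_mem isOpen_interior.measurableSet] with x hx hxo
    rw [← hug hxo, hx]; rfl
  have h3 := Measure.eqOn_open_of_ae_eq h2 isOpen_interior hg.continuousOn continuousOn_const
  exact fun x hx => (hug hx).trans (h3 hx)

theorem PwC.pwConst (c : Finset (Sp d) → ℝ) : T.PwC (T.pwConst c) := fun o ho =>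
  ⟨fun _ => c o, continuous_const, fun _ hx => pwConst_apply c ho hx⟩

theorem PwC.add {u v : Sp d → F} (hu : T.PwC u) (hv : T.PwC v) :
    T.PwC fun x => u x + v x := (hu.prodMk hv).comp continuous_add

theorem PwC.sub {u v : Sp d → F} (hu : T.PwC u) (hv : T.PwC v) :
    T.PwC fun x => u x - v x := (hu.prodMk hv).comp continuous_sub

theorem PwC.smul [NormedSpace ℝ F] {c : Sp d → ℝ} {u : Sp d → F} (hc : T.PwC c) (hu : T.PwC u) :
    T.PwC fun x => c x • u x := (hc.prodMk hu).comp continuous_smul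

theorem PwC.mul {u v : Sp d → ℝ} (hu : T.PwC u) (hv : T.PwC v) :
    T.PwC fun x => u x * v x := (hu.prodMk hv).comp continuous_mul

theorem PwC.const_mul (c : ℝ) {u : Sp d → ℝ} (hu : T.PwC u) :
    T.PwC fun x => c * u x := hu.comp (continuous_const_mul c)

theorem PwC.inner {u v : Sp d → Sp d} (hu : T.PwC u) (hv : T.PwC v) :
    T.PwC fun x => inner ℝ (u x) (v x) := (hu.prodMk hv).comp continuous_inner

/-- On every element, `V` is the restriction of a continuously differentiable function. -/
def PwSmooth (T : BulkMesh pb.Ω) (V : Sp d → Sp d) : Prop :=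
  ∀ o ∈ T.elements, ∃ g : Sp d → Sp d, ContDiff ℝ 1 g ∧ Set.EqOn V g (openSimplex o)

variable {V : Sp d → Sp d}

theorem PwSmooth.pwC (hV : T.PwSmooth V) : T.PwC V := fun o ho => by
  obtain ⟨g, hg, h⟩ := hV o ho
  exact ⟨g, hg.continuous, h⟩

theorem PwSmooth.differentiableAt (hV : T.PwSmooth V) (ho : o ∈ T.elements) {x : Sp d}
    (hx : x ∈ openSimplex o) : DifferentiableAt ℝ V x := by
  obtain ⟨g, hg, h⟩ := hV o ho
  have : V =ᶠ[𝓝 x] g := h.eventuallyEq_of_mem (isOpen_interior.mem_nhds hx)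
  exact this.differentiableAt_iff.2 (hg.differentiable (by norm_num) x)

theorem PwSmooth.pwC_fderiv (hV : T.PwSmooth V) : T.PwC (fderiv ℝ V) := fun o ho => by
  obtain ⟨g, hg, h⟩ := hV o ho
  refine ⟨fderiv ℝ g, hg.continuous_fderiv (by norm_num), fun x hx => ?_⟩
  have : V =ᶠ[𝓝 x] g := h.eventuallyEq_of_mem (isOpen_interior.mem_nhds hx)
  exact this.fderiv_eq

theorem contDiff_eval (p : MvPolynomial (Fin d) ℝ) :
    ContDiff ℝ 1 fun x : Sp d => MvPolynomial.eval (fun i => x i) p := by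
  induction p using MvPolynomial.induction_on with
  | C a => simpa using contDiff_const
  | add p q hp hq => simpa using hp.add hq
  | mul_X p i hp =>
    simp only [map_mul, MvPolynomial.eval_X]
    refine hp.mul ?_
    exact contDiff_piLp_apply 2

theorem MemSVec.pwSmooth {k : ℕ} (hV : T.MemSVec k V) : T.PwSmooth V := fun o ho => by
  choose p _ hpV using fun i => (hV i).2.2 o ho
  refine ⟨fun x => WithLp.toLp 2 fun i => MvPolynomial.eval (fun i => x i) (p i), ?_, ?_⟩
  · rw [contDiff_euclidean]
    exact fun i => contDiff_eval (p i)
  · intro x hx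
    ext i
    exact hpV i x hx

theorem MemSVec.continuousOn {k : ℕ} (hV : T.MemSVec k V) : ContinuousOn V (closure pb.Ω) := by
  have : V = fun x => WithLp.toLp 2 fun i => V x i := rfl
  rw [this]
  refine (PiLp.continuous_toLp 2 _).comp_continuousOn (continuousOn_pi.2 fun i => (hV i).2.1)

theorem MemSVec.eq_zero_of_notMem {k : ℕ} (hV : T.MemSVec k V) {x : Sp d} (hx : x ∉ closure pb.Ω) :
    V x = 0 := by
  ext i
  exact (hV i).1 x hx

theorem memSVec_zero (k : ℕ) : T.MemSVec k 0 := fun _ =>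
  ⟨fun _ _ => rfl, continuousOn_const, fun _ _ => ⟨0, by simp, fun _ _ => by simp⟩⟩

/-- The default value zero lies in the space as well, so existence of the interpolant is not needed.
Of the interpolated data only this regularity enters the proof. -/
theorem memSVec_interp₂ (η : Sp d → Sp d) : T.MemSVec 2 (T.interp₂ η) := by
  unfold interp₂
  split_ifs with h
  · exact h.choose_spec.1
  · exact memSVec_zero 2

theorem eq_zero_of_eqOn_openSimplex {F : Type*} [TopologicalSpace F] [T2Space F] [Zero F]
    {u : Sp d → F} (hu : ContinuousOn u (closure pb.Ω))
    (h : ∀ o ∈ T.elements, ∀ x ∈ openSimplex o, u x = 0) : ∀ x ∈ closure pb.Ω, u x = 0 := by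
  intro x hx
  have hx' := hx
  rw [closure_eq (T := T)] at hx'
  simp only [Set.mem_iUnion, exists_prop] at hx'
  obtain ⟨o, ho, hxo⟩ := hx'
  have := (show Set.EqOn u (fun _ => 0) (openSimplex o) from h o ho).of_subset_closure
    (hu.mono (convexHull_subset_closure ho)) continuousOn_const interior_subset
    (convexHull_subset_closure_openSimplex ho)
  exact this hxo

end PiecewiseContinuous

/-! ### Finite dimension of the velocity and pressure spaces -/

section FiniteDimensional

/-- Polynomials of total degree at most `k` as functions on a set, extended by zero. -/
def polyIndicator (k : ℕ) (S : Set (Sp d)) :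
    MvPolynomial.restrictTotalDegree (Fin d) ℝ k →ₗ[ℝ] (Sp d → ℝ) where
  toFun p := S.indicator fun x => MvPolynomial.eval (fun i => x i) (p : MvPolynomial (Fin d) ℝ)
  map_add' p q := by
    ext x
    by_cases hx : x ∈ S <;> simp [hx]
  map_smul' c p := by
    simp only [RingHom.id_apply]
    ext x
    by_cases hx : x ∈ S <;> simp [hx, MvPolynomial.smul_eval]

/-- Restriction to the elements maps into a finite product of polynomial spaces. It is injective
because a continuous function on the closure of `Ω` is determined by its values on the open
elements, and the extension is zero outside. -/
theorem finiteDimensional_of_memSVec {k : ℕ} {S : Submodule ℝ (Sp d → Sp d)}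
    (hS : ∀ V ∈ S, T.MemSVec k V) : FiniteDimensional ℝ S := by
  have hmem : ∀ (V : S) (o : T.elements) (i : Fin d),
      (openSimplex (o : Finset (Sp d))).indicator (fun x => (V : Sp d → Sp d) x i) ∈
        LinearMap.range (polyIndicator k (openSimplex (o : Finset (Sp d)))) := by
    intro V o i
    obtain ⟨p, hp, hVp⟩ := (hS V V.2 i).2.2 o o.2
    refine ⟨⟨p, (MvPolynomial.mem_restrictTotalDegree _ _ _).2 hp⟩, ?_⟩
    exact Set.indicator_congr fun x hx => (hVp x hx).symm
  let Φ : S →ₗ[ℝ] (∀ o : T.elements, Fin d →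
      LinearMap.range (polyIndicator (d := d) k (openSimplex (o : Finset (Sp d))))) :=
    { toFun := fun V o i => ⟨_, hmem V o i⟩
      map_add' := fun V W => by
        ext o i x
        by_cases hx : x ∈ openSimplex (o : Finset (Sp d)) <;> simp [hx]
      map_smul' := fun c V => by
        ext o i x
        by_cases hx : x ∈ openSimplex (o : Finset (Sp d)) <;> simp [hx] }
  refine FiniteDimensional.of_injective Φ fun V W hVW => ?_
  have hz : ∀ x ∈ closure pb.Ω, (V - W : Sp d → Sp d) x = 0 := by
    refine eq_zero_of_eqOn_openSimplex (T := T)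
      ((hS V V.2).continuousOn.sub (hS W W.2).continuousOn) fun o ho x hx => ?_
    ext i
    have := congrFun (congrArg Subtype.val (congrFun (congrFun hVW ⟨o, ho⟩) i)) x
    simp only [Φ, LinearMap.coe_mk, AddHom.coe_mk, Set.indicator_of_mem hx] at this
    simp [this]
  ext1
  funext x
  by_cases hx : x ∈ closure pb.Ω
  · exact sub_eq_zero.1 (hz x hx)
  · rw [(hS V V.2).eq_zero_of_notMem hx, (hS W W.2).eq_zero_of_notMem hx]

theorem memLp_of_continuous_restrict {S : Set (Sp d)} (hS : MeasurableSet S) {K : Set (Sp d)}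
    (hK : IsCompact K) (hSK : S ⊆ K) {g : Sp d → ℝ} (hg : Continuous g) (μ : Measure (Sp d))
    [IsFiniteMeasure μ] : MemLp g 2 (μ.restrict S) := by
  obtain ⟨C, hC⟩ := hK.exists_bound_of_continuousOn hg.continuousOn
  refine MemLp.of_bound hg.aestronglyMeasurable C ?_
  filter_upwards [ae_restrict_mem hS] with x hx using hC x (hSK hx)

instance isFiniteMeasure_restrict_Ω : IsFiniteMeasure (volume.restrict pb.Ω) :=
  ⟨by simpa using pb.isBounded_Ω.measure_lt_top⟩

theorem memLp_eval (o : Finset (Sp d)) (p : MvPolynomial (Fin d) ℝ) :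
    MemLp (fun x : Sp d => MvPolynomial.eval (fun i => x i) p) 2
      ((volume.restrict pb.Ω).restrict (openSimplex o)) :=
  memLp_of_continuous_restrict isOpen_interior.measurableSet (isCompact_convexHull_finset o)
    interior_subset (contDiff_eval p).continuous _

/-- Polynomials of total degree at most `k` as square integrable functions on an element. -/
def polyLp (pb : FlowProblem d) (k : ℕ) (o : Finset (Sp d)) :
    MvPolynomial.restrictTotalDegree (Fin d) ℝ k →ₗ[ℝ]
      Lp ℝ 2 ((volume.restrict pb.Ω).restrict (openSimplex o)) where
  toFun p := (memLp_eval (pb := pb) o (p : MvPolynomial (Fin d) ℝ)).toLp _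
  map_add' p q := by
    rw [← MemLp.toLp_add]
    congr 1
    ext x
    simp
  map_smul' c p := by
    simp only [RingHom.id_apply]
    rw [← MemLp.toLp_const_smul]
    congr 1
    ext x
    simp [MvPolynomial.smul_eval]

/-- As for velocities, but with `L²` classes: the restrictions to the open elements determine the
class because the rest of `Ω` is null. -/
theorem finiteDimensional_of_memDiscontinuous {k : ℕ} {S : Submodule ℝ pb.Pressure}
    (hS : ∀ φ ∈ S, T.MemDiscontinuous k φ) : FiniteDimensional ℝ S := by
  have hmem : ∀ (φ : S) (o : T.elements),
      LpToLpRestrictCLM (Sp d) ℝ ℝ (volume.restrict pb.Ω) 2 (openSimplex (o : Finset (Sp d))) φ ∈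
        LinearMap.range (polyLp pb k (o : Finset (Sp d))) := by
    intro φ o
    obtain ⟨p, hp, hφp⟩ := hS φ φ.2 o o.2
    refine ⟨⟨p, (MvPolynomial.mem_restrictTotalDegree _ _ _).2 hp⟩, ?_⟩
    refine Lp.ext ?_
    have h1 := LpToLpRestrictCLM_coeFn ℝ (openSimplex (o : Finset (Sp d))) (φ : pb.Pressure)
    have h2 := (memLp_eval (pb := pb) o p).coeFn_toLp
    rw [← Measure.restrict_restrict_of_subset (openSimplex_subset o.2)] at hφp
    filter_upwards [h1, h2, hφp] with x hx1 hx2 hx3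
    rw [hx1, hx3]
    exact hx2
  let Φ : S →ₗ[ℝ] (∀ o : T.elements, LinearMap.range (polyLp pb k (o : Finset (Sp d)))) :=
    LinearMap.pi fun o => LinearMap.codRestrict _
      ((LpToLpRestrictCLM (Sp d) ℝ ℝ (volume.restrict pb.Ω) 2
        (openSimplex (o : Finset (Sp d)))).toLinearMap ∘ₗ S.subtype) fun φ => hmem φ o
  refine FiniteDimensional.of_injective Φ fun φ ψ h => ?_
  ext1
  refine Lp.ext ?_
  have key : ∀ o ∈ T.elements, ∀ᵐ x ∂(volume.restrict pb.Ω), x ∈ openSimplex o →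
      (φ : pb.Pressure) x = (ψ : pb.Pressure) x := by
    intro o ho
    rw [← ae_restrict_iff' (isOpen_openSimplex o).measurableSet]
    have h0 : LpToLpRestrictCLM (Sp d) ℝ ℝ (volume.restrict pb.Ω) 2 (openSimplex o)
        (φ : pb.Pressure) = LpToLpRestrictCLM (Sp d) ℝ ℝ (volume.restrict pb.Ω) 2
          (openSimplex o) (ψ : pb.Pressure) := congrArg Subtype.val (congrFun h ⟨o, ho⟩)
    have h1 := LpToLpRestrictCLM_coeFn ℝ (openSimplex o) (φ : pb.Pressure)
    have h2 := LpToLpRestrictCLM_coeFn ℝ (openSimplex o) (ψ : pb.Pressure)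
    rw [h0] at h1
    filter_upwards [h1, h2] with x hx1 hx2
    rw [← hx1, hx2]
  filter_upwards [(Filter.eventually_all_finset _).2 key, T.ae_mem_openSimplex]
    with x hx ⟨o, ho, hxo⟩ using hx o ho hxo

end FiniteDimensional

end BulkMesh

end

/-! ### Fields with vanishing rate of deformation are rigid motions -/

section

section Rigid

variable {d : ℕ}

/-- A vector field that preserves distances to first order on a ball is a rigid motion there. -/
theorem exists_skew_of_inner_sub_eq_zero {f : Sp d → Sp d} {c : Sp d} {r : ℝ} (hr : 0 < r)
    (h : ∀ x ∈ Metric.ball c r, ∀ y ∈ Metric.ball c r, inner ℝ (f x - f y) (x - y) = 0) :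
    ∃ A : Sp d →ₗ[ℝ] Sp d, (∀ v, inner ℝ (A v) v = 0) ∧
      ∀ x ∈ Metric.ball c r, f x = f c + A (x - c) := by
  set g : Sp d → Sp d := fun x => f (c + x) - f c with hg
  have hmem : ∀ x : Sp d, ‖x‖ < r → c + x ∈ Metric.ball c r := fun x hx => by
    simpa [dist_eq_norm] using hx
  have hc : c ∈ Metric.ball c r := Metric.mem_ball_self hr
  have h1 : ∀ x, ‖x‖ < r → inner ℝ (g x) x = 0 := fun x hx => by
    simpa [hg] using h _ (hmem x hx) _ hc
  have h2 : ∀ x y, ‖x‖ < r → ‖y‖ < r → inner ℝ (g x) y = - inner ℝ (g y) x := by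
    intro x y hx hy
    have h3 := h _ (hmem x hx) _ (hmem y hy)
    have e : f (c + x) - f (c + y) = g x - g y := by simp [hg]
    rw [e, add_sub_add_left_eq_sub, inner_sub_left, inner_sub_right, inner_sub_right, h1 x hx,
      h1 y hy] at h3
    linarith
  set ε : ℝ := r / 2 with hε
  have hε0 : 0 < ε := by positivity
  have hen : ∀ j : Fin d, ‖ε • (EuclideanSpace.single j (1 : ℝ) : Sp d)‖ < r := fun j => by
    rw [norm_smul, Real.norm_of_nonneg hε0.le]
    simp [hε, hr]
  -- By the skew relation `h2`, the `j`-th component of `g x` is minus the inner product of `x` with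
  -- `g (ε e_j) / ε`. This formula is linear in `x`; the factor `ε` keeps the test points inside the
  -- ball.
  let A : Sp d →ₗ[ℝ] Sp d :=
    { toFun := fun x => WithLp.toLp 2 fun j =>
        -(ε⁻¹ * inner ℝ (g (ε • EuclideanSpace.single j 1)) x)
      map_add' := fun x y => by ext j; simp [inner_add_right]; ring
      map_smul' := fun a x => by ext j; simp [inner_smul_right]; ring }
  have hA : ∀ x, ‖x‖ < r → g x = A x := by
    intro x hx
    ext j
    have := h2 x _ hx (hen j)
    rw [inner_smul_right, EuclideanSpace.inner_single_right] at this
    simp only [conj_trivial, one_mul] at this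
    change g x j = -(ε⁻¹ * inner ℝ (g (ε • EuclideanSpace.single j 1)) x)
    field_simp
    linarith
  refine ⟨A, fun v => ?_, fun x hx => ?_⟩
  · by_cases hv : v = 0
    · simp [hv]
    have hv0 : 0 < ‖v‖ := norm_pos_iff.2 hv
    have ht : ‖(ε / ‖v‖) • v‖ < r := by
      rw [norm_smul, Real.norm_of_nonneg (by positivity), div_mul_cancel₀ _ hv0.ne']
      simp [hε, hr]
    have h3 := h1 _ ht
    rw [hA _ ht, map_smul, inner_smul_left, inner_smul_right] at h3
    have : ε / ‖v‖ ≠ 0 := by positivity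
    simpa [this, hε0.ne', hv] using h3
  · have := hA (x - c) (by simpa [dist_eq_norm] using hx)
    rw [← this]
    simp [hg]

/-- A quadratic form only sees the symmetric part of its matrix. -/
theorem inner_fderiv_self_eq_zero {u : Sp d → Sp d} {x : Sp d} (h : deform u x = 0) (v : Sp d) :
    inner ℝ (fderiv ℝ u x v) v = 0 := by
  have hij : ∀ i j, grad u x i j + grad u x j i = 0 := fun i j => by
    have := congrFun (congrFun h i) j
    simpa [deform] using this
  have hv : v = ∑ j, v j • (EuclideanSpace.single j (1 : ℝ) : Sp d) := by
    ext i
    simp [Finset.sum_apply, Pi.single_apply]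
  have e : inner ℝ (fderiv ℝ u x v) v = ∑ i, ∑ j, grad u x i j * (v i * v j) := by
    rw [PiLp.inner_apply]
    refine Finset.sum_congr rfl fun i _ => ?_
    have : (fderiv ℝ u x v) i = ∑ j, v j * grad u x i j := by
      conv_lhs => rw [hv]
      simp [grad]
    rw [this]
    simp only [RCLike.inner_apply, conj_trivial, Finset.mul_sum]
    exact Finset.sum_congr rfl fun j _ => by ring
  have e2 : ∑ i, ∑ j, grad u x i j * (v i * v j) = ∑ i, ∑ j, grad u x j i * (v i * v j) := by
    rw [Finset.sum_comm]
    exact Finset.sum_congr rfl fun i _ => Finset.sum_congr rfl fun j _ => by ring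
  have e3 : ∑ i, ∑ j, grad u x i j * (v i * v j) + ∑ i, ∑ j, grad u x j i * (v i * v j) = 0 := by
    simp only [← Finset.sum_add_distrib, ← add_mul, hij, zero_mul, Finset.sum_const_zero]
  rw [e]
  linarith

/-- Along the segment from `y` to `x`, the component of `u` in the direction `x - y` has as
derivative the quadratic form of `∇u` at `x - y`, which is zero. Only first derivatives are needed.
-/
theorem inner_sub_eq_zero_of_deform_eq_zero {u : Sp d → Sp d} {S : Set (Sp d)} (hS : Convex ℝ S)
    (hu : ∀ x ∈ S, DifferentiableAt ℝ u x) (h : ∀ x ∈ S, deform u x = 0) {x y : Sp d} (hx : x ∈ S)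
    (hy : y ∈ S) : inner ℝ (u x - u y) (x - y) = 0 := by
  set φ : ℝ → ℝ := fun t => inner ℝ (u (y + t • (x - y))) (x - y) with hφ
  have hmem : ∀ t ∈ Set.Icc (0 : ℝ) 1, y + t • (x - y) ∈ S := fun t ht =>
    hS.add_smul_sub_mem hy hx ht
  have hder : ∀ t ∈ Set.Icc (0 : ℝ) 1, HasDerivAt φ 0 t := by
    intro t ht
    have h1 : HasDerivAt (fun t : ℝ => y + t • (x - y)) (x - y) t := by
      simpa using ((hasDerivAt_id t).smul_const (x - y)).const_add y
    have h2 := (hu _ (hmem t ht)).hasFDerivAt.comp_hasDerivAt t h1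
    have h3 := h2.inner ℝ (hasDerivAt_const t (x - y))
    rw [inner_fderiv_self_eq_zero (h _ (hmem t ht)), inner_zero_right, zero_add] at h3
    exact h3
  have := constant_of_has_deriv_right_zero (f := φ) (a := 0) (b := 1)
    (fun t ht => (hder t ht).continuousAt.continuousWithinAt)
    (fun t ht => (hder t ⟨ht.1, ht.2.le⟩).hasDerivWithinAt) 1 (by simp)
  simp only [hφ, one_smul, zero_smul, add_zero, add_sub_cancel] at this
  rw [inner_sub_left, this, sub_self]

variable {pb : FlowProblem d} {T : BulkMesh pb.Ω}

/-- Along the segment, the component of `U` in the direction `x - y` takes a single value on each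
element. It is therefore a continuous function on an interval with finite range, hence constant. No
account is needed of how the segment crosses the elements. -/
theorem inner_sub_eq_zero_of_piecewise {U : Sp d → Sp d} (hU : ContinuousOn U (closure pb.Ω))
    (h : ∀ o ∈ T.elements, ∀ x ∈ openSimplex o, ∀ y ∈ openSimplex o,
      inner ℝ (U x - U y) (x - y) = 0) {x y : Sp d} (hxy : segment ℝ x y ⊆ closure pb.Ω) :
    inner ℝ (U x - U y) (x - y) = 0 := by
  have hcl : ∀ o ∈ T.elements, ∀ x ∈ convexHull ℝ (o : Set (Sp d)),
      ∀ y ∈ convexHull ℝ (o : Set (Sp d)), inner ℝ (U x - U y) (x - y) = 0 := by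
    intro o ho x hx y hy
    have hc : ContinuousOn (fun z : Sp d × Sp d => inner ℝ (U z.1 - U z.2) (z.1 - z.2))
        (convexHull ℝ (o : Set (Sp d)) ×ˢ convexHull ℝ (o : Set (Sp d))) := by
      have hUo := hU.mono (BulkMesh.convexHull_subset_closure ho)
      refine ContinuousOn.inner ?_ (by fun_prop)
      exact (hUo.comp continuousOn_fst fun z hz => hz.1).sub
        (hUo.comp continuousOn_snd fun z hz => hz.2)
    have hE : Set.EqOn (fun z : Sp d × Sp d => inner ℝ (U z.1 - U z.2) (z.1 - z.2))
        (fun _ => (0 : ℝ)) (openSimplex o ×ˢ openSimplex o) := fun z hz => h o ho _ hz.1 _ hz.2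
    refine hE.of_subset_closure hc continuousOn_const
      (Set.prod_mono interior_subset interior_subset) ?_ (x := (x, y)) ⟨hx, hy⟩
    rw [closure_prod_eq]
    exact Set.prod_mono (BulkMesh.convexHull_subset_closure_openSimplex ho)
      (BulkMesh.convexHull_subset_closure_openSimplex ho)
  set γ : ℝ → Sp d := fun t => y + t • (x - y) with hγ
  have hγm : ∀ t ∈ Set.Icc (0 : ℝ) 1, γ t ∈ closure pb.Ω := by
    intro t ht
    refine hxy ?_
    rw [segment_symm, segment_eq_image']
    exact ⟨t, ht, rfl⟩
  set φ : ℝ → ℝ := fun t => inner ℝ (U (γ t)) (x - y) with hφ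
  have hcont : ContinuousOn φ (Set.Icc 0 1) := by
    refine ContinuousOn.inner (hU.comp (by fun_prop) hγm) continuousOn_const
  have hfin : (φ '' Set.Icc 0 1).Finite := by
    have hsub : φ '' Set.Icc 0 1 ⊆
        ⋃ o ∈ T.elements, φ '' {t | γ t ∈ convexHull ℝ (o : Set (Sp d))} := by
      rintro _ ⟨t, ht, rfl⟩
      have := hγm t ht
      rw [BulkMesh.closure_eq (T := T)] at this
      simp only [Set.mem_iUnion, exists_prop] at this ⊢
      obtain ⟨o, ho, hto⟩ := this
      exact ⟨o, ho, t, hto, rfl⟩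
    refine Set.Finite.subset (Set.Finite.biUnion T.elements.finite_toSet fun o ho => ?_) hsub
    refine Set.Subsingleton.finite ?_
    rintro _ ⟨t, ht, rfl⟩ _ ⟨s, hs, rfl⟩
    by_cases hts : t = s
    · rw [hts]
    have := hcl o ho _ ht _ hs
    have e : γ t - γ s = (t - s) • (x - y) := by simp only [hγ]; module
    rw [e, inner_smul_right, inner_sub_left] at this
    have := (mul_eq_zero.1 this).resolve_left (sub_ne_zero.2 hts)
    simp only [hφ]
    linarith
  have := isPreconnected_Icc.constant_of_mapsTo hfin.isDiscrete hcont (Set.mapsTo_image _ _)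
    (x := 1) (y := 0) (by simp) (by simp)
  simp only [hφ, hγ, one_smul, zero_smul, add_zero, add_sub_cancel] at this
  rw [inner_sub_left, this, sub_self]

/-- Balls in `Ω` are convex, so `U` is a rigid motion near each point. In particular `U` is
analytic; the identity theorem on the connected set `Ω` yields one rigid motion, and continuity
carries it to the closure. -/
theorem exists_rigid_of_deform_eq_zero {U : Sp d → Sp d} {k : ℕ} (hU : T.MemSVec k U)
    (h : ∀ o ∈ T.elements, ∀ x ∈ openSimplex o, deform U x = 0) :
    ∃ (A : Sp d →ₗ[ℝ] Sp d) (b : Sp d), (∀ v, inner ℝ (A v) v = 0) ∧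
      ∀ x ∈ closure pb.Ω, U x = A x + b := by
  have hseg : ∀ x y, segment ℝ x y ⊆ closure pb.Ω → inner ℝ (U x - U y) (x - y) = 0 :=
    fun x y hxy => inner_sub_eq_zero_of_piecewise hU.continuousOn (fun o ho x hx y hy =>
      inner_sub_eq_zero_of_deform_eq_zero (convex_convexHull ℝ _).interior
        (fun z hz => hU.pwSmooth.differentiableAt ho hz) (h o ho) hx hy) hxy
  have hloc : ∀ c ∈ pb.Ω, ∃ A : Sp d →ₗ[ℝ] Sp d, (∀ v, inner ℝ (A v) v = 0) ∧
      ∀ᶠ x in 𝓝 c, U x = U c + A (x - c) := by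
    intro c hc
    obtain ⟨r, hr, hball⟩ := Metric.isOpen_iff.1 pb.isOpen_Ω c hc
    obtain ⟨A, hA, hUA⟩ := exists_skew_of_inner_sub_eq_zero (f := U) hr fun x hx y hy =>
      hseg x y (((convex_ball c r).segment_subset hx hy).trans (hball.trans subset_closure))
    exact ⟨A, hA, Filter.eventually_of_mem (Metric.ball_mem_nhds c hr) hUA⟩
  have haff : ∀ (A : Sp d →ₗ[ℝ] Sp d) (b c : Sp d) (s : Set (Sp d)),
      AnalyticOnNhd ℝ (fun x => b + A (x - c)) s := fun A b c s x _ =>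
    analyticAt_const.add ((A.toContinuousLinearMap.analyticAt _).comp
      (analyticAt_id.sub analyticAt_const))
  obtain ⟨c, hc⟩ := pb.isConnected_Ω.nonempty
  obtain ⟨A, hA, hUA⟩ := hloc c hc
  have han : AnalyticOnNhd ℝ U pb.Ω := fun x hx => by
    obtain ⟨B, -, hB⟩ := hloc x hx
    exact (haff B (U x) x Set.univ x trivial).congr (hB.mono fun y hy => hy.symm)
  have heq := han.eqOn_of_preconnected_of_eventuallyEq (haff A (U c) c pb.Ω)
    pb.isConnected_Ω.isPreconnected hc hUA
  have heq' := heq.of_subset_closure hU.continuousOn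
    (haff A (U c) c _).continuousOn subset_closure subset_rfl
  refine ⟨A, U c - A c, hA, fun x hx => ?_⟩
  rw [heq' hx]
  simp only [map_sub]
  abel

end Rigid

end

/-! ### Outer normals: uniqueness, local constancy, measurability -/

section

section OuterNormal

variable {d : ℕ} {Ω : Set (Sp d)} {x p n n' : Sp d}

theorem eventually_add_smul (x v : Sp d) {P : Sp d → Prop} (h : ∀ᶠ y in 𝓝 x, P y) :
    ∃ t : ℝ, 0 < t ∧ P (x + t • v) := by
  have hc : Tendsto (fun t : ℝ => x + t • v) (𝓝[>] 0) (𝓝 x) := by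
    have : Continuous fun t : ℝ => x + t • v := by fun_prop
    simpa using (this.tendsto 0).mono_left nhdsWithin_le_nhds
  have h0 : ∀ᶠ t : ℝ in 𝓝[>] 0, 0 < t := self_mem_nhdsWithin
  exact (h0.and (hc.eventually h)).exists

theorem IsOuterNormal.unique (h : IsOuterNormal Ω x n) (h' : IsOuterNormal Ω x n') : n = n' := by
  by_contra hne
  have hlt : inner ℝ n n' < 1 := inner_lt_one_iff_real_of_norm_eq_one h.1 h'.1 |>.2 hne
  -- For distinct unit vectors, `n' - n` points strictly inwards with respect to `n` and strictly
  -- outwards with respect to `n'`.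
  obtain ⟨t, ht, h1, h2⟩ := eventually_add_smul x (n' - n) (h.2.and h'.2)
  rw [h1] at h2
  simp only [add_sub_cancel_left, inner_smul_right, inner_sub_right, real_inner_self_eq_norm_sq,
    h.1, h'.1, real_inner_comm n n'] at h2
  have h3 : t * (inner ℝ n n' - 1 ^ 2) < 0 := by nlinarith
  have h4 := h2.1 h3
  nlinarith

theorem outerNormal_eq (h : IsOuterNormal Ω x n) : outerNormal Ω x = n := by
  have hex : ∃ n, IsOuterNormal Ω x n := ⟨n, h⟩
  rw [outerNormal, dif_pos hex]
  exact hex.choose_spec.unique h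

theorem IsOuterNormal.mem_frontier (h : IsOuterNormal Ω x n) : x ∈ frontier Ω := by
  refine ⟨mem_closure_iff_nhds.2 fun s hs => ?_, fun hx => ?_⟩
  · obtain ⟨t, ht, h1, h2⟩ := eventually_add_smul x (-n) (h.2.and hs)
    refine ⟨_, h2, h1.2 ?_⟩
    simp [inner_smul_right, h.1, ht]
  · have := h.2.self_of_nhds.1 (interior_subset hx)
    simp at this

theorem IsOuterNormal.eventually (h : IsOuterNormal Ω x n) :
    ∀ᶠ y in 𝓝 x, inner ℝ n (y - x) = 0 → IsOuterNormal Ω y n := by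
  filter_upwards [h.2.eventually_nhds] with y hy h0
  refine ⟨h.1, hy.mono fun z hz => ?_⟩
  rw [hz, show z - x = (z - y) + (y - x) by abel, inner_add_right, h0, add_zero]

theorem IsOuterNormal.eventually_frontier (hΩ : IsOpen Ω) (h : IsOuterNormal Ω x n) :
    ∀ᶠ y in 𝓝 x, y ∈ frontier Ω → IsOuterNormal Ω y n := by
  filter_upwards [h.eventually, h.2.eventually_nhds] with y hy h1 hyf
  refine hy (le_antisymm ?_ ?_)
  · by_contra hlt
    rw [not_le] at hlt
    have hc : Continuous fun z : Sp d => inner ℝ n (z - x) := by fun_prop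
    have h2 : ∀ᶠ z in 𝓝 y, z ∉ Ω := by
      filter_upwards [h1, hc.continuousAt.eventually (lt_mem_nhds hlt)] with z hz hz'
      rw [hz]
      exact not_lt.2 hz'.le
    obtain ⟨z, hz, hz'⟩ := mem_closure_iff_nhds.1 hyf.1 _ h2
    exact hz hz'
  · by_contra hlt
    rw [not_le] at hlt
    have := h1.self_of_nhds.2 hlt
    rw [hΩ.frontier_eq] at hyf
    exact hyf.2 this

/-- Where a normal exists, the boundary is locally a piece of a hyperplane, so the set of these
points is relatively open in the boundary and the normal is locally constant on it. Elsewhere the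
field is zero. -/
theorem aestronglyMeasurable_outerNormal (hΩ : IsOpen Ω) (μ : Measure (Sp d)) :
    AEStronglyMeasurable (outerNormal Ω) μ := by
  set R : Set (Sp d) := {x | ∃ n, IsOuterNormal Ω x n} with hR
  have hloc : ∀ x ∈ R, ∃ u : Set (Sp d), IsOpen u ∧ x ∈ u ∧
      ∀ y ∈ u, y ∈ frontier Ω → IsOuterNormal Ω y (outerNormal Ω x) := by
    rintro x ⟨n, hn⟩
    obtain ⟨u, hu, huo, hxu⟩ := eventually_nhds_iff.1 (hn.eventually_frontier hΩ)
    exact ⟨u, huo, hxu, fun y hy hyf => by rw [outerNormal_eq hn]; exact hu y hy hyf⟩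
  choose! u huo hxu hu using hloc
  set O : Set (Sp d) := ⋃ x ∈ R, u x with hO
  have hOopen : IsOpen O := isOpen_biUnion fun x hx => huo x hx
  have hRO : frontier Ω ∩ O = R := by
    ext y
    constructor
    · rintro ⟨hyf, hyO⟩
      simp only [hO, Set.mem_iUnion, exists_prop] at hyO
      obtain ⟨x, hx, hyx⟩ := hyO
      exact ⟨_, hu x hx y hyx hyf⟩
    · intro hy
      obtain ⟨n, hn⟩ := id hy
      exact ⟨hn.mem_frontier, Set.mem_biUnion hy (hxu y hy)⟩
  have hRm : MeasurableSet R := hRO ▸ isClosed_frontier.measurableSet.inter hOopen.measurableSet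
  have hcont : ContinuousOn (outerNormal Ω) R := by
    intro x hx
    have : ∀ᶠ y in 𝓝[R] x, outerNormal Ω y = outerNormal Ω x := by
      filter_upwards [self_mem_nhdsWithin, mem_nhdsWithin_of_mem_nhds ((huo x hx).mem_nhds (hxu x hx))]
        with y hy hyu
      obtain ⟨n, hn⟩ := hy
      exact outerNormal_eq (hu x hx y hyu hn.mem_frontier)
    exact (continuousWithinAt_const (b := outerNormal Ω x)).congr_of_eventuallyEq this rfl
  have hind : outerNormal Ω = R.indicator (outerNormal Ω) := by
    funext x
    by_cases hx : x ∈ R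
    · rw [Set.indicator_of_mem hx]
    · rw [Set.indicator_of_notMem hx, outerNormal]
      exact dif_neg hx
  rw [hind, aestronglyMeasurable_indicator_iff hRm]
  exact hcont.aestronglyMeasurable hRm

theorem norm_outerNormal_le (Ω : Set (Sp d)) (x : Sp d) : ‖outerNormal Ω x‖ ≤ 1 := by
  rw [outerNormal]
  split_ifs with h
  · exact h.choose_spec.1.le
  · simp

/-- If the closure of `Ω` is a half space near `p`, so is the interior of the closure. -/
theorem isOuterNormal_of_closure (hΩ : interior (closure Ω) = Ω) (hn : ‖n‖ = 1)
    (h : ∀ᶠ y in 𝓝 p, (y ∈ closure Ω ↔ inner ℝ n (y - p) ≤ 0)) : IsOuterNormal Ω p n := by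
  refine ⟨hn, ?_⟩
  filter_upwards [h.eventually_nhds] with y hy
  rw [← hΩ, mem_interior_iff_mem_nhds]
  constructor
  · intro hm
    -- An interior point of the closure can be moved a little along `n` without leaving it, which
    -- makes the inequality strict at `y`.
    obtain ⟨t, ht, h1, h2⟩ := eventually_add_smul y n (hy.and hm)
    have := h1.1 h2
    rw [show y + t • n - p = (y - p) + t • n by abel, inner_add_right, inner_smul_right,
      real_inner_self_eq_norm_sq, hn] at this
    linarith
  · intro hlt
    have hc : Continuous fun z : Sp d => inner ℝ n (z - p) := by fun_prop
    filter_upwards [hy, hc.continuousAt.eventually (gt_mem_nhds hlt)] with z hz hz'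
    exact hz.2 hz'.le

end OuterNormal

/-! ### The normals of a polyhedral domain span the space -/

namespace BulkMesh

variable {d : ℕ} {pb : FlowProblem d} {T : BulkMesh pb.Ω}

/-- Through almost every point of `Ω`, the line with direction `v` only meets faces of the mesh
whose span together with `v` is everything. -/
theorem exists_mem_forall_line (T : BulkMesh pb.Ω) (v : Sp d) :
    ∃ x ∈ pb.Ω, ∀ s ∈ T.complex.faces, ∀ t : ℝ, x + t • v ∈ convexHull ℝ (s : Set (Sp d)) →
      vectorSpan ℝ (s : Set (Sp d)) ⊔ Submodule.span ℝ {v} = ⊤ := by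
  by_contra! hcon
  -- For a face `s` of the bad kind, the points whose line meets `s` lie in a proper affine subspace
  -- with direction `vectorSpan s + ℝ v`, a null set. Finitely many null sets cannot cover the
  -- nonempty open set `Ω`.
  let A : Finset (Sp d) → Set (Sp d) := fun s =>
    if vectorSpan ℝ (s : Set (Sp d)) ⊔ Submodule.span ℝ {v} = ⊤ then ∅ else
      {x | ∃ t : ℝ, x + t • v ∈ convexHull ℝ (s : Set (Sp d))}
  have hA : ∀ s, volume (A s) = 0 := by
    intro s
    by_cases hs : vectorSpan ℝ (s : Set (Sp d)) ⊔ Submodule.span ℝ {v} = ⊤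
    · simp [A, hs]
    · simp only [A, hs, if_false]
      rcases s.eq_empty_or_nonempty with rfl | ⟨q, hq⟩
      · simp
      refine measure_mono_null ?_ (Measure.addHaar_affineSubspace volume (AffineSubspace.mk' q
        (vectorSpan ℝ (s : Set (Sp d)) ⊔ Submodule.span ℝ {v})) fun htop => hs ?_)
      · rintro x ⟨t, ht⟩
        rw [SetLike.mem_coe, AffineSubspace.mem_mk', vsub_eq_sub]
        have e : x - q = (x + t • v - q) + (-t) • v := by module
        rw [e]
        refine Submodule.add_mem_sup ?_ (Submodule.smul_mem _ _ (Submodule.mem_span_singleton_self v))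
        rw [← direction_affineSpan]
        exact AffineSubspace.vsub_mem_direction (convexHull_subset_affineSpan _ ht)
          (subset_affineSpan ℝ _ hq)
      · rw [← AffineSubspace.direction_mk' q (vectorSpan ℝ (s : Set (Sp d)) ⊔ _), htop,
          AffineSubspace.direction_top]
  have hsub : pb.Ω ⊆ ⋃ s ∈ T.complex.faces, A s := by
    intro x hx
    obtain ⟨s, hs, t, ht, hne⟩ := hcon x hx
    refine Set.mem_biUnion hs ?_
    simp only [A, hne, if_false]
    exact ⟨t, ht⟩
  have h0 : volume pb.Ω = 0 :=
    measure_mono_null hsub ((measure_biUnion_null_iff T.finite_faces.countable).2 fun s _ => hA s)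
  exact (pb.isOpen_Ω.measure_pos volume pb.isConnected_Ω.nonempty).ne' h0

/-- In every direction `v`, there is a boundary point with an outer normal that is not orthogonal
to `v`. -/
theorem exists_isOuterNormal_inner_ne_zero (T : BulkMesh pb.Ω) {v : Sp d} (hv : v ≠ 0) :
    ∃ p n, IsOuterNormal pb.Ω p n ∧ inner ℝ n v ≠ 0 := by
  classical
  obtain ⟨x, hx, hline⟩ := T.exists_mem_forall_line v
  -- The line is connected and unbounded and starts in the bounded set `Ω`, so it meets the
  -- boundary.
  obtain ⟨p, ⟨t, htp⟩, hpf⟩ : ∃ p ∈ Set.range (fun t : ℝ => x + t • v), p ∈ frontier pb.Ω := by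
    have hconn : IsPreconnected (Set.range fun t : ℝ => x + t • v) :=
      isPreconnected_range (by fun_prop)
    by_contra! hcon
    have hsub : (Set.range fun t : ℝ => x + t • v) ⊆ pb.Ω := by
      refine hconn.subset_of_closure_inter_subset pb.isOpen_Ω ⟨x, ⟨0, by simp⟩, hx⟩ ?_
      rintro y ⟨hy, hyr⟩
      by_contra hyΩ
      exact hcon y hyr (pb.isOpen_Ω.frontier_eq ▸ ⟨hy, hyΩ⟩)
    obtain ⟨R, hR⟩ := (pb.isBounded_Ω.subset hsub).subset_closedBall x
    have hv0 : 0 < ‖v‖ := norm_pos_iff.2 hv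
    have := hR ⟨(|R| + 1) / ‖v‖, rfl⟩
    rw [Metric.mem_closedBall, dist_eq_norm, add_sub_cancel_left, norm_smul,
      Real.norm_of_nonneg (by positivity), div_mul_cancel₀ _ hv0.ne'] at this
    linarith [le_abs_self R]
  replace htp : x + t • v = p := htp
  have hpΩ : p ∉ pb.Ω := (pb.isOpen_Ω.frontier_eq ▸ hpf : p ∈ closure pb.Ω \ pb.Ω).2
  have hpc := hpf.1
  rw [closure_eq (T := T)] at hpc
  simp only [Set.mem_iUnion, exists_prop] at hpc
  obtain ⟨o, ho, hpo⟩ := hpc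
  -- `s` is the smallest face containing `p`; all weights of `p` in it are positive.
  obtain ⟨s, hso, hsne, w, hw0, hw1, hwp⟩ := exists_face_bary_pos (affineIndependent ho) hpo
  have hsf : s ∈ T.complex.faces := T.complex.down_closed (mem_elements.1 ho).1 hso hsne
  have hsi := T.complex.indep hsf
  have hps : p ∈ convexHull ℝ (s : Set (Sp d)) :=
    Finset.mem_convexHull'.2 ⟨w, fun q hq => (hw0 q hq).le, hw1, hwp⟩
  set W := vectorSpan ℝ (s : Set (Sp d)) with hW
  have htop : W ⊔ Submodule.span ℝ {v} = ⊤ := hline s hsf t (htp.symm ▸ hps)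
  have hdim : Module.finrank ℝ (Sp d) = d := by simp
  have hWd : d ≤ Module.finrank ℝ W + 1 := by
    have h1 := Submodule.finrank_add_le_finrank_add_finrank W (Submodule.span ℝ {v})
    have h2 := finrank_span_le_card (R := ℝ) ({v} : Set (Sp d))
    rw [htop, finrank_top, hdim] at h1
    simp at h2
    omega
  -- The choice of the line forces `s` to span at least dimension `d - 1`. Dimension `d` would put
  -- `p` in an open element, hence in `Ω`. So `p` is off the edges and corners.
  have hcard : s.card = d := by
    have h1 : s.card = Module.finrank ℝ W + 1 := by
      obtain ⟨k, hk⟩ : ∃ k, s.card = k + 1 := ⟨s.card - 1, by have := hsne.card_pos; omega⟩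
      rw [hk, finrank_vectorSpan_of_card hsi hk]
    have h2 : s.card ≤ d + 1 := (Finset.card_le_card hso).trans (mem_elements.1 ho).2.le
    by_contra hne
    have hse : s ∈ T.elements := mem_elements.2 ⟨hsf, by omega⟩
    refine hpΩ (openSimplex_subset hse (setOf_bary_pos_subset hse fun q hq => ?_))
    rw [← hwp, bary_of_weights hsi subset_rfl hw1 hq, if_pos hq]
    exact hw0 q hq
  have hvW : v ∉ W := by
    intro hvW
    have : W = ⊤ := by
      rw [← htop, eq_comm, sup_eq_left, Submodule.span_singleton_le_iff_mem]
      exact hvW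
    obtain ⟨k, hk⟩ : ∃ k, s.card = k + 1 := ⟨s.card - 1, by have := hsne.card_pos; omega⟩
    have h1 := finrank_vectorSpan_of_card hsi hk
    rw [← hW, this, finrank_top, hdim] at h1
    omega
  obtain ⟨m, hm, hm0⟩ : ∃ m ∈ Wᗮ, m ≠ 0 := by
    have : Wᗮ ≠ ⊥ := by
      rw [Ne, Submodule.orthogonal_eq_bot_iff]
      rintro h
      exact hvW (h ▸ trivial)
    exact Submodule.exists_mem_ne_zero_of_ne_bot this
  set n0 : Sp d := ‖m‖⁻¹ • m with hn0
  have hn0W : n0 ∈ Wᗮ := Submodule.smul_mem _ _ hm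
  have hn01 : ‖n0‖ = 1 := by
    rw [hn0, norm_smul, norm_inv, norm_norm, inv_mul_cancel₀ (norm_ne_zero_iff.2 hm0)]
  have hn0v : inner ℝ n0 v ≠ 0 := by
    intro h0
    have : n0 ∈ (W ⊔ Submodule.span ℝ {v})ᗮ := by
      rw [← Submodule.inf_orthogonal]
      refine ⟨hn0W, Submodule.mem_orthogonal_singleton_iff_inner_left.2 h0⟩
    rw [htop, Submodule.top_orthogonal_eq_bot, Submodule.mem_bot] at this
    rw [this] at hn01
    simp at hn01
  -- near `p`, every element that contains `p` is a half space
  have hhalf : ∀ o ∈ T.elements, p ∈ convexHull ℝ (o : Set (Sp d)) → ∃ c : ℝ, c ≠ 0 ∧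
      ∀ᶠ y in 𝓝 p, (y ∈ convexHull ℝ (o : Set (Sp d)) ↔ 0 ≤ c * inner ℝ n0 (y - p)) := by
    intro o ho hpo
    have hoi := affineIndependent ho
    -- By conformity `p` lies in the hull of `s ∩ o`; since all its weights in `s` are positive, no
    -- vertex of `s` can be missing from `o`.
    have hso : s ⊆ o := by
      have hmem : p ∈ convexHull ℝ ((s ∩ o : Finset (Sp d)) : Set (Sp d)) := by
        rw [Finset.coe_inter]
        exact T.complex.inter_subset_convexHull hsf (mem_elements.1 ho).1 ⟨hps, hpo⟩
      obtain ⟨w', -, hw'1, hw'p⟩ := Finset.mem_convexHull'.1 hmem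
      intro q hq
      have h1 : bary s q p = w q := by
        rw [← hwp, bary_of_weights hsi subset_rfl hw1 hq, if_pos hq]
      have h2 : bary s q p = if q ∈ s ∩ o then w' q else 0 := by
        rw [← hw'p, bary_of_weights hsi Finset.inter_subset_left hw'1 hq]
      by_contra hqo
      rw [if_neg (by simp [hqo]), h1] at h2
      exact (hw0 q hq).ne' h2
    obtain ⟨a, hao, has⟩ : ∃ a ∈ o, a ∉ s := by
      by_contra! hcon
      have := Finset.card_le_card hcon
      rw [hcard, (mem_elements.1 ho).2] at this
      omega
    have hos : ∀ q ∈ o, q ≠ a → q ∈ s := by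
      have : insert a s = o := Finset.eq_of_subset_of_card_le
        (Finset.insert_subset hao hso) (by rw [Finset.card_insert_of_notMem has, hcard, (mem_elements.1 ho).2])
      intro q hq hqa
      rw [← this] at hq
      exact (Finset.mem_insert.1 hq).resolve_left hqa
    set L := (bary o a).linear with hL
    have hLp : ∀ y, bary o a y = L (y - p) := by
      intro y
      have h1 : bary o a p = 0 := by
        rw [← hwp, bary_of_weights hoi hso hw1 hao, if_neg has]
      have := (bary o a).linearMap_vsub y p
      rw [vsub_eq_sub, vsub_eq_sub, h1, sub_zero] at this
      exact this.symm
    have hLW : ∀ u ∈ W, L u = 0 := by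
      have : W ≤ LinearMap.ker L := by
        rw [hW, vectorSpan_def, Submodule.span_le]
        rintro _ ⟨q, hq, r, hr, rfl⟩
        rw [SetLike.mem_coe, LinearMap.mem_ker]
        change L (q -ᵥ r) = 0
        rw [hL, AffineMap.linearMap_vsub, bary_apply hoi hao (hso hq), bary_apply hoi hao (hso hr),
          if_neg (by rintro rfl; exact has hq), if_neg (by rintro rfl; exact has hr)]
        simp
      exact fun u hu => this hu
    -- `L` is the linear part of the coordinate of the vertex `a` opposite to `s`. It vanishes on
    -- the hyperplane `W`, so it is a multiple of the inner product with `n0`.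
    have hLn : ∀ u, L u = L n0 * inner ℝ n0 u := by
      intro u
      have hu : u ∈ W ⊔ Submodule.span ℝ {v} := htop ▸ trivial
      have hn : n0 ∈ W ⊔ Submodule.span ℝ {v} := htop ▸ trivial
      obtain ⟨u1, hu1, u2, hu2, rfl⟩ := Submodule.mem_sup.1 hu
      obtain ⟨n1, hn1, n2, hn2, hnn⟩ := Submodule.mem_sup.1 hn
      obtain ⟨α, rfl⟩ := Submodule.mem_span_singleton.1 hu2
      obtain ⟨β, rfl⟩ := Submodule.mem_span_singleton.1 hn2
      have e1 : inner ℝ n0 u1 = 0 := Submodule.inner_left_of_mem_orthogonal hu1 hn0W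
      have e2 : L n0 = β * L v := by
        rw [← hnn, map_add, hLW n1 hn1, map_smul, zero_add, smul_eq_mul]
      have e3 : β * inner ℝ n0 v = 1 := by
        have h4 : inner ℝ n0 n1 = 0 := Submodule.inner_left_of_mem_orthogonal hn1 hn0W
        have h5 : inner ℝ n0 n0 = (1 : ℝ) := by rw [real_inner_self_eq_norm_sq, hn01]; norm_num
        nth_rewrite 2 [← hnn] at h5
        rw [inner_add_right, h4, inner_smul_right, zero_add] at h5
        exact h5
      rw [map_add, hLW u1 hu1, map_smul, inner_add_right, e1, inner_smul_right, e2, smul_eq_mul]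
      linear_combination (-α * L v) * e3
    refine ⟨L n0, fun h0 => ?_, ?_⟩
    · have h1 := hLp a
      rw [hLn, h0, zero_mul, bary_apply hoi hao hao, if_pos rfl] at h1
      norm_num at h1
    -- Near `p` the coordinates belonging to `s` stay positive, so membership in `o` depends only on
    -- the sign of the coordinate of `a`.
    · have hpos : ∀ᶠ y in 𝓝 p, ∀ q ∈ s, 0 < bary o q y := by
        rw [Filter.eventually_all_finset]
        intro q hq
        refine (continuous_bary o q).continuousAt.eventually (lt_mem_nhds ?_)
        rw [← hwp, bary_of_weights hoi hso hw1 (hso hq), if_pos hq]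
        exact hw0 q hq
      filter_upwards [hpos] with y hy
      rw [mem_convexHull_iff_bary hoi, ← hLn, ← hLp]
      refine ⟨fun h => h.2 a hao, fun h => ⟨mem_affineSpan ho y, fun q hq => ?_⟩⟩
      by_cases hqa : q = a
      · rw [hqa]; exact h
      · exact (hy q (hos q hq hqa)).le
  choose! c hc0 hc using hhalf
  set Ep := T.elements.filter fun o : Finset (Sp d) => p ∈ convexHull ℝ (o : Set (Sp d)) with hEp
  have hclos : ∀ᶠ y in 𝓝 p, (y ∈ closure pb.Ω ↔ ∃ o ∈ Ep, 0 ≤ c o * inner ℝ n0 (y - p)) := by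
    have h1 : ∀ᶠ y in 𝓝 p, ∀ o ∈ T.elements, p ∉ convexHull ℝ (o : Set (Sp d)) →
        y ∉ convexHull ℝ (o : Set (Sp d)) := by
      rw [Filter.eventually_all_finset]
      intro o ho
      rw [eventually_imp_distrib_left]
      exact fun h => (isCompact_convexHull_finset o).isClosed.isOpen_compl.mem_nhds h
    have h2 : ∀ᶠ y in 𝓝 p, ∀ o ∈ Ep,
        (y ∈ convexHull ℝ (o : Set (Sp d)) ↔ 0 ≤ c o * inner ℝ n0 (y - p)) := by
      rw [Filter.eventually_all_finset]
      exact fun o ho => hc o (Finset.mem_filter.1 ho).1 (Finset.mem_filter.1 ho).2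
    filter_upwards [h1, h2] with y hy1 hy2
    rw [closure_eq (T := T)]
    simp only [Set.mem_iUnion, exists_prop]
    constructor
    · rintro ⟨o, ho, hyo⟩
      have hoE : o ∈ Ep := Finset.mem_filter.2 ⟨ho, by_contra fun h => hy1 o ho h hyo⟩
      exact ⟨o, hoE, (hy2 o hoE).1 hyo⟩
    · rintro ⟨o, ho, hyo⟩
      exact ⟨o, (Finset.mem_filter.1 ho).1, (hy2 o ho).2 hyo⟩
  have hoEp : o ∈ Ep := Finset.mem_filter.2 ⟨ho, hpo⟩
  have hEc : ∀ o ∈ Ep, c o ≠ 0 := fun o ho =>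
    hc0 o (Finset.mem_filter.1 ho).1 (Finset.mem_filter.1 ho).2
  -- The sign of `c o` tells on which side of the hyperplane the element lies. If all elements at
  -- `p` are on one side, the closure of `Ω` is a half space near `p`, with normal `-n0` or `n0`.
  by_cases hpos : ∀ o ∈ Ep, 0 < c o
  · refine ⟨p, -n0, isOuterNormal_of_closure pb.interior_closure_Ω (by simpa using hn01) ?_,
      by simpa using hn0v⟩
    filter_upwards [hclos] with y hy
    rw [hy, inner_neg_left, neg_nonpos]
    constructor
    · rintro ⟨o, ho, h⟩
      exact nonneg_of_mul_nonneg_right h (hpos o ho)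
    · exact fun h => ⟨o, hoEp, mul_nonneg (hpos o hoEp).le h⟩
  by_cases hneg : ∀ o ∈ Ep, c o < 0
  · refine ⟨p, n0, isOuterNormal_of_closure pb.interior_closure_Ω hn01 ?_, hn0v⟩
    filter_upwards [hclos] with y hy
    rw [hy]
    constructor
    · rintro ⟨o, ho, h⟩
      exact nonpos_of_mul_nonneg_right h (hneg o ho)
    · exact fun h => ⟨o, hoEp, mul_nonneg_of_nonpos_of_nonpos (hneg o hoEp).le h⟩
  -- With elements on both sides, the closure would contain a neighbourhood of `p`, so `p` would
  -- belong to `Ω`.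
  · exfalso
    push Not at hpos hneg
    obtain ⟨o1, ho1, h1⟩ := hpos
    obtain ⟨o2, ho2, h2⟩ := hneg
    refine hpΩ ?_
    rw [← pb.interior_closure_Ω, mem_interior_iff_mem_nhds]
    filter_upwards [hclos] with y hy
    rw [hy]
    rcases le_total 0 (inner ℝ n0 (y - p)) with h | h
    · exact ⟨o2, ho2, mul_nonneg h2 h⟩
    · exact ⟨o1, ho1, mul_nonneg_of_nonpos_of_nonpos h1 h⟩

end BulkMesh

end

/-! ### Boundary conditions, the kernel form of Korn's inequality, and the slip term -/

section

section Boundary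

variable {d : ℕ} {pb : FlowProblem d} {T : BulkMesh pb.Ω}

/-- The set is isometric to a ball in a space of dimension `d - 1`. Boundary conditions hold only
almost everywhere; this positivity together with continuity makes them pointwise. -/
theorem euclideanHausdorffMeasure_hyperplane_inter_ball_ne_zero {n : Sp d} (hn : n ≠ 0) (q : Sp d)
    {ε : ℝ} (hε : 0 < ε) :
    (μHE[d - 1] : Measure (Sp d)) ({y | inner ℝ n (y - q) = 0} ∩ Metric.ball q ε) ≠ 0 := by
  set W : Submodule ℝ (Sp d) := (Submodule.span ℝ {n})ᗮ with hW
  have hdim : Module.finrank ℝ W = d - 1 := by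
    have h1 := (Submodule.span ℝ {n}).finrank_add_finrank_orthogonal
    rw [finrank_span_singleton hn, finrank_euclideanSpace_fin, ← hW] at h1
    omega
  have e : {y | inner ℝ n (y - q) = 0} ∩ Metric.ball q ε =
      (fun y => q + y) '' (Subtype.val '' Metric.ball (0 : W) ε) := by
    ext y
    constructor
    · rintro ⟨h1, h2⟩
      refine ⟨y - q, ⟨⟨y - q, Submodule.mem_orthogonal_singleton_iff_inner_right.2 h1⟩, ?_, rfl⟩,
        by simp⟩
      rw [Metric.mem_ball, dist_eq_norm] at h2 ⊢
      simpa using h2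
    · rintro ⟨_, ⟨w, hw, rfl⟩, rfl⟩
      rw [Metric.mem_ball, dist_eq_norm] at hw
      refine ⟨?_, by simpa [dist_eq_norm] using hw⟩
      simpa using Submodule.mem_orthogonal_singleton_iff_inner_right.1 w.2
  rw [e, euclideanHausdorffMeasure_add_image, ← hdim, euclideanHausdorffMeasure_subtype_image]
  exact (Metric.measure_ball_pos volume _ hε).ne'

/-- The common consequence of no-slip and slip conditions; it is all that the exclusion of rigid
motions uses. -/
theorem FlowProblem.BoundaryConditions.ae_inner_outerNormal {φ : Sp d → Sp d}
    (h : pb.BoundaryConditions φ) :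
    ∀ᵐ x ∂(μHE[d - 1] : Measure (Sp d)), x ∈ frontier pb.Ω →
      inner ℝ (φ x) (outerNormal pb.Ω x) = 0 := by
  obtain ⟨h1, h2⟩ := h
  rw [ae_restrict_iff' pb.measurableSet_bd₁] at h1
  rw [ae_restrict_iff' pb.measurableSet_bd₂] at h2
  filter_upwards [h1, h2] with x hx1 hx2 hx
  rw [← pb.union_bd] at hx
  rcases hx with hx | hx
  · rw [hx1 hx, inner_zero_left]
  · exact hx2 hx

/-- Near `p` the points of the tangent hyperplane are boundary points with the same normal. If the
normal component were nonzero at one of them, it would be so, by continuity, on a piece of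
hyperplane of positive measure. -/
theorem FlowProblem.BoundaryConditions.eventually_inner_eq_zero {φ : Sp d → Sp d}
    (h : pb.BoundaryConditions φ) (hφ : ContinuousOn φ (closure pb.Ω)) {p n : Sp d}
    (hn : IsOuterNormal pb.Ω p n) :
    ∀ᶠ y in 𝓝 p, inner ℝ n (y - p) = 0 → inner ℝ (φ y) n = 0 := by
  filter_upwards [hn.eventually.eventually_nhds] with y hy h0
  by_contra hne
  have hyn : IsOuterNormal pb.Ω y n := hy.self_of_nhds h0
  have hc : ContinuousWithinAt (fun z => inner ℝ (φ z) n) (closure pb.Ω) y :=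
    (hφ y hyn.mem_frontier.1).inner continuousWithinAt_const
  have h1 : ∀ᶠ z in 𝓝 y, z ∈ closure pb.Ω → inner ℝ (φ z) n ≠ 0 :=
    eventually_nhdsWithin_iff.1 (hc.eventually_ne hne)
  obtain ⟨ε, hε, hball⟩ := Metric.eventually_nhds_iff_ball.1 (h1.and hy)
  refine euclideanHausdorffMeasure_hyperplane_inter_ball_ne_zero
    (n := n) (by rintro rfl; simpa using hn.1) y hε ?_
  refine measure_mono_null (fun z hz => ?_) (ae_iff.1 h.ae_inner_outerNormal)
  obtain ⟨hz0, hzb⟩ := hz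
  obtain ⟨hz1, hz2⟩ := hball z hzb
  have hzn : IsOuterNormal pb.Ω z n := hz2 (by
    rw [show z - p = (z - y) + (y - p) by abel, inner_add_right, h0, add_zero]
    exact hz0)
  simp only [Set.mem_ofPred_eq, Classical.not_imp]
  refine ⟨hzn.mem_frontier, ?_⟩
  rw [outerNormal_eq hzn]
  exact hz1 hzn.mem_frontier.1

/-- A rigid motion that satisfies the boundary conditions vanishes. -/
theorem eq_zero_of_rigid (T : BulkMesh pb.Ω) {φ : Sp d → Sp d} (h : pb.BoundaryConditions φ)
    {A : Sp d →ₗ[ℝ] Sp d} {b : Sp d} (hA : ∀ v, inner ℝ (A v) v = 0)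
    (hφ : ∀ x ∈ closure pb.Ω, φ x = A x + b) : ∀ x ∈ closure pb.Ω, φ x = 0 := by
  have hskew : ∀ v w, inner ℝ (A v) w = - inner ℝ (A w) v := by
    intro v w
    have := hA (v + w)
    rw [map_add, inner_add_left, inner_add_right, inner_add_right, hA, hA] at this
    linarith
  have hcA : Continuous A := A.continuous_of_finiteDimensional
  have hφc : ContinuousOn φ (closure pb.Ω) :=
    (hcA.add continuous_const).continuousOn.congr hφ
  have hker : ∀ p n, IsOuterNormal pb.Ω p n → A n = 0 ∧ inner ℝ b n = 0 := by
    intro p n hn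
    have hev := (h.eventually_inner_eq_zero hφc hn).and hn.eventually
    have hval : ∀ y, inner ℝ n (y - p) = 0 → (inner ℝ n (y - p) = 0 → inner ℝ (φ y) n = 0) →
        (inner ℝ n (y - p) = 0 → IsOuterNormal pb.Ω y n) → inner ℝ (A y + b) n = 0 := by
      intro y h0 h1 h2
      rw [← hφ y (h2 h0).mem_frontier.1]
      exact h1 h0
    have hp : inner ℝ (A p + b) n = 0 := hval p (by simp) hev.self_of_nhds.1 hev.self_of_nhds.2
    -- Since `A` is skew, `A n` is tangential. Moving from `p` in this direction changes the normal
    -- component of the rigid motion by `-t |A n|²`, and it must stay zero.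
    have hAn : A n = 0 := by
      obtain ⟨t, ht, h1, h2⟩ := eventually_add_smul p (A n) hev
      have h3 := hval (p + t • A n) (by
        rw [add_sub_cancel_left, inner_smul_right, real_inner_comm, hA, mul_zero]) h1 h2
      rw [map_add, map_smul, add_right_comm, inner_add_left, hp, zero_add, inner_smul_left,
        hskew] at h3
      have h4 : inner ℝ (A n) (A n) = 0 := by
        simpa [ht.ne'] using h3
      exact inner_self_eq_zero.1 h4
    refine ⟨hAn, ?_⟩
    rwa [inner_add_left, hskew, hAn, inner_zero_left, neg_zero, zero_add] at hp
  -- Every outer normal lies in `ker A ∩ b^⊥`. A nonzero vector orthogonal to this subspace would be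
  -- orthogonal to all normals, which is impossible.
  have hK : LinearMap.ker A ⊓ (Submodule.span ℝ {b})ᗮ = ⊤ := by
    by_contra hne
    have h1 : (LinearMap.ker A ⊓ (Submodule.span ℝ {b})ᗮ)ᗮ ≠ ⊥ := by
      rwa [Ne, Submodule.orthogonal_eq_bot_iff]
    obtain ⟨v, hv, hv0⟩ := Submodule.exists_mem_ne_zero_of_ne_bot h1
    obtain ⟨p, n, hn, hnv⟩ := T.exists_isOuterNormal_inner_ne_zero hv0
    obtain ⟨h2, h3⟩ := hker p n hn
    exact hnv (Submodule.inner_right_of_mem_orthogonal (Submodule.mem_inf.2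
      ⟨h2, Submodule.mem_orthogonal_singleton_iff_inner_right.2 h3⟩) hv)
  have hA0 : ∀ x, A x = 0 := fun x =>
    (Submodule.mem_inf.1 (hK ▸ Submodule.mem_top : x ∈ LinearMap.ker A ⊓ (Submodule.span ℝ {b})ᗮ)).1
  have hb0 : b = 0 := (inner_self_eq_zero (𝕜 := ℝ)).1 (Submodule.mem_orthogonal_singleton_iff_inner_right.1
    (Submodule.mem_inf.1 (hK ▸ Submodule.mem_top : b ∈ LinearMap.ker A ⊓ (Submodule.span ℝ {b})ᗮ)).2)
  intro x hx
  rw [hφ x hx, hA0, hb0, add_zero]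

/-- A discrete version of Korn's inequality, as a statement on kernels. -/
theorem eq_zero_of_deform_eq_zero {U : Sp d → Sp d} {k : ℕ} (hU : T.MemSVec k U)
    (hbc : pb.BoundaryConditions U) (h : ∀ o ∈ T.elements, ∀ x ∈ openSimplex o, deform U x = 0) :
    U = 0 := by
  obtain ⟨A, b, hA, hUA⟩ := exists_rigid_of_deform_eq_zero hU h
  funext x
  by_cases hx : x ∈ closure pb.Ω
  · exact eq_zero_of_rigid T hbc hA hUA x hx
  · exact hU.eq_zero_of_notMem hx

/-- A boundary point lies in no open element, so the smallest face containing it has at most `d`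
vertices; there are finitely many such faces. -/
theorem euclideanHausdorffMeasure_frontier_lt_top (hd : 0 < d) (T : BulkMesh pb.Ω) :
    (μHE[d - 1] : Measure (Sp d)) (frontier pb.Ω) < ⊤ := by
  have hsub : frontier pb.Ω ⊆ ⋃ s ∈ {s ∈ T.complex.faces | s.card ≤ d},
      convexHull ℝ (s : Set (Sp d)) := by
    intro p hp
    rw [pb.isOpen_Ω.frontier_eq] at hp
    have hpc := hp.1
    rw [BulkMesh.closure_eq (T := T)] at hpc
    simp only [Set.mem_iUnion, exists_prop] at hpc
    obtain ⟨o, ho, hpo⟩ := hpc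
    obtain ⟨s, hso, hsne, w, hw0, hw1, hwp⟩ :=
      exists_face_bary_pos (BulkMesh.affineIndependent ho) hpo
    have hsf : s ∈ T.complex.faces := T.complex.down_closed (BulkMesh.mem_elements.1 ho).1 hso hsne
    refine Set.mem_biUnion (x := s) ⟨hsf, ?_⟩
      (Finset.mem_convexHull'.2 ⟨w, fun q hq => (hw0 q hq).le, hw1, hwp⟩)
    by_contra hlt
    have h2 := (Finset.card_le_card hso).trans (BulkMesh.mem_elements.1 ho).2.le
    have hse : s ∈ T.elements := BulkMesh.mem_elements.2 ⟨hsf, by omega⟩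
    classical
    refine hp.2 (BulkMesh.openSimplex_subset hse (BulkMesh.setOf_bary_pos_subset hse fun q hq => ?_))
    rw [← hwp, bary_of_weights (T.complex.indep hsf) subset_rfl hw1 hq, if_pos hq]
    exact hw0 q hq
  refine (measure_mono hsub).trans_lt (measure_biUnion_lt_top
    (T.finite_faces.subset fun s hs => hs.1) fun s hs => ?_)
  exact euclideanHausdorffMeasure_convexHull_lt_top (T.complex.indep hs.1)
    (by have := hs.2; omega)

theorem sum_inner_stdOrthonormalBasis (n u ξ : Sp d) (hn : n = 0 ∨ ‖n‖ = 1) :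
    ∑ i, inner ℝ u (stdOrthonormalBasis ℝ (Submodule.span ℝ {n})ᗮ i : Sp d) *
      inner ℝ ξ (stdOrthonormalBasis ℝ (Submodule.span ℝ {n})ᗮ i : Sp d) =
    inner ℝ u ξ - inner ℝ u n * inner ℝ ξ n := by
  set W := (Submodule.span ℝ {n})ᗮ
  set B := stdOrthonormalBasis ℝ W
  have h1 : ∀ (x : Sp d) i, inner ℝ x (B i : Sp d) = inner ℝ (W.orthogonalProjectionOnto x) (B i) :=
    fun x i => by rw [Submodule.inner_orthogonalProjectionOnto_eq_of_mem_right]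
  simp only [h1]
  have h2 := B.sum_inner_mul_inner (W.orthogonalProjectionOnto u) (W.orthogonalProjectionOnto ξ)
  have h3 : ∀ i, inner ℝ (W.orthogonalProjectionOnto ξ) (B i) =
      inner ℝ (B i) (W.orthogonalProjectionOnto ξ) := fun i => real_inner_comm _ _
  simp only [h3, h2]
  rw [Submodule.inner_orthogonalProjectionOnto_eq_of_mem_right]
  have h4 : ((W.orthogonalProjectionOnto ξ : W) : Sp d) = ξ - inner ℝ n ξ • n := by
    change W.starProjection ξ = _
    rw [Submodule.starProjection_orthogonal_val]
    rcases hn with rfl | hn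
    · simp
    · rw [Submodule.starProjection_unit_singleton ℝ hn]
  rw [h4, inner_sub_right, inner_smul_right, real_inner_comm n ξ]
  ring

/-- The orthonormal basis is chosen point by point with no control of measurability. The tangential
inner product does not depend on it and can be written with the normal alone; this form also makes
sense where the normal takes its default value zero. -/
theorem slip_eq (pb : FlowProblem d) (u ξ : Sp d → Sp d) :
    pb.slip u ξ = ∫ x in pb.bd₂, (inner ℝ (u x) (ξ x) -
      inner ℝ (u x) (outerNormal pb.Ω x) * inner ℝ (ξ x) (outerNormal pb.Ω x))
        ∂(μHE[d - 1] : Measure (Sp d)) := by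
  rw [FlowProblem.slip]
  congr 1
  funext x
  refine sum_inner_stdOrthonormalBasis _ _ _ ?_
  rw [outerNormal]
  split_ifs with h
  · exact Or.inr h.choose_spec.1
  · exact Or.inl rfl

theorem slip_self_nonneg (pb : FlowProblem d) (u : Sp d → Sp d) : 0 ≤ pb.slip u u :=
  integral_nonneg fun _ => Finset.sum_nonneg fun _ _ => mul_self_nonneg _

theorem integrableOn_slip (hd : 0 < d) (T : BulkMesh pb.Ω) {u ξ : Sp d → Sp d}
    (hu : ContinuousOn u (closure pb.Ω)) (hξ : ContinuousOn ξ (closure pb.Ω)) :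
    IntegrableOn (fun x => inner ℝ (u x) (ξ x) -
      inner ℝ (u x) (outerNormal pb.Ω x) * inner ℝ (ξ x) (outerNormal pb.Ω x)) pb.bd₂
      (μHE[d - 1] : Measure (Sp d)) := by
  have hsub : pb.bd₂ ⊆ frontier pb.Ω := pb.union_bd ▸ Set.subset_union_right
  have hcl : frontier pb.Ω ⊆ closure pb.Ω := frontier_subset_closure
  have hK : IsCompact (frontier pb.Ω) :=
    Metric.isCompact_of_isClosed_isBounded isClosed_frontier
      (pb.isBounded_Ω.closure.subset hcl)
  have hfin : (μHE[d - 1] : Measure (Sp d)) (frontier pb.Ω) ≠ ⊤ :=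
    (euclideanHausdorffMeasure_frontier_lt_top hd T).ne
  refine IntegrableOn.mono_set (t := frontier pb.Ω) ?_ hsub
  have hint : ∀ {v : Sp d → Sp d}, ContinuousOn v (closure pb.Ω) →
      AEStronglyMeasurable v ((μHE[d - 1] : Measure (Sp d)).restrict (frontier pb.Ω)) :=
    fun hv => (hv.mono hcl).aestronglyMeasurable isClosed_frontier.measurableSet
  have hn := aestronglyMeasurable_outerNormal pb.isOpen_Ω
    ((μHE[d - 1] : Measure (Sp d)).restrict (frontier pb.Ω))
  obtain ⟨C, hC⟩ := hK.exists_bound_of_continuousOn (hu.mono hcl)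
  obtain ⟨C', hC'⟩ := hK.exists_bound_of_continuousOn (hξ.mono hcl)
  have : IsFiniteMeasure ((μHE[d - 1] : Measure (Sp d)).restrict (frontier pb.Ω)) :=
    ⟨by simpa using hfin.lt_top⟩
  refine Integrable.of_bound
    (((hint hu).inner (hint hξ)).sub (((hint hu).inner hn).mul ((hint hξ).inner hn)))
    (C * C' + C * C') ?_
  filter_upwards [ae_restrict_mem isClosed_frontier.measurableSet] with x hx
  have h1 := hC x hx
  have h2 := hC' x hx
  have h3 := norm_outerNormal_le pb.Ω x
  have h0 : 0 ≤ C := (norm_nonneg _).trans h1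
  have h0' : 0 ≤ C' := (norm_nonneg _).trans h2
  have e1 : ‖inner ℝ (u x) (ξ x)‖ ≤ C * C' :=
    (norm_inner_le_norm _ _).trans (mul_le_mul h1 h2 (norm_nonneg _) h0)
  have e2 : ‖inner ℝ (u x) (outerNormal pb.Ω x)‖ ≤ C * 1 :=
    (norm_inner_le_norm _ _).trans (mul_le_mul h1 h3 (norm_nonneg _) h0)
  have e3 : ‖inner ℝ (ξ x) (outerNormal pb.Ω x)‖ ≤ C' * 1 :=
    (norm_inner_le_norm _ _).trans (mul_le_mul h2 h3 (norm_nonneg _) h0')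
  rw [mul_one] at e2 e3
  refine (norm_sub_le _ _).trans (add_le_add e1 ?_)
  rw [norm_mul]
  exact mul_le_mul e2 e3 (norm_nonneg _) h0

theorem slip_add_left (hd : 0 < d) (T : BulkMesh pb.Ω) {u v ξ : Sp d → Sp d}
    (hu : ContinuousOn u (closure pb.Ω)) (hv : ContinuousOn v (closure pb.Ω))
    (hξ : ContinuousOn ξ (closure pb.Ω)) :
    pb.slip (u + v) ξ = pb.slip u ξ + pb.slip v ξ := by
  rw [slip_eq, slip_eq, slip_eq, ← integral_add (integrableOn_slip hd T hu hξ)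
    (integrableOn_slip hd T hv hξ)]
  congr 1
  funext x
  simp only [Pi.add_apply, inner_add_left]
  ring

theorem slip_smul_left (c : ℝ) (u ξ : Sp d → Sp d) :
    pb.slip (c • u) ξ = c * pb.slip u ξ := by
  rw [slip_eq, slip_eq, ← integral_const_mul]
  congr 1
  funext x
  simp only [Pi.smul_apply, inner_smul_left, conj_trivial]
  ring

theorem slip_comm (u ξ : Sp d → Sp d) : pb.slip u ξ = pb.slip ξ u := by
  rw [slip_eq, slip_eq]
  congr 1
  funext x
  rw [real_inner_comm]
  ring

end Boundary

end

/-! ### Polyhedral surfaces: facets, vertices, null overlaps -/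

section

namespace Surface

variable {d : ℕ} {Γ : Surface d} {σ : Finset (Sp d)}

theorem mem_facets : σ ∈ Γ.facets ↔ σ ∈ Γ.complex.faces ∧ σ.card = d := by
  classical
  simp [facets]

theorem affineIndependent (hσ : σ ∈ Γ.facets) : AffineIndependent ℝ ((↑) : σ → Sp d) :=
  Γ.complex.indep (mem_facets.1 hσ).1

theorem carrier_eq (Γ : Surface d) : Γ.carrier = ⋃ σ ∈ Γ.facets, closedSimplex σ := by
  ext x
  simp only [carrier, Geometry.SimplicialComplex.mem_space_iff, Set.mem_iUnion, exists_prop]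
  constructor
  · rintro ⟨s, hs, hx⟩
    obtain ⟨o, ho, hso, hc⟩ := Γ.pure s hs
    exact ⟨o, mem_facets.2 ⟨ho, hc⟩, convexHull_mono (by exact_mod_cast hso) hx⟩
  · rintro ⟨o, ho, hx⟩
    exact ⟨o, (mem_facets.1 ho).1, hx⟩

theorem mem_carrier_iff {x : Sp d} : x ∈ Γ.carrier ↔ ∃ σ ∈ Γ.facets, x ∈ closedSimplex σ := by
  rw [carrier_eq]
  simp

theorem closedSimplex_subset_carrier (hσ : σ ∈ Γ.facets) : closedSimplex σ ⊆ Γ.carrier :=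
  fun _ hx => mem_carrier_iff.2 ⟨σ, hσ, hx⟩

theorem mem_closedSimplex_of_mem {q : Sp d} (hq : q ∈ σ) : q ∈ closedSimplex σ :=
  subset_convexHull ℝ _ hq

theorem isCompact_closedSimplex (σ : Finset (Sp d)) : IsCompact (closedSimplex σ) :=
  isCompact_convexHull_finset σ

theorem mem_vertices_of_mem {q : Sp d} (hσ : σ ∈ Γ.facets) (hq : q ∈ σ) :
    q ∈ Γ.complex.vertices := by
  rw [Geometry.SimplicialComplex.vertices_eq]
  exact Set.mem_biUnion (mem_facets.1 hσ).1 hq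

theorem exists_facet_of_mem_vertices {q : Sp d} (hq : q ∈ Γ.complex.vertices) :
    ∃ σ ∈ Γ.facets, q ∈ σ := by
  obtain ⟨σ, hσ, hqσ, hc⟩ := Γ.pure _ hq
  exact ⟨σ, mem_facets.2 ⟨hσ, hc⟩, Finset.singleton_subset_iff.1 hqσ⟩

theorem finite_vertices (Γ : Surface d) : Γ.complex.vertices.Finite := by
  rw [Geometry.SimplicialComplex.vertices_eq]
  exact Γ.finite_faces.biUnion fun s _ => s.finite_toSet

theorem mem_star {q : Sp d} (hq : q ∈ Γ.complex.vertices) :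
    σ ∈ Γ.star q ↔ σ ∈ Γ.facets ∧ q ∈ σ := by
  classical
  rw [star, Finset.mem_filter]
  refine and_congr_right fun hσ => ?_
  exact Γ.complex.vertex_mem_convexHull_iff hq (mem_facets.1 hσ).1

theorem measure_closedSimplex_lt_top (hσ : σ ∈ Γ.facets) :
    (μHE[d - 1] : Measure (Sp d)) (closedSimplex σ) < ⊤ :=
  euclideanHausdorffMeasure_convexHull_lt_top (affineIndependent hσ)
    (by have := (mem_facets.1 hσ).2; omega)

/-- Almost every point of a facet has positive barycentric coordinates. -/
theorem ae_bary_pos (hσ : σ ∈ Γ.facets) :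
    ∀ᵐ x ∂((μHE[d - 1] : Measure (Sp d)).restrict (closedSimplex σ)),
      x ∈ closedSimplex σ ∧ ∀ q ∈ σ, 0 < bary σ q x := by
  classical
  have hmeas : MeasurableSet (closedSimplex σ) := (isCompact_closedSimplex σ).measurableSet
  have h : ∀ᵐ x ∂(μHE[d - 1] : Measure (Sp d)), ∀ q ∈ σ,
      x ∉ convexHull ℝ ((σ.erase q : Finset (Sp d)) : Set (Sp d)) := by
    rw [Filter.eventually_all_finset]
    intro q hq
    refine measure_eq_zero_iff_ae_notMem.1 (euclideanHausdorffMeasure_convexHull_eq_zero _ ?_)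
    rw [Finset.card_erase_of_mem hq, (mem_facets.1 hσ).2]
  rw [ae_restrict_iff' hmeas]
  filter_upwards [h] with x hx hxσ
  refine ⟨hxσ, fun q hq => ?_⟩
  obtain ⟨hxa, hx0⟩ := (mem_convexHull_iff_bary (affineIndependent hσ)).1 hxσ
  refine lt_of_le_of_ne (hx0 q hq) fun h0 => hx q hq ?_
  have h1 := sum_bary (affineIndependent hσ) hxa
  have h2 := sum_bary_smul (affineIndependent hσ) hxa
  rw [← Finset.add_sum_erase _ _ hq, ← h0, zero_add] at h1
  rw [← Finset.add_sum_erase _ _ hq, ← h0, zero_smul, zero_add] at h2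
  exact Finset.mem_convexHull'.2
    ⟨fun r => bary σ r x, fun r hr => hx0 r (Finset.mem_of_mem_erase hr), h1, h2⟩

/-- The facets only overlap in null sets. -/
theorem sum_area_le_measure_carrier (Γ : Surface d) :
    ∑ σ ∈ Γ.facets, area σ ≤ ((μHE[d - 1] : Measure (Sp d)) Γ.carrier).toReal := by
  classical
  have hdisj : Set.Pairwise (Γ.facets : Set (Finset (Sp d)))
      (Function.onFun (AEDisjoint (μHE[d - 1] : Measure (Sp d))) closedSimplex) := by
    intro σ hσ τ hτ hne
    have hc1 := (mem_facets.1 hσ).2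
    have hc2 := (mem_facets.1 hτ).2
    refine measure_mono_null (t := convexHull ℝ ((σ ∩ τ : Finset (Sp d)) : Set (Sp d))) ?_
      (euclideanHausdorffMeasure_convexHull_eq_zero _ ?_)
    · rw [Finset.coe_inter]
      exact Γ.complex.inter_subset_convexHull (mem_facets.1 hσ).1 (mem_facets.1 hτ).1
    · by_contra hlt
      have e1 : σ ∩ τ = σ := Finset.eq_of_subset_of_card_le Finset.inter_subset_left (by omega)
      have e2 : σ ∩ τ = τ := Finset.eq_of_subset_of_card_le Finset.inter_subset_right (by omega)
      exact hne (e1.symm.trans e2)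
  rw [carrier_eq, measure_biUnion_finset₀ hdisj
    fun σ _ => (isCompact_closedSimplex σ).measurableSet.nullMeasurableSet,
    ENNReal.toReal_sum fun σ hσ => (measure_closedSimplex_lt_top hσ).ne]
  exact le_rfl

/-! ### Piecewise linear functions on the surface -/

section PiecewiseLinear

variable {F : Type*} [NormedAddCommGroup F] [NormedSpace ℝ F]

variable (Γ F) in
/-- The functions that are continuous and piecewise affine on the surface, extended by zero. -/
def plSpace : Submodule ℝ (Sp d → F) where
  carrier := {X | (∀ x ∉ Γ.carrier, X x = 0) ∧ ContinuousOn X Γ.carrier ∧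
    ∀ σ ∈ Γ.facets, ∃ g : Sp d →ᵃ[ℝ] F, ∀ x ∈ closedSimplex σ, X x = g x}
  add_mem' := by
    rintro X Y ⟨h1, h2, h3⟩ ⟨k1, k2, k3⟩
    refine ⟨fun x hx => by simp [h1 x hx, k1 x hx], h2.add k2, fun σ hσ => ?_⟩
    obtain ⟨g, hg⟩ := h3 σ hσ
    obtain ⟨k, hk⟩ := k3 σ hσ
    exact ⟨g + k, fun x hx => by simp [hg x hx, hk x hx]⟩
  zero_mem' := ⟨fun _ _ => rfl, continuousOn_const, fun _ _ => ⟨0, fun _ _ => rfl⟩⟩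
  smul_mem' := by
    rintro c X ⟨h1, h2, h3⟩
    refine ⟨fun x hx => by simp [h1 x hx], h2.const_smul c, fun σ hσ => ?_⟩
    obtain ⟨g, hg⟩ := h3 σ hσ
    exact ⟨c • g, fun x hx => by simp [hg x hx]⟩

theorem apply_eq_sum_bary {X : Sp d → F} (hX : X ∈ Γ.plSpace F) (hσ : σ ∈ Γ.facets) {x : Sp d}
    (hx : x ∈ closedSimplex σ) : X x = ∑ q ∈ σ, bary σ q x • X q := by
  obtain ⟨g, hg⟩ := hX.2.2 σ hσ
  rw [hg x hx, affine_apply_eq_sum_bary (affineIndependent hσ) (convexHull_subset_affineSpan _ hx) g]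
  exact Finset.sum_congr rfl fun q hq => by rw [hg q (mem_closedSimplex_of_mem hq)]

theorem eq_zero_of_vertices {X : Sp d → F} (hX : X ∈ Γ.plSpace F)
    (h : ∀ q ∈ Γ.complex.vertices, X q = 0) : X = 0 := by
  funext x
  by_cases hx : x ∈ Γ.carrier
  · obtain ⟨σ, hσ, hxσ⟩ := mem_carrier_iff.1 hx
    rw [apply_eq_sum_bary hX hσ hxσ]
    exact Finset.sum_eq_zero fun q hq => by rw [h q (mem_vertices_of_mem hσ hq), smul_zero]
  · exact hX.1 x hx

instance finiteDimensional_plSpace [FiniteDimensional ℝ F] :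
    FiniteDimensional ℝ (Γ.plSpace F) := by
  have := Γ.finite_vertices.to_subtype
  let Φ : Γ.plSpace F →ₗ[ℝ] (Γ.complex.vertices → F) :=
    { toFun := fun X q => (X : Sp d → F) q
      map_add' := fun _ _ => rfl
      map_smul' := fun _ _ => rfl }
  refine FiniteDimensional.of_injective Φ ((injective_iff_map_eq_zero Φ).2 fun X hX => ?_)
  exact Subtype.ext (eq_zero_of_vertices X.2 fun q hq => congrFun hX ⟨q, hq⟩)

theorem continuousOn_carrier {F : Type*} [TopologicalSpace F] {X : Sp d → F}
    (h : ∀ σ ∈ Γ.facets, ContinuousOn X (closedSimplex σ)) : ContinuousOn X Γ.carrier := by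
  have : Γ.carrier = ⋃ σ : Γ.facets, closedSimplex (σ : Finset (Sp d)) := by
    rw [carrier_eq, Set.iUnion_subtype]
  rw [this]
  exact (locallyFinite_of_finite _).continuousOn_iUnion
    (fun σ => (isCompact_closedSimplex _).isClosed) fun σ => h σ σ.2

open Classical in
/-- There is a piecewise linear function with prescribed values at the vertices. -/
theorem exists_plSpace_vertices (Γ : Surface d) (a : Sp d → ℝ) :
    ∃ χ ∈ Γ.plSpace ℝ, ∀ q ∈ Γ.complex.vertices, χ q = a q := by
  let χ : Sp d → ℝ := fun x => if h : ∃ σ ∈ Γ.facets, x ∈ closedSimplex σ then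
    ∑ q ∈ h.choose, bary h.choose q x * a q else 0
  -- Two facets meet in the hull of their common vertices, where the coordinates of all other
  -- vertices vanish, so the facetwise interpolants agree.
  have hwd : ∀ σ ∈ Γ.facets, ∀ τ ∈ Γ.facets, ∀ x ∈ closedSimplex σ, x ∈ closedSimplex τ →
      ∑ q ∈ σ, bary σ q x * a q = ∑ q ∈ τ, bary τ q x * a q := by
    intro σ hσ τ hτ x hxσ hxτ
    have hmem : x ∈ convexHull ℝ ((σ ∩ τ : Finset (Sp d)) : Set (Sp d)) := by
      rw [Finset.coe_inter]
      exact Γ.complex.inter_subset_convexHull (mem_facets.1 hσ).1 (mem_facets.1 hτ).1 ⟨hxσ, hxτ⟩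
    obtain ⟨w, -, hw1, rfl⟩ := Finset.mem_convexHull'.1 hmem
    have key : ∀ ρ ∈ Γ.facets, σ ∩ τ ⊆ ρ →
        ∑ q ∈ ρ, bary ρ q (∑ y ∈ σ ∩ τ, w y • y) * a q = ∑ q ∈ σ ∩ τ, w q * a q := by
      intro ρ hρ hsub
      rw [← Finset.sum_subset hsub fun q hq hqn => by
        rw [bary_of_weights (affineIndependent hρ) hsub hw1 hq, if_neg hqn, zero_mul]]
      exact Finset.sum_congr rfl fun q hq => by
        rw [bary_of_weights (affineIndependent hρ) hsub hw1 (hsub hq), if_pos hq]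
    rw [key σ hσ Finset.inter_subset_left, key τ hτ Finset.inter_subset_right]
  have hχ : ∀ σ ∈ Γ.facets, ∀ x ∈ closedSimplex σ, χ x = ∑ q ∈ σ, bary σ q x * a q := by
    intro σ hσ x hx
    have h : ∃ σ ∈ Γ.facets, x ∈ closedSimplex σ := ⟨σ, hσ, hx⟩
    simp only [χ, dif_pos h]
    exact hwd _ h.choose_spec.1 σ hσ x h.choose_spec.2 hx
  have haff : ∀ σ ∈ Γ.facets, ∀ x ∈ closedSimplex σ, χ x = (∑ q ∈ σ, a q • bary σ q) x := by
    intro σ hσ x hx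
    have hsum : ∀ s : Finset (Sp d),
        (∑ q ∈ s, a q • bary σ q) x = ∑ q ∈ s, bary σ q x * a q := by
      intro s
      induction s using Finset.induction_on with
      | empty => simp
      | insert q s hq ih =>
        rw [Finset.sum_insert hq, Finset.sum_insert hq, AffineMap.coe_add, Pi.add_apply, ih,
          AffineMap.coe_smul, Pi.smul_apply, smul_eq_mul, mul_comm]
    rw [hχ σ hσ x hx, hsum]
  refine ⟨χ, ⟨fun x hx => ?_, continuousOn_carrier fun σ hσ => ?_, fun σ hσ => ⟨_, haff σ hσ⟩⟩,
    fun q hq => ?_⟩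
  · exact dif_neg fun h => hx (mem_carrier_iff.2 h)
  · exact (AffineMap.continuous_of_finiteDimensional _).continuousOn.congr (haff σ hσ)
  · obtain ⟨σ, hσ, hqσ⟩ := exists_facet_of_mem_vertices hq
    rw [hχ σ hσ q (mem_closedSimplex_of_mem hqσ), Finset.sum_eq_single q]
    · rw [bary_apply (affineIndependent hσ) hqσ hqσ, if_pos rfl, one_mul]
    · intro r hr hrq
      rw [bary_apply (affineIndependent hσ) hr hqσ, if_neg hrq, zero_mul]
    · exact fun h => absurd hqσ h

theorem smul_mem_plSpace {χ : Sp d → ℝ} (hχ : χ ∈ Γ.plSpace ℝ) (v : F) :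
    (fun x => χ x • v) ∈ Γ.plSpace F := by
  refine ⟨fun x hx => by simp [hχ.1 x hx], hχ.2.1.smul continuousOn_const, fun σ hσ => ?_⟩
  obtain ⟨g, hg⟩ := hχ.2.2 σ hσ
  exact ⟨(LinearMap.toSpanSingleton ℝ F v).toAffineMap.comp g, fun x hx => by simp [hg x hx]⟩

/-- The tangential gradient on the facet `σ` of the affine function with the vertex values of
`X`, extended by zero in the normal direction. -/
def tangGrad (σ : Finset (Sp d)) (X : Sp d → F) : Sp d →ₗ[ℝ] F :=
  ∑ q ∈ σ, ((bary σ q).linear ∘ₗ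
    (vectorSpan ℝ (σ : Set (Sp d))).starProjection.toLinearMap).smulRight (X q)

theorem tangGrad_apply (σ : Finset (Sp d)) (X : Sp d → F) (v : Sp d) :
    tangGrad σ X v = ∑ q ∈ σ,
      (bary σ q).linear ((vectorSpan ℝ (σ : Set (Sp d))).starProjection v) • X q := by
  simp [tangGrad, LinearMap.sum_apply]

theorem tangGrad_add (σ : Finset (Sp d)) (X Y : Sp d → F) (v : Sp d) :
    tangGrad σ (X + Y) v = tangGrad σ X v + tangGrad σ Y v := by
  simp [tangGrad_apply, Finset.sum_add_distrib]

theorem tangGrad_smul (σ : Finset (Sp d)) (c : ℝ) (X : Sp d → F) (v : Sp d) :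
    tangGrad σ (c • X) v = c • tangGrad σ X v := by
  simp [tangGrad_apply, Finset.smul_sum, smul_comm c]

/-- Differences of points of a facet lie in its direction space, where the projection inside
`tangGrad` acts as the identity. -/
theorem apply_add_of_mem {X : Sp d → F} (hX : X ∈ Γ.plSpace F) (hσ : σ ∈ Γ.facets) {x y : Sp d}
    (hx : x ∈ closedSimplex σ) (hy : y ∈ closedSimplex σ) :
    X y = X x + tangGrad σ X (y - x) := by
  have hmem : y - x ∈ vectorSpan ℝ (σ : Set (Sp d)) := by
    rw [← direction_affineSpan]
    exact AffineSubspace.vsub_mem_direction (convexHull_subset_affineSpan _ hy)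
      (convexHull_subset_affineSpan _ hx)
  rw [apply_eq_sum_bary hX hσ hx, apply_eq_sum_bary hX hσ hy, tangGrad_apply,
    Submodule.starProjection_eq_self_iff.2 hmem, ← Finset.sum_add_distrib]
  refine Finset.sum_congr rfl fun q _ => ?_
  rw [← add_smul, ← vsub_eq_sub y x, AffineMap.linearMap_vsub, vsub_eq_sub, add_sub_cancel]

theorem tangGrad_starProjection (σ : Finset (Sp d)) (X : Sp d → F) (v : Sp d) :
    tangGrad σ X ((vectorSpan ℝ (σ : Set (Sp d))).starProjection v) = tangGrad σ X v := by
  rw [tangGrad_apply, tangGrad_apply,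
    Submodule.starProjection_eq_self_iff.2 (Submodule.starProjection_apply_mem _ v)]

theorem tangGrad_id (hσ : σ ∈ Γ.facets) (v : Sp d) :
    tangGrad σ (fun x => x) v = (vectorSpan ℝ (σ : Set (Sp d))).starProjection v := by
  set u := (vectorSpan ℝ (σ : Set (Sp d))).starProjection v with hu
  have hum : u ∈ (affineSpan ℝ (σ : Set (Sp d))).direction := by
    rw [direction_affineSpan]
    exact Submodule.starProjection_apply_mem _ v
  rw [tangGrad_apply, ← hu]
  rcases σ.eq_empty_or_nonempty with rfl | ⟨q, hq⟩
  · simp at hum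
    simp [hum]
  · have hqs : q ∈ affineSpan ℝ (σ : Set (Sp d)) := subset_affineSpan ℝ _ hq
    have h1 := sum_bary_smul (affineIndependent hσ) (AffineSubspace.vadd_mem_of_mem_direction hum hqs)
    have h2 := sum_bary_smul (affineIndependent hσ) hqs
    have h3 : ∀ r, (bary σ r).linear u = bary σ r (u +ᵥ q) - bary σ r q := fun r => by
      rw [AffineMap.map_vadd]; simp
    simp only [h3, sub_smul, Finset.sum_sub_distrib, h1, h2]
    simp

end PiecewiseLinear

end Surface

end

/-! ### Hilbert–Schmidt norm and area factor of linear maps -/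

section

section HilbertSchmidt

variable {d : ℕ}

/-- The Hilbert--Schmidt inner product of linear maps. -/
def hs (S T : Sp d →ₗ[ℝ] Sp d) : ℝ :=
  ∑ j, inner ℝ (S (EuclideanSpace.single j 1)) (T (EuclideanSpace.single j 1))

theorem frob_of_linearMap (S T : Sp d →ₗ[ℝ] Sp d) :
    frob (Matrix.of fun i j => S (EuclideanSpace.single j 1) i)
      (Matrix.of fun i j => T (EuclideanSpace.single j 1) i) = hs S T := by
  rw [frob, Finset.sum_comm, hs]
  refine Finset.sum_congr rfl fun j _ => ?_
  rw [PiLp.inner_apply]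
  refine Finset.sum_congr rfl fun i _ => ?_
  simp [mul_comm]

theorem hs_add_left (S S' T : Sp d →ₗ[ℝ] Sp d) : hs (S + S') T = hs S T + hs S' T := by
  simp [hs, inner_add_left, Finset.sum_add_distrib]

theorem hs_smul_left (c : ℝ) (S T : Sp d →ₗ[ℝ] Sp d) : hs (c • S) T = c * hs S T := by
  simp [hs, inner_smul_left, Finset.mul_sum]

theorem hs_comm (S T : Sp d →ₗ[ℝ] Sp d) : hs S T = hs T S := by
  simp [hs, real_inner_comm]

theorem hs_self_nonneg (T : Sp d →ₗ[ℝ] Sp d) : 0 ≤ hs T T :=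
  Finset.sum_nonneg fun _ _ => real_inner_self_nonneg

theorem eq_zero_of_hs_self_eq_zero {T : Sp d →ₗ[ℝ] Sp d} (h : hs T T = 0) : T = 0 := by
  rw [hs, Finset.sum_eq_zero_iff_of_nonneg fun _ _ => real_inner_self_nonneg] at h
  refine (EuclideanSpace.basisFun (Fin d) ℝ).toBasis.ext fun j => ?_
  simpa using h j (Finset.mem_univ j)

/-- For maps that only see the orthogonal projection onto `W`, the Hilbert--Schmidt inner product
can be computed with an orthonormal basis of `W`. -/
theorem hs_eq_sum_orthonormalBasis {W : Submodule ℝ (Sp d)} {T : Sp d →ₗ[ℝ] Sp d}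
    (hT : ∀ v, T (W.starProjection v) = T v) {ι : Type*} [Fintype ι] (b : OrthonormalBasis ι ℝ W) :
    hs T T = ∑ i, ‖T (b i)‖ ^ 2 := by
  set S : W →ₗ[ℝ] Sp d := T ∘ₗ W.subtype with hS
  set P : Sp d →ₗ[ℝ] W := W.orthogonalProjectionOnto.toLinearMap with hP
  have hPS : ∀ v, S (P v) = T v := hT
  set R : W →ₗ[ℝ] W := LinearMap.adjoint S ∘ₗ S with hR
  -- With `S` the restriction of `T` to `W`, both sides are the trace of `S* S`. On the whole space
  -- this operator appears between the projection onto `W` and the inclusion, and the trace is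
  -- cyclic.
  have h1 : hs T T = LinearMap.trace ℝ _ (W.subtype ∘ₗ R ∘ₗ P) := by
    rw [LinearMap.trace_eq_sum_inner _ (EuclideanSpace.basisFun (Fin d) ℝ), hs]
    refine Finset.sum_congr rfl fun j _ => ?_
    rw [EuclideanSpace.basisFun_apply, ← hPS]
    simp only [LinearMap.comp_apply, Submodule.subtype_apply]
    rw [← Submodule.inner_orthogonalProjectionOnto_eq_of_mem_right]
    change _ = inner ℝ (P _) (LinearMap.adjoint S (S (P _)))
    rw [LinearMap.adjoint_inner_right]
  have h2 : LinearMap.trace ℝ _ (W.subtype ∘ₗ R ∘ₗ P) = LinearMap.trace ℝ _ R := by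
    rw [LinearMap.trace_comp_comm']
    congr 1
    ext v
    simp only [LinearMap.comp_apply, Submodule.subtype_apply, hP]
    rw [ContinuousLinearMap.coe_coe, Submodule.orthogonalProjectionOnto_mem_subspace_eq_self]
  rw [h1, h2, LinearMap.trace_eq_sum_inner _ b]
  refine Finset.sum_congr rfl fun i _ => ?_
  rw [hR, LinearMap.comp_apply, LinearMap.adjoint_inner_right, real_inner_self_eq_norm_sq]
  rfl

/-- In dimension one this is `t ≤ (t² + 1) / 2`. In dimension two the squared area factor is the
Gram determinant, at most `|a|² |b|²`, and the inequality between geometric and arithmetic mean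
applies. In dimension three it fails, for instance for large multiples of the identity. -/
theorem normDet_sub_one_le {W : Submodule ℝ (Sp d)} {T : Sp d →ₗ[ℝ] Sp d}
    (hT : ∀ v, T (W.starProjection v) = T v)
    (hW : Module.finrank ℝ W = 1 ∨ Module.finrank ℝ W = 2) :
    (T ∘ₗ W.subtype).normDet - 1 ≤ 1 / 2 * (hs T T - Module.finrank ℝ W) := by
  have h0 := (T ∘ₗ W.subtype).normDet_nonneg
  rcases hW with hW | hW
  · let b : OrthonormalBasis (Fin 1) ℝ W := (stdOrthonormalBasis ℝ W).reindex (finCongr hW)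
    have h1 := (T ∘ₗ W.subtype).normDet_sq_eq_det_gram b
    rw [Matrix.det_fin_one] at h1
    simp only [Matrix.gram_apply, RCLike.ofReal_real_eq_id, id, real_inner_self_eq_norm_sq,
      LinearMap.comp_apply, Submodule.subtype_apply] at h1
    rw [hs_eq_sum_orthonormalBasis hT b, Fin.sum_univ_one, hW, ← h1]
    push_cast
    nlinarith [sq_nonneg ((T ∘ₗ W.subtype).normDet - 1)]
  · let b : OrthonormalBasis (Fin 2) ℝ W := (stdOrthonormalBasis ℝ W).reindex (finCongr hW)
    have h1 := (T ∘ₗ W.subtype).normDet_sq_eq_det_gram b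
    rw [Matrix.det_fin_two] at h1
    simp only [Matrix.gram_apply, RCLike.ofReal_real_eq_id, id, real_inner_self_eq_norm_sq,
      LinearMap.comp_apply, Submodule.subtype_apply] at h1
    rw [real_inner_comm (T (b 0)) (T (b 1))] at h1
    rw [hs_eq_sum_orthonormalBasis hT b, Fin.sum_univ_two, hW]
    push_cast
    have h2 : (T ∘ₗ W.subtype).normDet ≤ 1 / 2 * (‖T (b 0)‖ ^ 2 + ‖T (b 1)‖ ^ 2) := by
      refine abs_le_of_sq_le_sq' ?_ (by positivity) |>.2
      rw [h1]
      nlinarith [sq_nonneg (‖T (b 0)‖ ^ 2 - ‖T (b 1)‖ ^ 2),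
        sq_nonneg (inner ℝ (T (b 0)) (T (b 1)) : ℝ)]
    linarith

end HilbertSchmidt

/-! ### Dirichlet form, change of area, and the kernels of the surface equations -/

namespace Surface

variable {d : ℕ} {Γ : Surface d} {σ : Finset (Sp d)} {X Y η : Sp d → Sp d}

/-- In the relative interior of a facet, small tangential displacements stay in the facet, so the
extension that is constant in the normal direction is affine near the origin. -/
theorem surfGrad_eq (hX : X ∈ Γ.plSpace (Sp d)) (hσ : σ ∈ Γ.facets) {x : Sp d}
    (hx : x ∈ closedSimplex σ) (hpos : ∀ q ∈ σ, 0 < bary σ q x) :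
    surfGrad σ X x = Matrix.of fun i j => tangGrad σ X (EuclideanSpace.single j 1) i := by
  set P := (vectorSpan ℝ (σ : Set (Sp d))).starProjection with hP
  have hev : ∀ᶠ v in 𝓝 (0 : Sp d), x + P v ∈ closedSimplex σ := by
    have h1 : ∀ᶠ v in 𝓝 (0 : Sp d), ∀ q ∈ σ, 0 < bary σ q (x + P v) := by
      rw [Filter.eventually_all_finset]
      intro q hq
      have hc : Continuous fun v => bary σ q (x + P v) :=
        (continuous_bary σ q).comp (by fun_prop)
      refine hc.continuousAt.eventually (lt_mem_nhds ?_)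
      simpa using hpos q hq
    filter_upwards [h1] with v hv
    refine (mem_convexHull_iff_bary (affineIndependent hσ)).2 ⟨?_, fun q hq => (hv q hq).le⟩
    have hPv : P v ∈ (affineSpan ℝ (σ : Set (Sp d))).direction := by
      rw [direction_affineSpan]
      exact Submodule.starProjection_apply_mem _ v
    rw [add_comm]
    exact AffineSubspace.vadd_mem_of_mem_direction hPv (convexHull_subset_affineSpan _ hx)
  have heq : (fun v => X (x + P v)) =ᶠ[𝓝 0] fun v => X x + tangGrad σ X v := by
    filter_upwards [hev] with v hv
    rw [apply_add_of_mem hX hσ hx hv, add_sub_cancel_left, tangGrad_starProjection]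
  have hf : fderiv ℝ (fun v => X (x + P v)) 0 = (tangGrad σ X).toContinuousLinearMap := by
    rw [heq.fderiv_eq]
    exact ((tangGrad σ X).toContinuousLinearMap.hasFDerivAt.const_add (X x)).fderiv
  ext i j
  change (fderiv ℝ (fun v => X (x + P v)) 0 (EuclideanSpace.single j 1)) i = _
  rw [hf]
  rfl

theorem gradIp_eq (hX : X ∈ Γ.plSpace (Sp d)) (hη : η ∈ Γ.plSpace (Sp d)) :
    Γ.gradIp X η = ∑ σ ∈ Γ.facets, area σ * hs (tangGrad σ X) (tangGrad σ η) := by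
  refine Finset.sum_congr rfl fun σ hσ => ?_
  have : (fun x => frob (surfGrad σ X x) (surfGrad σ η x))
      =ᵐ[(μHE[d - 1] : Measure (Sp d)).restrict (closedSimplex σ)]
      fun _ => hs (tangGrad σ X) (tangGrad σ η) := by
    filter_upwards [ae_bary_pos hσ] with x hx
    rw [surfGrad_eq hX hσ hx.1 hx.2, surfGrad_eq hη hσ hx.1 hx.2, frob_of_linearMap]
  rw [integral_congr_ae this, setIntegral_const]
  rfl

theorem tangGrad_add' (σ : Finset (Sp d)) (X Y : Sp d → Sp d) :
    tangGrad σ (X + Y) = tangGrad σ X + tangGrad σ Y :=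
  LinearMap.ext fun v => tangGrad_add σ X Y v

theorem tangGrad_smul' (σ : Finset (Sp d)) (c : ℝ) (X : Sp d → Sp d) :
    tangGrad σ (c • X) = c • tangGrad σ X :=
  LinearMap.ext fun v => tangGrad_smul σ c X v

theorem area_nonneg (σ : Finset (Sp d)) : 0 ≤ area σ := ENNReal.toReal_nonneg

theorem gradIp_self_nonneg (hX : X ∈ Γ.plSpace (Sp d)) : 0 ≤ Γ.gradIp X X := by
  rw [gradIp_eq hX hX]
  exact Finset.sum_nonneg fun σ _ => mul_nonneg (area_nonneg σ) (hs_self_nonneg _)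

/-- The identity on the surface. -/
def ident (Γ : Surface d) : Sp d → Sp d := Γ.carrier.indicator fun x => x

theorem ident_apply {x : Sp d} (hx : x ∈ Γ.carrier) : Γ.ident x = x := Set.indicator_of_mem hx _

theorem ident_mem : Γ.ident ∈ Γ.plSpace (Sp d) := by
  refine ⟨fun x hx => Set.indicator_of_notMem hx _,
    continuousOn_id.congr fun x hx => ident_apply hx, fun σ hσ => ⟨AffineMap.id ℝ _, fun x hx =>
      ident_apply (closedSimplex_subset_carrier hσ hx)⟩⟩

theorem finrank_vectorSpan (hd : 0 < d) (hσ : σ ∈ Γ.facets) :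
    Module.finrank ℝ (vectorSpan ℝ (σ : Set (Sp d))) = d - 1 :=
  finrank_vectorSpan_of_card (affineIndependent hσ) (by rw [(mem_facets.1 hσ).2]; omega)

theorem tangGrad_ident (hσ : σ ∈ Γ.facets) (v : Sp d) :
    tangGrad σ Γ.ident v = (vectorSpan ℝ (σ : Set (Sp d))).starProjection v := by
  rw [← tangGrad_id hσ, tangGrad_apply, tangGrad_apply]
  refine Finset.sum_congr rfl fun q hq => ?_
  rw [ident_apply (closedSimplex_subset_carrier hσ (mem_closedSimplex_of_mem hq))]

theorem hs_tangGrad_ident (hd : 0 < d) (hσ : σ ∈ Γ.facets) :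
    hs (tangGrad σ Γ.ident) (tangGrad σ Γ.ident) = (d - 1 : ℕ) := by
  set W := vectorSpan ℝ (σ : Set (Sp d)) with hW
  rw [hs_eq_sum_orthonormalBasis (W := W) (tangGrad_starProjection σ _) (stdOrthonormalBasis ℝ W)]
  have : ∀ i, ‖tangGrad σ Γ.ident (stdOrthonormalBasis ℝ W i : Sp d)‖ ^ 2 = 1 := by
    intro i
    rw [tangGrad_ident hσ, Submodule.starProjection_eq_self_iff.2 (Subtype.coe_prop _)]
    have := (stdOrthonormalBasis ℝ W).orthonormal.1 i
    rw [Submodule.coe_norm] at this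
    rw [this, one_pow]
  simp only [this, Finset.sum_const, Finset.card_univ, Fintype.card_fin, nsmul_eq_mul, mul_one]
  rw [finrank_vectorSpan hd hσ]

theorem toReal_measure_image_closedSimplex (hd : 0 < d) (hX : X ∈ Γ.plSpace (Sp d))
    (hσ : σ ∈ Γ.facets) :
    (μHE[d - 1] : Measure (Sp d)) (X '' closedSimplex σ) < ⊤ ∧
    ((μHE[d - 1] : Measure (Sp d)) (X '' closedSimplex σ)).toReal =
      (tangGrad σ X ∘ₗ (vectorSpan ℝ (σ : Set (Sp d))).subtype).normDet * area σ := by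
  obtain ⟨q, hq⟩ : σ.Nonempty := Finset.card_pos.1 (by rw [(mem_facets.1 hσ).2]; exact hd)
  have hqσ := mem_closedSimplex_of_mem hq
  have himg : X '' closedSimplex σ = (fun y => X q + tangGrad σ X (y - q)) '' closedSimplex σ :=
    Set.image_congr fun y hy => apply_add_of_mem hX hσ hqσ hy
  have hmem : ∀ y ∈ closedSimplex σ, y - q ∈ vectorSpan ℝ (σ : Set (Sp d)) := fun y hy => by
    rw [← direction_affineSpan]
    exact AffineSubspace.vsub_mem_direction (convexHull_subset_affineSpan _ hy)
      (convexHull_subset_affineSpan _ hqσ)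
  have h := euclideanHausdorffMeasure_linear_image (vectorSpan ℝ (σ : Set (Sp d)))
    (tangGrad σ X) q (X q) hmem
  rw [← himg, finrank_vectorSpan hd hσ] at h
  rw [h]
  refine ⟨ENNReal.mul_lt_top ENNReal.ofReal_lt_top (measure_closedSimplex_lt_top hσ), ?_⟩
  rw [ENNReal.toReal_mul, ENNReal.toReal_ofReal (LinearMap.normDet_nonneg _)]
  rfl

/-- The decrease of surface area is controlled by the Dirichlet form. -/
theorem measure_image_sub_measure_le (hd : d = 2 ∨ d = 3) (hX : X ∈ Γ.plSpace (Sp d)) :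
    ((μHE[d - 1] : Measure (Sp d)) (X '' Γ.carrier)).toReal -
      ((μHE[d - 1] : Measure (Sp d)) Γ.carrier).toReal ≤ Γ.gradIp X (X - Γ.ident) := by
  have hd0 : 0 < d := by omega
  -- The image may overlap itself, so only subadditivity is available here. For `Γ` itself the
  -- opposite inequality is needed, and it holds because its facets overlap in null sets.
  have h1 : ((μHE[d - 1] : Measure (Sp d)) (X '' Γ.carrier)).toReal ≤ ∑ σ ∈ Γ.facets,
      (tangGrad σ X ∘ₗ (vectorSpan ℝ (σ : Set (Sp d))).subtype).normDet * area σ := by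
    have hsub : X '' Γ.carrier ⊆ ⋃ σ ∈ Γ.facets, X '' closedSimplex σ := by
      rw [carrier_eq, Set.image_iUnion₂]
    have h2 : (μHE[d - 1] : Measure (Sp d)) (X '' Γ.carrier) ≤
        ∑ σ ∈ Γ.facets, (μHE[d - 1] : Measure (Sp d)) (X '' closedSimplex σ) :=
      (measure_mono hsub).trans (measure_biUnion_finset_le _ _)
    have hne : ∀ σ ∈ Γ.facets, (μHE[d - 1] : Measure (Sp d)) (X '' closedSimplex σ) ≠ ⊤ :=
      fun σ hσ => (toReal_measure_image_closedSimplex hd0 hX hσ).1.ne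
    have h3 := ENNReal.toReal_mono (ENNReal.sum_ne_top.2 hne) h2
    rw [ENNReal.toReal_sum hne] at h3
    exact h3.trans (Finset.sum_le_sum fun σ hσ =>
      (toReal_measure_image_closedSimplex hd0 hX hσ).2.le)
  have h4 := Γ.sum_area_le_measure_carrier
  have h5 : ∑ σ ∈ Γ.facets,
      (tangGrad σ X ∘ₗ (vectorSpan ℝ (σ : Set (Sp d))).subtype).normDet * area σ -
      ∑ σ ∈ Γ.facets, area σ ≤ Γ.gradIp X (X - Γ.ident) := by
    rw [gradIp_eq hX (Submodule.sub_mem _ hX ident_mem), ← Finset.sum_sub_distrib]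
    refine Finset.sum_le_sum fun σ hσ => ?_
    have h6 := normDet_sub_one_le (W := vectorSpan ℝ (σ : Set (Sp d))) (T := tangGrad σ X)
      (tangGrad_starProjection σ X) (by rw [finrank_vectorSpan hd0 hσ]; omega)
    rw [finrank_vectorSpan hd0 hσ, ← hs_tangGrad_ident hd0 hσ] at h6
    have h7 : tangGrad σ (X - Γ.ident) = tangGrad σ X + (-1 : ℝ) • tangGrad σ Γ.ident := by
      rw [← tangGrad_smul', ← tangGrad_add', neg_one_smul, sub_eq_add_neg]
    set S := tangGrad σ X
    set T := tangGrad σ Γ.ident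
    have h8 : hs S (tangGrad σ (X - Γ.ident)) = hs S S - hs S T := by
      rw [h7, hs_comm, hs_add_left, hs_smul_left, hs_comm T S]
      ring
    -- From `|S - T|² ≥ 0` follows `(|S|² - |T|²) / 2 ≤ ⟨S, S - T⟩`. Since `|T|² = d - 1`, the left
    -- side is the bound for the area factor minus one.
    have h9 := hs_self_nonneg (S + (-1 : ℝ) • T)
    rw [hs_add_left, hs_smul_left, hs_comm S, hs_comm T, hs_add_left, hs_add_left, hs_smul_left,
      hs_smul_left, hs_comm T S] at h9
    rw [h8]
    nlinarith [area_nonneg σ]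
  linarith

/-- A piecewise linear function with vanishing Dirichlet energy is constant on the connected
components of the surface. -/
theorem eq_of_gradIp_self_eq_zero (hpos : ∀ σ ∈ Γ.facets, 0 < area σ)
    (hX : X ∈ Γ.plSpace (Sp d)) (h : Γ.gradIp X X = 0) {x y : Sp d} (hx : x ∈ Γ.carrier)
    (hy : y ∈ connectedComponentIn Γ.carrier x) : X y = X x := by
  have hconst : ∀ σ ∈ Γ.facets, ∀ x ∈ closedSimplex σ, ∀ y ∈ closedSimplex σ, X y = X x := by
    intro σ hσ x hx y hy
    rw [gradIp_eq hX hX, Finset.sum_eq_zero_iff_of_nonneg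
      fun σ _ => mul_nonneg (area_nonneg σ) (hs_self_nonneg _)] at h
    have h0 := (mul_eq_zero.1 (h σ hσ)).resolve_left (hpos σ hσ).ne'
    rw [apply_add_of_mem hX hσ hx hy, eq_zero_of_hs_self_eq_zero h0, LinearMap.zero_apply,
      add_zero]
  have hfin : (X '' Γ.carrier).Finite := by
    rw [carrier_eq, Set.image_iUnion₂]
    refine Γ.facets.finite_toSet.biUnion fun σ hσ => Set.Subsingleton.finite ?_
    rintro _ ⟨x, hx, rfl⟩ _ ⟨y, hy, rfl⟩
    exact hconst σ hσ y hy x hx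
  have hsub := connectedComponentIn_subset Γ.carrier x
  exact isPreconnected_connectedComponentIn.constant_of_mapsTo hfin.isDiscrete
    (hX.2.1.mono hsub) ((Set.mapsTo_image X Γ.carrier).mono_left hsub) hy
    (mem_connectedComponentIn hx)

theorem inner_vertexNormal_eq_zero {q v : Sp d}
    (h : inner ℝ v (∑ σ ∈ Γ.star q, area σ • Γ.normal σ) = (0 : ℝ)) :
    inner ℝ v (Γ.vertexNormal q) = (0 : ℝ) := by
  rw [vertexNormal, inner_smul_right, h, mul_zero]

open Classical in
/-- Testing the lumped inner product with a nodal basis function. -/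
theorem lumped_nodal {u w : Finset (Sp d) → Sp d → Sp d} {q : Sp d} {χ : Sp d → ℝ}
    (hq : q ∈ Γ.complex.vertices)
    (hχ : ∀ r ∈ Γ.complex.vertices, χ r = if r = q then 1 else 0) :
    Γ.lumped u (fun σ x => χ x • w σ x) =
      1 / (d : ℝ) * ∑ σ ∈ Γ.star q, area σ * inner ℝ (u σ q) (w σ q) := by
  rw [lumped]
  congr 1
  have hsub : Γ.star q ⊆ Γ.facets := fun σ hσ => ((mem_star hq).1 hσ).1
  rw [← Finset.sum_subset hsub]
  · refine Finset.sum_congr rfl fun σ hσ => ?_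
    obtain ⟨hσf, hqσ⟩ := (mem_star hq).1 hσ
    rw [Finset.sum_eq_single q]
    · simp only [hχ q hq, if_true, one_smul]
    · intro r hr hrq
      simp only [hχ r (mem_vertices_of_mem hσf hr), if_neg hrq, zero_smul, inner_zero_right]
    · exact fun h => absurd hqσ h
  · intro σ hσ hns
    rw [Finset.sum_eq_zero, mul_zero]
    intro r hr
    have hrq : r ≠ q := by
      rintro rfl
      exact hns ((mem_star hq).2 ⟨hσ, hr⟩)
    simp only [hχ r (mem_vertices_of_mem hσ hr), if_neg hrq, zero_smul, inner_zero_right]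

/-- Zero energy makes `X` constant on each component. Testing with nodal functions shows that this
constant is orthogonal to every vertex normal of the component, and these span the space. -/
theorem eq_zero_of_gradIp_of_lumped (hd : 0 < d) (hpos : ∀ σ ∈ Γ.facets, 0 < area σ)
    (hcomp : Γ.SpanOnComponents) (hX : X ∈ Γ.plSpace (Sp d)) (h : Γ.gradIp X X = 0)
    (hl : ∀ χ ∈ Γ.plSpace ℝ, Γ.lumped (fun _ => X) (fun σ x => χ x • Γ.normal σ) = 0) :
    X = 0 := by
  classical
  refine eq_zero_of_vertices hX fun q hq => ?_
  have hqc : q ∈ Γ.carrier := Γ.complex.vertices_subset_space hq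
  have horth : ∀ r ∈ Γ.complex.vertices, inner ℝ (X r) (Γ.vertexNormal r) = (0 : ℝ) := by
    intro r hr
    obtain ⟨χ, hχ, hχr⟩ := Γ.exists_plSpace_vertices fun p => if p = r then 1 else 0
    have h1 := hl χ hχ
    rw [lumped_nodal (w := fun σ _ => Γ.normal σ) hr hχr] at h1
    refine inner_vertexNormal_eq_zero ?_
    rw [inner_sum]
    simp only [inner_smul_right]
    exact (mul_eq_zero.1 h1).resolve_left (by positivity)
  have hspan : Submodule.span ℝ (Γ.vertexNormal ''
      (Γ.complex.vertices ∩ connectedComponentIn Γ.carrier q)) = ⊤ :=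
    Submodule.eq_top_of_finrank_eq (by rw [hcomp q hq, finrank_euclideanSpace_fin])
  have hle : Submodule.span ℝ (Γ.vertexNormal ''
      (Γ.complex.vertices ∩ connectedComponentIn Γ.carrier q)) ≤ (Submodule.span ℝ {X q})ᗮ := by
    rw [Submodule.span_le]
    rintro _ ⟨r, ⟨hr, hrc⟩, rfl⟩
    rw [SetLike.mem_coe, Submodule.mem_orthogonal_singleton_iff_inner_right,
      ← eq_of_gradIp_self_eq_zero hpos hX h hqc hrc]
    exact horth r hr
  rw [hspan, top_le_iff] at hle
  have : X q ∈ (Submodule.span ℝ {X q})ᗮ := hle ▸ Submodule.mem_top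
  exact (inner_self_eq_zero (𝕜 := ℝ)).1 (Submodule.mem_orthogonal_singleton_iff_inner_right.1 this)

theorem lumped_comm (u w : Finset (Sp d) → Sp d → Sp d) : Γ.lumped u w = Γ.lumped w u := by
  simp only [lumped]
  congr 1
  refine Finset.sum_congr rfl fun σ _ => ?_
  congr 1
  exact Finset.sum_congr rfl fun q _ => real_inner_comm _ _

/-- The test field equal to the vertex normal at `q` and zero at the other vertices isolates `κ q`
times a multiple of the squared length of that normal. -/
theorem eq_zero_of_lumped {κ : Sp d → ℝ} (hd : 0 < d)
    (hω : ∀ q ∈ Γ.complex.vertices, Γ.vertexNormal q ≠ 0) (hκ : κ ∈ Γ.plSpace ℝ)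
    (hl : ∀ η ∈ Γ.plSpace (Sp d), Γ.lumped (fun _ => η) (fun σ x => κ x • Γ.normal σ) = 0) :
    κ = 0 := by
  classical
  refine eq_zero_of_vertices hκ fun q hq => ?_
  by_contra hne
  refine hω q hq ?_
  obtain ⟨χ, hχ, hχq⟩ := Γ.exists_plSpace_vertices fun p => if p = q then 1 else 0
  refine (inner_self_eq_zero (𝕜 := ℝ)).1 (inner_vertexNormal_eq_zero ?_)
  have h1 := hl _ (smul_mem_plSpace hχ (Γ.vertexNormal q))
  rw [lumped_comm, lumped_nodal (w := fun _ _ => Γ.vertexNormal q) hq hχq] at h1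
  have h2 := (mul_eq_zero.1 h1).resolve_left (by positivity)
  have h3 : κ q * inner ℝ (Γ.vertexNormal q) (∑ σ ∈ Γ.star q, area σ • Γ.normal σ) = 0 := by
    rw [← h2, inner_sum, Finset.mul_sum]
    refine Finset.sum_congr rfl fun σ _ => ?_
    rw [inner_smul_right, inner_smul_left, real_inner_comm]
    simp only [conj_trivial]
    ring
  exact (mul_eq_zero.1 h3).resolve_left hne

end Surface

end

/-! ### The abstract saddle point system -/

section

/-- Unique solvability of a linear saddle point system with two multipliers, coupled through
`c` and `ℓ`. -/
theorem existsUnique_saddle {𝕌 ℙ 𝕏 𝕂 : Type*}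
    [AddCommGroup 𝕌] [Module ℝ 𝕌] [FiniteDimensional ℝ 𝕌]
    [AddCommGroup ℙ] [Module ℝ ℙ] [FiniteDimensional ℝ ℙ]
    [AddCommGroup 𝕏] [Module ℝ 𝕏] [FiniteDimensional ℝ 𝕏]
    [AddCommGroup 𝕂] [Module ℝ 𝕂] [FiniteDimensional ℝ 𝕂]
    (a : 𝕌 →ₗ[ℝ] 𝕌 →ₗ[ℝ] ℝ) (b : ℙ →ₗ[ℝ] 𝕌 →ₗ[ℝ] ℝ) (c : 𝕂 →ₗ[ℝ] 𝕌 →ₗ[ℝ] ℝ)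
    (l : 𝕏 →ₗ[ℝ] 𝕂 →ₗ[ℝ] ℝ) (g : 𝕏 →ₗ[ℝ] 𝕏 →ₗ[ℝ] ℝ) {γ τ : ℝ} (hγ : 0 < γ) (hτ : 0 < τ)
    (ha : ∀ u, 0 ≤ a u u) (ha0 : ∀ u, a u u = 0 → u = 0)
    (hg : ∀ x, 0 ≤ g x x) (hg0 : ∀ x, g x x = 0 → (∀ k, l x k = 0) → x = 0)
    (hl0 : ∀ k, (∀ x, l x k = 0) → k = 0) (hb0 : ∀ p, (∀ u, b p u = 0) → p = 0)
    (L₁ : 𝕌 →ₗ[ℝ] ℝ) (L₃ : 𝕂 →ₗ[ℝ] ℝ) :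
    ∃! s : 𝕌 × ℙ × 𝕏 × 𝕂,
      (∀ ξ, a s.1 ξ - b s.2.1 ξ - γ * c s.2.2.2 ξ = L₁ ξ) ∧ (∀ φ, b φ s.1 = 0) ∧
      (∀ χ, τ⁻¹ * l s.2.2.1 χ - c χ s.1 = L₃ χ) ∧ ∀ η, l η s.2.2.2 + g s.2.2.1 η = 0 := by
  let Φ : 𝕌 × ℙ × 𝕏 × 𝕂 →ₗ[ℝ]
      Module.Dual ℝ 𝕌 × Module.Dual ℝ ℙ × Module.Dual ℝ 𝕏 × Module.Dual ℝ 𝕂 :=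
    -- Components are ordered by the space of the test function, so the curvature equation (tested
    -- in `𝕏`) precedes the motion equation (tested in `𝕂`).
    LinearMap.prod
      (a ∘ₗ LinearMap.fst ℝ _ _ - b ∘ₗ LinearMap.fst ℝ _ _ ∘ₗ LinearMap.snd ℝ _ _ -
        γ • c ∘ₗ LinearMap.snd ℝ _ _ ∘ₗ LinearMap.snd ℝ _ _ ∘ₗ LinearMap.snd ℝ _ _)
      (LinearMap.prod (b.flip ∘ₗ LinearMap.fst ℝ _ _)
        (LinearMap.prod
          (l.flip ∘ₗ LinearMap.snd ℝ _ _ ∘ₗ LinearMap.snd ℝ _ _ ∘ₗ LinearMap.snd ℝ _ _ +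
            g ∘ₗ LinearMap.fst ℝ _ _ ∘ₗ LinearMap.snd ℝ _ _ ∘ₗ LinearMap.snd ℝ _ _)
          (τ⁻¹ • l ∘ₗ LinearMap.fst ℝ _ _ ∘ₗ LinearMap.snd ℝ _ _ ∘ₗ LinearMap.snd ℝ _ _ -
            c.flip ∘ₗ LinearMap.fst ℝ _ _)))
  have hinj : Function.Injective Φ := by
    rw [← LinearMap.ker_eq_bot, LinearMap.ker_eq_bot']
    rintro ⟨u, p, x, k⟩ h
    simp only [Prod.ext_iff, LinearMap.ext_iff] at h
    obtain ⟨h1, h2, h3, h4⟩ := h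
    replace h1 : ∀ ξ, a u ξ - b p ξ - γ * c k ξ = 0 := h1
    replace h2 : ∀ φ, b φ u = 0 := h2
    replace h3 : ∀ η, l η k + g x η = 0 := h3
    replace h4 : ∀ χ, τ⁻¹ * l x χ - c χ u = 0 := h4
    -- Eliminating `c k u` by the motion equation and then `l x k` by the curvature equation turns
    -- this into `a u u + γ τ⁻¹ g x x = 0`.
    have e1 := h1 u
    have e4 := h4 k
    rw [h2, sub_zero, show c k u = τ⁻¹ * l x k by linarith,
      show l x k = -g x x by linarith [h3 x]] at e1
    have hpos : 0 ≤ γ * (τ⁻¹ * g x x) := by have := hg x; positivity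
    have hu : u = 0 := ha0 u (by linarith [ha u])
    have hgx : g x x = 0 := by
      have : γ * (τ⁻¹ * g x x) = 0 := by linarith [ha u]
      simpa [hγ.ne', hτ.ne'] using this
    have hx : x = 0 := hg0 x hgx fun χ => by
      have := h4 χ
      rw [hu, map_zero, sub_zero] at this
      simpa [hτ.ne'] using this
    have hk : k = 0 := hl0 k fun η => by simpa [hx] using h3 η
    have hp : p = 0 := hb0 p fun ξ => by simpa [hu, hk] using h1 ξ
    simp [hu, hp, hx, hk]
  have hsurj : Function.Surjective Φ := by
    refine (LinearMap.injective_iff_surjective_of_finrank_eq_finrank ?_).1 hinj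
    simp [Module.finrank_prod, Subspace.dual_finrank_eq]
  obtain ⟨s, hs⟩ := hsurj ⟨L₁, 0, 0, L₃⟩
  have key : ∀ s, Φ s = ⟨L₁, 0, 0, L₃⟩ ↔
      (∀ ξ, a s.1 ξ - b s.2.1 ξ - γ * c s.2.2.2 ξ = L₁ ξ) ∧ (∀ φ, b φ s.1 = 0) ∧
      (∀ χ, τ⁻¹ * l s.2.2.1 χ - c χ s.1 = L₃ χ) ∧
        ∀ η, l η s.2.2.2 + g s.2.2.1 η = 0 := by
    intro s
    simp only [Prod.ext_iff, LinearMap.ext_iff]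
    constructor
    · rintro ⟨h1, h2, h3, h4⟩
      exact ⟨h1, h2, h4, h3⟩
    · rintro ⟨h1, h2, h4, h3⟩
      exact ⟨h1, h2, h3, h4⟩
  exact ⟨s, (key s).1 hs, fun s' h' => hinj (((key s').2 h').trans hs.symm)⟩

end

section

variable {d : ℕ}

/-! ### Bilinear forms on jets -/

/-- Values and first derivatives of vector fields at a point. -/
abbrev Jet (d : ℕ) := Sp d × (Sp d →L[ℝ] Sp d)

/-- The first order jet of a vector field. -/
def jet (V : Sp d → Sp d) (x : Sp d) : Jet d := (V x, fderiv ℝ V x)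

/-- The matrix of a continuous linear map. -/
def gradOf (A : Sp d →L[ℝ] Sp d) : Matrix (Fin d) (Fin d) ℝ :=
  Matrix.of fun i j => A (EuclideanSpace.single j 1) i

/-- The symmetric part of the matrix of a continuous linear map. -/
def deformOf (A : Sp d →L[ℝ] Sp d) : Matrix (Fin d) (Fin d) ℝ :=
  (1 / 2 : ℝ) • (gradOf A + (gradOf A).transpose)

theorem gradOf_add (A B : Sp d →L[ℝ] Sp d) : gradOf (A + B) = gradOf A + gradOf B := by
  ext i j
  simp [gradOf]

theorem gradOf_smul (c : ℝ) (A : Sp d →L[ℝ] Sp d) : gradOf (c • A) = c • gradOf A := by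
  ext i j
  simp [gradOf]

theorem deformOf_add (A B : Sp d →L[ℝ] Sp d) : deformOf (A + B) = deformOf A + deformOf B := by
  ext i j
  simp [deformOf, gradOf_add]
  ring

theorem deformOf_smul (c : ℝ) (A : Sp d →L[ℝ] Sp d) : deformOf (c • A) = c • deformOf A := by
  ext i j
  simp [deformOf, gradOf_smul]
  ring

theorem frob_add_left (A B C : Matrix (Fin d) (Fin d) ℝ) :
    frob (A + B) C = frob A C + frob B C := by
  simp [frob, add_mul, Finset.sum_add_distrib]

theorem frob_smul_left (c : ℝ) (A B : Matrix (Fin d) (Fin d) ℝ) :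
    frob (c • A) B = c * frob A B := by
  simp [frob, Finset.mul_sum, mul_assoc]

theorem frob_comm (A B : Matrix (Fin d) (Fin d) ℝ) : frob A B = frob B A := by
  simp [frob, mul_comm]

theorem frob_self_nonneg (A : Matrix (Fin d) (Fin d) ℝ) : 0 ≤ frob A A :=
  Finset.sum_nonneg fun _ _ => Finset.sum_nonneg fun _ _ => mul_self_nonneg _

theorem eq_zero_of_frob_self_eq_zero {A : Matrix (Fin d) (Fin d) ℝ} (h : frob A A = 0) :
    A = 0 := by
  ext i j
  have h1 := (Finset.sum_eq_zero_iff_of_nonneg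
    fun i _ => Finset.sum_nonneg fun j _ => mul_self_nonneg (A i j)).1 h i (Finset.mem_univ i)
  have h2 := (Finset.sum_eq_zero_iff_of_nonneg
    fun j _ => mul_self_nonneg (A i j)).1 h1 j (Finset.mem_univ j)
  simpa using h2

theorem frob_add_right (A B C : Matrix (Fin d) (Fin d) ℝ) :
    frob A (B + C) = frob A B + frob A C := by
  rw [frob_comm, frob_add_left, frob_comm B, frob_comm C]

theorem frob_smul_right (c : ℝ) (A B : Matrix (Fin d) (Fin d) ℝ) :
    frob A (c • B) = c * frob A B := by
  rw [frob_comm, frob_smul_left, frob_comm B]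

/-- The integrand of the volume terms in the discrete momentum equation: inertia with coefficient
`r`, viscosity `m`, and skew-symmetrized transport of density `q` by the velocity `w`. -/
def momentumJet (r m q : ℝ) (w : Sp d) : Jet d →ₗ[ℝ] Jet d →ₗ[ℝ] ℝ :=
  LinearMap.mk₂ ℝ (fun v z => r * inner ℝ v.1 z.1 + m * frob (deformOf v.2) (deformOf z.2) +
      q * (inner ℝ (v.2 w) z.1 - inner ℝ (z.2 w) v.1))
    (fun v v' z => by
      simp [deformOf_add, inner_add_left, inner_add_right, frob_add_left]
      ring)
    (fun c v z => by
      simp [deformOf_smul, inner_smul_left, inner_smul_right, frob_smul_left]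
      ring)
    (fun v z z' => by
      simp [deformOf_add, inner_add_left, inner_add_right, frob_add_right]
      ring)
    (fun c v z => by
      simp [deformOf_smul, inner_smul_left, inner_smul_right, frob_smul_right]
      ring)

theorem continuous_gradOf : Continuous (gradOf : (Sp d →L[ℝ] Sp d) → _) := by
  refine continuous_matrix fun i j => ?_
  simp only [gradOf, Matrix.of_apply]
  fun_prop

theorem continuous_deformOf : Continuous (deformOf : (Sp d →L[ℝ] Sp d) → _) := by
  have := (continuous_gradOf (d := d)).add continuous_gradOf.matrix_transpose
  exact this.const_smul (1 / 2 : ℝ)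

theorem continuous_frob :
    Continuous fun p : Matrix (Fin d) (Fin d) ℝ × Matrix (Fin d) (Fin d) ℝ => frob p.1 p.2 := by
  unfold frob
  fun_prop

namespace BulkMesh

variable {pb : FlowProblem d} {T : BulkMesh pb.Ω} {o : Finset (Sp d)} {V W : Sp d → Sp d}
  {k k' : ℕ}

theorem PwSmooth.jet_add (hV : T.PwSmooth V) (hW : T.PwSmooth W) (ho : o ∈ T.elements) {x : Sp d}
    (hx : x ∈ openSimplex o) : jet (V + W) x = jet V x + jet W x :=
  Prod.ext rfl (fderiv_add (hV.differentiableAt ho hx) (hW.differentiableAt ho hx))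

/-- Scalars pass through `fderiv` at every point, differentiable or not, whereas sums require an
open element. -/
theorem jet_smul (c : ℝ) (V : Sp d → Sp d) (x : Sp d) : jet (c • V) x = c • jet V x :=
  Prod.ext rfl (congrFun (fderiv_const_smul_field c) x)

theorem PwSmooth.pwC_divergence (hV : T.PwSmooth V) : T.PwC (divergence V) :=
  hV.pwC_fderiv.comp (continuous_gradOf.matrix_trace)

theorem PwSmooth.pwC_deform (hV : T.PwSmooth V) (hW : T.PwSmooth W) :
    T.PwC fun x => frob (deform V x) (deform W x) :=
  ((hV.pwC_fderiv.comp continuous_deformOf).prodMk (hW.pwC_fderiv.comp continuous_deformOf)).comp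
    continuous_frob

theorem PwSmooth.pwC_convect (hV : T.PwSmooth V) {w : Sp d → Sp d} (hw : T.PwC w) :
    T.PwC fun x => convect w V x :=
  (hV.pwC_fderiv.prodMk hw).comp (isBoundedBilinearMap_apply.continuous)

theorem pwC_momentumJet {r m q : Sp d → ℝ} {w : Sp d → Sp d} (hr : T.PwC r) (hm : T.PwC m)
    (hq : T.PwC q) (hw : T.PwC w) (hV : T.PwSmooth V) (hW : T.PwSmooth W) :
    T.PwC fun x => momentumJet (r x) (m x) (q x) (w x) (jet V x) (jet W x) :=
  ((hr.mul (hV.pwC.inner hW.pwC)).add (hm.mul (hV.pwC_deform hW))).add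
    (hq.mul (((hV.pwC_convect hw).inner hW.pwC).sub ((hW.pwC_convect hw).inner hV.pwC)))

theorem PwC.memLp {u : Sp d → ℝ} (hu : T.PwC u) : MemLp u 2 (volume.restrict pb.Ω) := by
  rw [memLp_two_iff_integrable_sq hu.integrableOn.aestronglyMeasurable]
  exact (hu.comp (continuous_pow 2)).integrableOn

theorem integrable_mul_divergence (φ : pb.Pressure) (hV : T.PwSmooth V) :
    Integrable (fun x => φ x * divergence V x) (volume.restrict pb.Ω) :=
  (Lp.memLp φ).integrable_mul hV.pwC_divergence.memLp

theorem PwSmooth.divergence_add (hV : T.PwSmooth V) (hW : T.PwSmooth W) (ho : o ∈ T.elements)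
    {x : Sp d} (hx : x ∈ openSimplex o) :
    divergence (V + W) x = divergence V x + divergence W x := by
  change (gradOf (jet (V + W) x).2).trace = (gradOf (jet V x).2).trace + (gradOf (jet W x).2).trace
  rw [hV.jet_add hW ho hx, Prod.snd_add, gradOf_add, Matrix.trace_add]

theorem divergence_smul (c : ℝ) (V : Sp d → Sp d) (x : Sp d) :
    divergence (c • V) x = c * divergence V x := by
  change (gradOf (jet (c • V) x).2).trace = c * (gradOf (jet V x).2).trace
  rw [jet_smul, Prod.smul_snd, gradOf_smul, Matrix.trace_smul, smul_eq_mul]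

/-! ### The bulk terms as bilinear and linear forms -/

section Forms

variable {S : Submodule ℝ (Sp d → Sp d)} (hS : ∀ V ∈ S, T.MemSVec k V)

/-- The volume terms of the discrete momentum equation as a bilinear form. -/
def momentumForm {r m q : Sp d → ℝ} {w : Sp d → Sp d} (hr : T.PwC r) (hm : T.PwC m)
    (hq : T.PwC q) (hw : T.PwC w) : S →ₗ[ℝ] S →ₗ[ℝ] ℝ :=
  have hi : ∀ V W : S, Integrable
      (fun x => momentumJet (r x) (m x) (q x) (w x) (jet V x) (jet W x))
      (volume.restrict pb.Ω) := fun V W =>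
    (pwC_momentumJet hr hm hq hw (hS V V.2).pwSmooth (hS W W.2).pwSmooth).integrableOn
  LinearMap.mk₂ ℝ
    (fun V W => ∫ x in pb.Ω, momentumJet (r x) (m x) (q x) (w x) (jet V x) (jet W x))
    (fun V V' W => by
      rw [← integral_add (hi _ _) (hi _ _)]
      refine integral_congr_ae ?_
      filter_upwards [T.ae_mem_openSimplex] with x ⟨o, ho, hx⟩
      rw [Submodule.coe_add, (hS V V.2).pwSmooth.jet_add (hS V' V'.2).pwSmooth ho hx, map_add,
        LinearMap.add_apply])
    (fun c V W => by
      rw [smul_eq_mul, ← integral_const_mul]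
      congr 1
      funext x
      rw [Submodule.coe_smul, jet_smul, map_smul, LinearMap.smul_apply, smul_eq_mul])
    (fun V W W' => by
      rw [← integral_add (hi _ _) (hi _ _)]
      refine integral_congr_ae ?_
      filter_upwards [T.ae_mem_openSimplex] with x ⟨o, ho, hx⟩
      rw [Submodule.coe_add, (hS W W.2).pwSmooth.jet_add (hS W' W'.2).pwSmooth ho hx, map_add])
    (fun c V W => by
      rw [smul_eq_mul, ← integral_const_mul]
      congr 1
      funext x
      rw [Submodule.coe_smul, jet_smul, map_smul, smul_eq_mul])

theorem momentumForm_apply {r m q : Sp d → ℝ} {w : Sp d → Sp d} (hr : T.PwC r) (hm : T.PwC m)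
    (hq : T.PwC q) (hw : T.PwC w) (V W : S) :
    momentumForm hS hr hm hq hw V W =
      (∫ x in pb.Ω, r x * inner ℝ ((V : Sp d → Sp d) x) ((W : Sp d → Sp d) x)) +
      (∫ x in pb.Ω, m x * frob (deform V x) (deform W x)) +
      ∫ x in pb.Ω, q x * (inner ℝ (convect w V x) ((W : Sp d → Sp d) x) -
        inner ℝ (convect w W x) ((V : Sp d → Sp d) x)) := by
  have hV := (hS V V.2).pwSmooth
  have hW := (hS W W.2).pwSmooth
  have h1 := (hr.mul (hV.pwC.inner hW.pwC)).integrableOn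
  have h2 := (hm.mul (hV.pwC_deform hW)).integrableOn
  have h3 := (hq.mul (((hV.pwC_convect hw).inner hW.pwC).sub
    ((hW.pwC_convect hw).inner hV.pwC))).integrableOn
  rw [← integral_add h1 h2]
  exact integral_add (h1.add h2) h3

/-- The slip term as a bilinear form. -/
def slipForm (hd : 0 < d) : S →ₗ[ℝ] S →ₗ[ℝ] ℝ :=
  LinearMap.mk₂ ℝ (fun V W => pb.slip V W)
    (fun V V' W => slip_add_left hd T (hS V V.2).continuousOn (hS V' V'.2).continuousOn
      (hS W W.2).continuousOn)
    (fun c V W => slip_smul_left c _ _)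
    (fun V W W' => by
      rw [slip_comm, Submodule.coe_add, slip_add_left hd T (hS W W.2).continuousOn
        (hS W' W'.2).continuousOn (hS V V.2).continuousOn, slip_comm, slip_comm (W' : Sp d → Sp d)])
    (fun c V W => by
      rw [slip_comm, Submodule.coe_smul, slip_smul_left, slip_comm, smul_eq_mul])

/-- The `L²` inner product with a piecewise continuous field as a linear form. -/
def loadForm {f : Sp d → Sp d} (hf : T.PwC f) : S →ₗ[ℝ] ℝ :=
  have hi : ∀ V : S, Integrable (fun x => inner ℝ (f x) ((V : Sp d → Sp d) x))
    (volume.restrict pb.Ω) := fun V => (hf.inner (hS V V.2).pwSmooth.pwC).integrableOn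
  { toFun := fun V => pb.ip f V
    map_add' := fun V W => by
      simp only [FlowProblem.ip]
      rw [← integral_add (hi _) (hi _)]
      congr 1
      funext x
      simp [inner_add_right]
    map_smul' := fun c V => by
      simp only [FlowProblem.ip, RingHom.id_apply, smul_eq_mul]
      rw [← integral_const_mul]
      congr 1
      funext x
      simp [inner_smul_right] }

/-- The pairing of pressures with divergences of velocities as a bilinear form. -/
def divForm (Q : Submodule ℝ pb.Pressure) : Q →ₗ[ℝ] S →ₗ[ℝ] ℝ :=
  have hi : ∀ (φ : Q) (V : S), Integrable (fun x => (φ : pb.Pressure) x * divergence V x)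
    (volume.restrict pb.Ω) := fun φ V => integrable_mul_divergence _ (hS V V.2).pwSmooth
  LinearMap.mk₂ ℝ (fun φ V => pb.divPair φ V)
    (fun φ φ' V => by
      simp only [FlowProblem.divPair]
      rw [← integral_add (hi _ _) (hi _ _)]
      refine integral_congr_ae ?_
      filter_upwards [Lp.coeFn_add (φ : pb.Pressure) (φ' : pb.Pressure)] with x hx
      rw [Submodule.coe_add, hx, Pi.add_apply, add_mul])
    (fun c φ V => by
      simp only [FlowProblem.divPair, smul_eq_mul]
      rw [← integral_const_mul]
      refine integral_congr_ae ?_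
      filter_upwards [Lp.coeFn_smul c (φ : pb.Pressure)] with x hx
      rw [Submodule.coe_smul, hx, Pi.smul_apply, smul_eq_mul, mul_assoc])
    (fun φ V W => by
      simp only [FlowProblem.divPair]
      rw [← integral_add (hi _ _) (hi _ _)]
      refine integral_congr_ae ?_
      filter_upwards [T.ae_mem_openSimplex] with x ⟨o, ho, hx⟩
      rw [Submodule.coe_add, (hS V V.2).pwSmooth.divergence_add (hS W W.2).pwSmooth ho hx, mul_add])
    (fun c φ V => by
      simp only [FlowProblem.divPair, smul_eq_mul]
      rw [← integral_const_mul]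
      congr 1
      funext x
      rw [Submodule.coe_smul, divergence_smul]
      ring)

end Forms

end BulkMesh

/-! ### The surface terms as bilinear forms -/

namespace Surface

variable {Γ : Surface d} {σ : Finset (Sp d)}

theorem integrableOn_closedSimplex (hσ : σ ∈ Γ.facets) {f : Sp d → ℝ}
    (hf : ContinuousOn f (closedSimplex σ)) :
    IntegrableOn f (closedSimplex σ) (μHE[d - 1] : Measure (Sp d)) := by
  have hK := isCompact_closedSimplex σ
  have : IsFiniteMeasure ((μHE[d - 1] : Measure (Sp d)).restrict (closedSimplex σ)) :=
    ⟨by simpa using measure_closedSimplex_lt_top hσ⟩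
  obtain ⟨C, hC⟩ := hK.exists_bound_of_continuousOn hf
  refine Integrable.of_bound (hf.aestronglyMeasurable hK.measurableSet) C ?_
  filter_upwards [ae_restrict_mem hK.measurableSet] with x hx using hC x hx

theorem ip_comm (v w : Finset (Sp d) → Sp d → Sp d) : Γ.ip v w = Γ.ip w v := by
  simp only [ip]
  refine Finset.sum_congr rfl fun σ _ => ?_
  congr 1
  funext x
  exact real_inner_comm _ _

theorem continuousOn_of_mem_plSpace {χ : Sp d → ℝ} (hχ : χ ∈ Γ.plSpace ℝ) (hσ : σ ∈ Γ.facets) :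
    ContinuousOn χ (closedSimplex σ) := hχ.2.1.mono (closedSimplex_subset_carrier hσ)

/-- The pairing of normal fields on the surface with bulk velocities as a bilinear form. -/
def normalForm (Γ : Surface d) {S : Submodule ℝ (Sp d → Sp d)}
    (hS : ∀ V ∈ S, ContinuousOn V Γ.carrier) : Γ.plSpace ℝ →ₗ[ℝ] S →ₗ[ℝ] ℝ :=
  have hi : ∀ (κ : Γ.plSpace ℝ) (V : S), ∀ σ ∈ Γ.facets, Integrable
      (fun x => inner ℝ ((κ : Sp d → ℝ) x • Γ.normal σ) ((V : Sp d → Sp d) x))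
      ((μHE[d - 1] : Measure (Sp d)).restrict (closedSimplex σ)) := fun κ V σ hσ =>
    integrableOn_closedSimplex hσ (((continuousOn_of_mem_plSpace κ.2 hσ).smul
      continuousOn_const).inner ((hS V V.2).mono (closedSimplex_subset_carrier hσ)))
  LinearMap.mk₂ ℝ (fun κ V => Γ.ip (fun σ x => (κ : Sp d → ℝ) x • Γ.normal σ) fun _ => V)
    (fun κ κ' V => by
      simp only [ip]
      rw [← Finset.sum_add_distrib]
      refine Finset.sum_congr rfl fun σ hσ => ?_
      rw [← integral_add (hi _ _ σ hσ) (hi _ _ σ hσ)]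
      congr 1
      funext x
      simp [add_smul, inner_add_left])
    (fun c κ V => by
      simp only [ip, smul_eq_mul, Finset.mul_sum]
      refine Finset.sum_congr rfl fun σ hσ => ?_
      rw [← integral_const_mul]
      congr 1
      funext x
      simp [inner_smul_left, mul_assoc])
    (fun κ V W => by
      simp only [ip]
      rw [← Finset.sum_add_distrib]
      refine Finset.sum_congr rfl fun σ hσ => ?_
      rw [← integral_add (hi _ _ σ hσ) (hi _ _ σ hσ)]
      congr 1
      funext x
      simp [inner_add_right])
    (fun c κ V => by
      simp only [ip, smul_eq_mul, Finset.mul_sum]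
      refine Finset.sum_congr rfl fun σ hσ => ?_
      rw [← integral_const_mul]
      congr 1
      funext x
      simp only [Submodule.coe_smul, Pi.smul_apply, inner_smul_right])

/-- The mass lumped pairing of vector fields with normal fields as a bilinear form. -/
def lumpedForm (Γ : Surface d) : Γ.plSpace (Sp d) →ₗ[ℝ] Γ.plSpace ℝ →ₗ[ℝ] ℝ :=
  LinearMap.mk₂ ℝ
    (fun X χ => Γ.lumped (fun _ => X) fun σ x => (χ : Sp d → ℝ) x • Γ.normal σ)
    (fun X Y χ => by
      simp [lumped, inner_add_left, Finset.sum_add_distrib, mul_add])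
    (fun c X χ => by
      simp only [lumped, smul_eq_mul, Finset.mul_sum, Submodule.coe_smul, Pi.smul_apply,
        inner_smul_left, conj_trivial]
      refine Finset.sum_congr rfl fun σ _ => Finset.sum_congr rfl fun q _ => ?_
      ring)
    (fun X χ χ' => by
      simp [lumped, add_smul, inner_add_right, Finset.sum_add_distrib, mul_add])
    (fun c X χ => by
      simp only [lumped, smul_eq_mul, Finset.mul_sum, Submodule.coe_smul, Pi.smul_apply,
        inner_smul_right]
      refine Finset.sum_congr rfl fun σ _ => Finset.sum_congr rfl fun q _ => ?_
      ring)

/-- The Dirichlet form on the surface. -/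
def dirichletForm (Γ : Surface d) : Γ.plSpace (Sp d) →ₗ[ℝ] Γ.plSpace (Sp d) →ₗ[ℝ] ℝ :=
  LinearMap.mk₂ ℝ (fun X Y => Γ.gradIp X Y)
    (fun X Y Z => by
      rw [gradIp_eq (X + Y).2 Z.2, gradIp_eq X.2 Z.2, gradIp_eq Y.2 Z.2, ← Finset.sum_add_distrib]
      refine Finset.sum_congr rfl fun σ _ => ?_
      rw [Submodule.coe_add, tangGrad_add', hs_add_left, mul_add])
    (fun c X Z => by
      rw [gradIp_eq (c • X).2 Z.2, gradIp_eq X.2 Z.2, smul_eq_mul, Finset.mul_sum]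
      refine Finset.sum_congr rfl fun σ _ => ?_
      rw [Submodule.coe_smul, tangGrad_smul', hs_smul_left]
      ring)
    (fun Z X Y => by
      rw [gradIp_eq Z.2 (X + Y).2, gradIp_eq Z.2 X.2, gradIp_eq Z.2 Y.2, ← Finset.sum_add_distrib]
      refine Finset.sum_congr rfl fun σ _ => ?_
      rw [Submodule.coe_add, tangGrad_add', hs_comm, hs_add_left, hs_comm, hs_comm (tangGrad σ Y), mul_add])
    (fun c Z X => by
      rw [gradIp_eq Z.2 (c • X).2, gradIp_eq Z.2 X.2, smul_eq_mul, Finset.mul_sum]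
      refine Finset.sum_congr rfl fun σ _ => ?_
      rw [Submodule.coe_smul, tangGrad_smul', hs_comm, hs_smul_left, hs_comm]
      ring)

end Surface

end

/-! ### The time step: coercivity, unique solvability, energy estimate -/

section

variable {d : ℕ}

/-- Under either rule the coefficient is a convex combination of the two phase values. On a null
simplex the volume quotient is zero by convention, which is harmless. -/
theorem CutRule.le_coeff (r : CutRule) (Γ : Surface d) {c cMinus cPlus : ℝ} (h₁ : c ≤ cMinus)
    (h₂ : c ≤ cPlus) (o : Finset (Sp d)) : c ≤ r.coeff Γ cMinus cPlus o := by
  cases r with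
  | mean =>
    simp only [CutRule.coeff]
    split_ifs <;> linarith
  | volumeFraction =>
    simp only [CutRule.coeff]
    set v := volume.real (openSimplex o ∩ Γ.inside) / volume.real (openSimplex o) with hv
    have h0 : 0 ≤ v := by positivity
    have h1 : v ≤ 1 := by
      refine div_le_one_of_le₀ (measureReal_mono Set.inter_subset_left ?_) measureReal_nonneg
      exact ((measure_mono interior_subset).trans_lt
        (isCompact_convexHull_finset o).measure_lt_top).ne
    nlinarith

theorem BulkMesh.pwConst_nonneg {Ω : Set (Sp d)} (T : BulkMesh Ω) {c : Finset (Sp d) → ℝ}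
    (hc : ∀ o, 0 ≤ c o) (x : Sp d) : 0 ≤ T.pwConst c x :=
  Finset.sum_nonneg fun o _ => Set.indicator_nonneg (fun _ _ => hc o) x

namespace Discretization

variable {pb : FlowProblem d} (D : Discretization pb) {m : ℕ}

theorem pwC_rho (m : ℕ) : (D.mesh m).PwC (D.rho m) := BulkMesh.PwC.pwConst _

theorem pwC_mu (m : ℕ) : (D.mesh m).PwC (D.mu m) := BulkMesh.PwC.pwConst _

theorem pwC_rhoOld (m : ℕ) : (D.mesh m).PwC (D.rhoOld m) := BulkMesh.PwC.pwConst _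

theorem pwC_velOld (m : ℕ) : (D.mesh m).PwC (D.velOld m) :=
  (BulkMesh.memSVec_interp₂ _).pwSmooth.pwC

theorem pwC_force (m : ℕ) : (D.mesh m).PwC (D.force m) :=
  ((D.pwC_rho m).smul (BulkMesh.memSVec_interp₂ _).pwSmooth.pwC).add
    (BulkMesh.memSVec_interp₂ _).pwSmooth.pwC

theorem rho_nonneg (m : ℕ) (x : Sp d) : 0 ≤ D.rho m x :=
  BulkMesh.pwConst_nonneg _ (D.rule.le_coeff _ pb.rhoMinus_nonneg pb.rhoPlus_nonneg) x

theorem mu_nonneg (m : ℕ) (x : Sp d) : 0 ≤ D.mu m x :=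
  BulkMesh.pwConst_nonneg _ (D.rule.le_coeff _ pb.muMinus_pos.le pb.muPlus_pos.le) x

theorem mu_pos {o : Finset (Sp d)} (ho : o ∈ (D.mesh m).elements) {x : Sp d}
    (hx : x ∈ openSimplex o) : 0 < D.mu m x := by
  rw [mu, BulkMesh.pwConst_apply _ ho hx]
  exact (lt_min pb.muMinus_pos pb.muPlus_pos).trans_le
    (D.rule.le_coeff _ (min_le_left _ _) (min_le_right _ _) o)

theorem rhoOld_nonneg (m : ℕ) (x : Sp d) : 0 ≤ D.rhoOld m x := by
  refine BulkMesh.pwConst_nonneg _ (fun o => ?_) x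
  rw [average_eq]
  refine smul_nonneg (by positivity) (integral_nonneg fun y => ?_)
  cases m with
  | zero => exact D.rho_nonneg 0 y
  | succ m => exact D.rho_nonneg m y

theorem τ_pos (hm : m < D.M) : 0 < D.τ m := sub_pos.2 (D.t_lt m hm)

/-- The pressure space on level `m` as a linear space. -/
def presHatSubmodule (m : ℕ) : Submodule ℝ pb.Pressure where
  carrier := D.presHat m
  add_mem' := by
    rintro φ ψ ⟨hφ, hφ'⟩ ⟨hψ, hψ'⟩
    refine ⟨add_mem hφ hψ, ?_⟩
    rw [integral_congr_ae (Lp.coeFn_add φ ψ)]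
    simp only [Pi.add_apply]
    rw [integral_add ((Lp.memLp φ).integrable one_le_two) ((Lp.memLp ψ).integrable one_le_two),
      hφ', hψ', add_zero]
  zero_mem' := ⟨zero_mem _, by
    rw [integral_congr_ae (Lp.coeFn_zero ℝ 2 (volume.restrict pb.Ω))]
    simp⟩
  smul_mem' := by
    rintro c φ ⟨hφ, hφ'⟩
    refine ⟨Submodule.smul_mem _ c hφ, ?_⟩
    rw [integral_congr_ae (Lp.coeFn_smul c φ)]
    simp only [Pi.smul_apply]
    rw [integral_smul, hφ', smul_zero]

/-- If a nonzero pressure were annihilated by all velocities, every quotient in the supremum,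
including the one with `ξ = 0`, would be zero, below `C₀`. -/
theorem eq_zero_of_divPair_eq_zero {C₀ : ℝ} (hC : 0 < C₀) (h : D.LBB m C₀) {φ : pb.Pressure}
    (hφ : φ ∈ D.presHat m) (h0 : ∀ ξ ∈ D.velSpace m, pb.divPair φ ξ = 0) : φ = 0 := by
  by_contra hne
  have h1 := h.trans (iInf₂_le φ ⟨hφ, hne⟩)
  have h2 := h1.trans (iSup₂_le (a := (0 : EReal)) fun ξ hξ => by rw [h0 ξ hξ]; simp)
  exact absurd (EReal.coe_nonneg.2 hC.le) (by
    intro _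
    exact absurd (EReal.coe_le_coe_iff.1 (by simpa using h2)) (not_le.2 hC))

/-- The coefficient of the inertia term. -/
def inertia (m : ℕ) (x : Sp d) : ℝ := 1 / 2 * ((D.τ m)⁻¹ * (D.rho m x + D.rhoOld m x))

theorem pwC_inertia (m : ℕ) : (D.mesh m).PwC (D.inertia m) :=
  (((D.pwC_rho m).add (D.pwC_rhoOld m)).const_mul _).const_mul _

theorem inertia_nonneg (hm : m < D.M) (x : Sp d) : 0 ≤ D.inertia m x := by
  have := D.τ_pos hm
  have := D.rho_nonneg m x
  have := D.rhoOld_nonneg m x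
  rw [inertia]
  positivity

section Forms

variable {k : ℕ} (hS : ∀ V ∈ D.velSpace m, (D.mesh m).MemSVec k V)

/-- The bilinear form of the discrete momentum equation, without pressure and surface tension. -/
def flowForm (hd : 0 < d) : D.velSpace m →ₗ[ℝ] D.velSpace m →ₗ[ℝ] ℝ :=
  BulkMesh.momentumForm hS (D.pwC_inertia m) ((D.pwC_mu m).const_mul 2)
    ((D.pwC_rho m).const_mul (1 / 2)) (D.pwC_velOld m) + pb.β • BulkMesh.slipForm hS hd

theorem flowForm_apply (hd : 0 < d) (U ξ : D.velSpace m) :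
    D.flowForm hS hd U ξ =
      (∫ x in pb.Ω, D.inertia m x * inner ℝ ((U : Sp d → Sp d) x) ((ξ : Sp d → Sp d) x)) +
      2 * (∫ x in pb.Ω, D.mu m x * frob (deform U x) (deform ξ x)) +
      1 / 2 * (∫ x in pb.Ω, D.rho m x *
        (inner ℝ (convect (D.velOld m) U x) ((ξ : Sp d → Sp d) x) -
          inner ℝ (convect (D.velOld m) ξ x) ((U : Sp d → Sp d) x))) +
      pb.β * pb.slip U ξ := by
  rw [flowForm, LinearMap.add_apply, LinearMap.add_apply, BulkMesh.momentumForm_apply,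
    ← integral_const_mul, ← integral_const_mul]
  simp only [mul_assoc]
  rfl

/-- The skew-symmetrized convective term cancels on the diagonal, whatever the transporting
velocity. -/
theorem flowForm_self (hd : 0 < d) (U : D.velSpace m) :
    D.flowForm hS hd U U =
      (∫ x in pb.Ω, D.inertia m x * inner ℝ ((U : Sp d → Sp d) x) ((U : Sp d → Sp d) x)) +
      2 * (∫ x in pb.Ω, D.mu m x * frob (deform U x) (deform U x)) + pb.β * pb.slip U U := by
  rw [flowForm_apply]
  simp

theorem flowForm_self_nonneg (hd : 0 < d) (hm : m < D.M) (U : D.velSpace m) :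
    0 ≤ D.flowForm hS hd U U := by
  rw [flowForm_self]
  have h1 : 0 ≤ ∫ x in pb.Ω,
      D.inertia m x * inner ℝ ((U : Sp d → Sp d) x) ((U : Sp d → Sp d) x) :=
    integral_nonneg fun x => mul_nonneg (D.inertia_nonneg hm x) real_inner_self_nonneg
  have h2 : 0 ≤ ∫ x in pb.Ω, D.mu m x * frob (deform U x) (deform U x) :=
    integral_nonneg fun x => mul_nonneg (D.mu_nonneg m x) (frob_self_nonneg _)
  have h3 := mul_nonneg pb.β_nonneg (slip_self_nonneg pb U)
  linarith

/-- The three nonnegative terms vanish separately. The viscosity is positive on every element, so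
`D(U) = 0` there. -/
theorem eq_zero_of_flowForm_self (hd : 0 < d) (hm : m < D.M)
    (U : D.velSpace m) (h : D.flowForm hS hd U U = 0) : U = 0 := by
  rw [flowForm_self] at h
  have h1 : 0 ≤ ∫ x in pb.Ω,
      D.inertia m x * inner ℝ ((U : Sp d → Sp d) x) ((U : Sp d → Sp d) x) :=
    integral_nonneg fun x => mul_nonneg (D.inertia_nonneg hm x) real_inner_self_nonneg
  have h2 : 0 ≤ ∫ x in pb.Ω, D.mu m x * frob (deform U x) (deform U x) :=
    integral_nonneg fun x => mul_nonneg (D.mu_nonneg m x) (frob_self_nonneg _)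
  have h3 := mul_nonneg pb.β_nonneg (slip_self_nonneg pb U)
  have hU := (hS U U.2).pwSmooth
  refine Subtype.ext (eq_zero_of_deform_eq_zero (hS U U.2) (D.velSpace_bc m hm U U.2)
    fun o ho x hx => ?_)
  have h4 := BulkMesh.PwC.eqOn_zero ((D.pwC_mu m).mul (hU.pwC_deform hU))
    (fun o _ x _ => mul_nonneg (D.mu_nonneg m x) (frob_self_nonneg _)) (by linarith) ho x hx
  exact eq_zero_of_frob_self_eq_zero ((mul_eq_zero.1 h4).resolve_left (D.mu_pos ho hx).ne')

/-- The right-hand side of the discrete momentum equation, including the old momentum. -/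
def momentumLoad : D.velSpace m →ₗ[ℝ] ℝ :=
  BulkMesh.loadForm hS (D.pwC_force m) + (D.τ m)⁻¹ •
    BulkMesh.loadForm hS ((D.pwC_rhoOld m).smul (D.pwC_velOld m))

theorem momentumLoad_apply (ξ : D.velSpace m) : D.momentumLoad hS ξ =
    pb.ip (D.force m) ξ + (D.τ m)⁻¹ * pb.ip (fun x => D.rhoOld m x • D.velOld m x) ξ := rfl

/-- The old momentum occurs in both difference quotients, which compensates the factor one half;
moving it to the right leaves a bilinear form. -/
theorem ip_inertia {k : ℕ} (hS : ∀ V ∈ D.velSpace m, (D.mesh m).MemSVec k V)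
    (U ξ : D.velSpace m) :
    1 / 2 * pb.ip (fun x =>
        (D.τ m)⁻¹ • (D.rho m x • (U : Sp d → Sp d) x - D.rhoOld m x • D.velOld m x) +
        D.rhoOld m x • ((D.τ m)⁻¹ • ((U : Sp d → Sp d) x - D.velOld m x))) ξ =
      (∫ x in pb.Ω, D.inertia m x * inner ℝ ((U : Sp d → Sp d) x) ((ξ : Sp d → Sp d) x)) -
        (D.τ m)⁻¹ * pb.ip (fun x => D.rhoOld m x • D.velOld m x) ξ := by
  have hU := (hS U U.2).pwSmooth.pwC
  have hξ := (hS ξ ξ.2).pwSmooth.pwC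
  have h1 := ((D.pwC_inertia m).mul (hU.inner hξ)).integrableOn
  have h2 := ((((D.pwC_rhoOld m).smul (D.pwC_velOld m)).inner hξ).const_mul (D.τ m)⁻¹).integrableOn
  rw [FlowProblem.ip, FlowProblem.ip, ← integral_const_mul, ← integral_const_mul,
    ← integral_sub h1 h2]
  congr 1
  funext x
  simp only [inertia, inner_add_left, inner_sub_left, inner_smul_left, conj_trivial]
  ring

theorem momentum_iff (hd : 0 < d) (hΓ : (D.surf m).carrier ⊆ closure pb.Ω)
    (U ξ : D.velSpace m) (P : D.presHatSubmodule m) (κ : (D.surf m).plSpace ℝ) :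
    (1 / 2 * pb.ip (fun x =>
        (D.τ m)⁻¹ • (D.rho m x • (U : Sp d → Sp d) x - D.rhoOld m x • D.velOld m x) +
        D.rhoOld m x • ((D.τ m)⁻¹ • ((U : Sp d → Sp d) x - D.velOld m x))) ξ
      + 2 * (∫ x in pb.Ω, D.mu m x * frob (deform U x) (deform ξ x))
      + 1 / 2 * (∫ x in pb.Ω, D.rho m x *
          (inner ℝ (convect (D.velOld m) U x) ((ξ : Sp d → Sp d) x) -
            inner ℝ (convect (D.velOld m) ξ x) ((U : Sp d → Sp d) x)))
      - pb.divPair P ξ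
      + pb.β * pb.slip U ξ
      - pb.γ * (D.surf m).ip (fun σ x => (κ : Sp d → ℝ) x • (D.surf m).normal σ) (fun _ => ξ)
    = pb.ip (D.force m) ξ) ↔
    D.flowForm hS hd U ξ - BulkMesh.divForm hS (D.presHatSubmodule m) P ξ -
      pb.γ * (D.surf m).normalForm (fun V hV => (hS V hV).continuousOn.mono hΓ) κ ξ =
        D.momentumLoad hS ξ := by
  rw [D.ip_inertia hS, flowForm_apply, momentumLoad_apply]
  change _ ↔ _ - pb.divPair P ξ - pb.γ * (D.surf m).ip
    (fun σ x => (κ : Sp d → ℝ) x • (D.surf m).normal σ) (fun _ => ξ) = _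
  constructor <;> intro h <;> linarith

end Forms

/-- The identity on the surface, as an element of the space of parametrizations. -/
def identV (Γ : Surface d) : Γ.plSpace (Sp d) := ⟨Γ.ident, Surface.ident_mem⟩

/-- The lumped product samples only vertices, where the plain identity agrees with its extension by
zero. -/
theorem lumped_displacement {Γ : Surface d} (τ : ℝ) (X : Γ.plSpace (Sp d)) (χ : Γ.plSpace ℝ) :
    Γ.lumped (fun _ x => τ⁻¹ • ((X : Sp d → Sp d) x - x))
        (fun σ x => (χ : Sp d → ℝ) x • Γ.normal σ) =
      τ⁻¹ * Γ.lumpedForm (X - identV Γ) χ := by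
  change _ = τ⁻¹ * Γ.lumped (fun _ => (X : Sp d → Sp d) - Γ.ident)
    (fun σ x => (χ : Sp d → ℝ) x • Γ.normal σ)
  simp only [Surface.lumped, Finset.mul_sum]
  refine Finset.sum_congr rfl fun σ hσ => Finset.sum_congr rfl fun q hq => ?_
  rw [Pi.sub_apply, Surface.ident_apply (Surface.closedSimplex_subset_carrier hσ
    (Surface.mem_closedSimplex_of_mem hq)), inner_smul_left, conj_trivial]
  ring

theorem isSolution_iff {k : ℕ} (hS : ∀ V ∈ D.velSpace m, (D.mesh m).MemSVec k V) (hd : 0 < d)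
    (hΓ : (D.surf m).carrier ⊆ closure pb.Ω) (U : D.velSpace m) (P : D.presHatSubmodule m)
    (X : (D.surf m).plSpace (Sp d)) (κ : (D.surf m).plSpace ℝ) :
    D.IsSolution m ⟨U, P, X, κ⟩ ↔
      (∀ ξ, D.flowForm hS hd U ξ - BulkMesh.divForm hS (D.presHatSubmodule m) P ξ -
        pb.γ * (D.surf m).normalForm (fun V hV => (hS V hV).continuousOn.mono hΓ) κ ξ =
          D.momentumLoad hS ξ) ∧
      (∀ φ, BulkMesh.divForm hS (D.presHatSubmodule m) φ U = 0) ∧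
      (∀ χ, (D.τ m)⁻¹ * (D.surf m).lumpedForm X χ -
        (D.surf m).normalForm (fun V hV => (hS V hV).continuousOn.mono hΓ) χ U =
          ((D.τ m)⁻¹ • (D.surf m).lumpedForm (identV (D.surf m))) χ) ∧
      ∀ η, (D.surf m).lumpedForm η κ + (D.surf m).dirichletForm X η = 0 := by
  have h3 : ∀ χ : (D.surf m).plSpace ℝ,
      ((D.surf m).lumped (fun _ x => (D.τ m)⁻¹ • ((X : Sp d → Sp d) x - x))
        (fun σ x => (χ : Sp d → ℝ) x • (D.surf m).normal σ)
      - (D.surf m).ip (fun _ => U) (fun σ x => (χ : Sp d → ℝ) x • (D.surf m).normal σ) = 0) ↔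
      (D.τ m)⁻¹ * (D.surf m).lumpedForm X χ -
        (D.surf m).normalForm (fun V hV => (hS V hV).continuousOn.mono hΓ) χ U =
          ((D.τ m)⁻¹ • (D.surf m).lumpedForm (identV (D.surf m))) χ := by
    intro χ
    rw [lumped_displacement, Surface.ip_comm, map_sub, LinearMap.sub_apply, LinearMap.smul_apply,
      smul_eq_mul]
    change _ ↔ _ - (D.surf m).ip (fun σ x => (χ : Sp d → ℝ) x • (D.surf m).normal σ)
      (fun _ => U) = _
    constructor <;> intro h <;> linarith
  constructor
  · intro h
    refine ⟨fun ξ => (D.momentum_iff hS hd hΓ U ξ P κ).1 (h.momentum ξ ξ.2),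
      fun φ => h.incompressibility φ φ.2, fun χ => (h3 χ).1 (h.motion χ χ.2), fun η => ?_⟩
    have := h.curvature η η.2
    rwa [Surface.lumped_comm] at this
  · rintro ⟨e1, e2, e3, e4⟩
    refine ⟨U.2, P.2, X.2, κ.2,
      fun ξ hξ => (D.momentum_iff hS hd hΓ U ⟨ξ, hξ⟩ P κ).2 (e1 ⟨ξ, hξ⟩),
      fun φ hφ => e2 ⟨φ, hφ⟩, fun χ hχ => (h3 ⟨χ, hχ⟩).2 (e3 ⟨χ, hχ⟩), fun η hη => ?_⟩
    rw [Surface.lumped_comm]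
    exact e4 ⟨η, hη⟩

theorem existsUnique_isSolution (hd : d = 2 ∨ d = 3) (hm : m < D.M) {C₀ : ℝ} (hC : 0 < C₀)
    (hLBB : D.LBB m C₀) (hA : (D.surf m).AssumptionA pb.Ω) (hcomp : (D.surf m).SpanOnComponents)
    (hω : ∀ q ∈ (D.surf m).complex.vertices, (D.surf m).vertexNormal q ≠ 0) :
    ∃! s : State pb, D.IsSolution m s := by
  have hd0 : 0 < d := by omega
  obtain ⟨k, hS⟩ := D.velSpace_poly m hm
  obtain ⟨k', hP⟩ := D.presSpace_poly m hm
  obtain ⟨hpos, hΓ, -⟩ := hA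
  have := BulkMesh.finiteDimensional_of_memSVec hS
  have : FiniteDimensional ℝ (D.presHatSubmodule m) :=
    BulkMesh.finiteDimensional_of_memDiscontinuous fun φ hφ => hP φ hφ.1
  obtain ⟨⟨U, P, X, κ⟩, hs, huniq⟩ := existsUnique_saddle (D.flowForm hS hd0)
    (BulkMesh.divForm hS (D.presHatSubmodule m))
    ((D.surf m).normalForm fun V hV => (hS V hV).continuousOn.mono hΓ)
    (D.surf m).lumpedForm (D.surf m).dirichletForm pb.γ_pos (D.τ_pos hm)
    (D.flowForm_self_nonneg hS hd0 hm) (D.eq_zero_of_flowForm_self hS hd0 hm)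
    (fun X => Surface.gradIp_self_nonneg X.2)
    (fun X h hl => Subtype.ext (Surface.eq_zero_of_gradIp_of_lumped hd0 hpos hcomp X.2 h
      fun χ hχ => hl ⟨χ, hχ⟩))
    (fun κ hl => Subtype.ext (Surface.eq_zero_of_lumped hd0 hω κ.2 fun η hη => hl ⟨η, hη⟩))
    (fun P hb => Subtype.ext (D.eq_zero_of_divPair_eq_zero hC hLBB P.2 fun ξ hξ => hb ⟨ξ, hξ⟩))
    (D.momentumLoad hS) ((D.τ m)⁻¹ • (D.surf m).lumpedForm (identV (D.surf m)))
  refine ⟨⟨U, P, X, κ⟩, (D.isSolution_iff hS hd0 hΓ U P X κ).2 hs, ?_⟩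
  rintro ⟨U', P', X', κ'⟩ h'
  have := huniq ⟨⟨U', h'.mem_U⟩, ⟨P', h'.mem_P⟩, ⟨X', h'.mem_X⟩, ⟨κ', h'.mem_κ⟩⟩
    ((D.isSolution_iff hS hd0 hΓ _ _ _ _).1 h')
  have h1 : U' = U := congrArg (fun t => (t.1 : Sp d → Sp d)) this
  have h2 : P' = P := congrArg (fun t => (t.2.1 : pb.Pressure)) this
  have h3 : X' = X := congrArg (fun t => (t.2.2.1 : Sp d → Sp d)) this
  have h4 : κ' = κ := congrArg (fun t => (t.2.2.2 : Sp d → ℝ)) this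
  subst h1 h2 h3 h4
  rfl

/-- Test with `U`, `P`, `κ` and the displacement `X - id`, and multiply by `τ`. With the old
velocity `W`, the inertia terms give energies through `2⟨W, U⟩ = |U|² + |W|² - |U - W|²`, weighted
by the old density. -/
theorem energy_le (hd : d = 2 ∨ d = 3) (hm : m < D.M) (hA : (D.surf m).AssumptionA pb.Ω)
    {s : State pb} (h : D.IsSolution m s) :
    pb.energy (D.rho m) s.U (s.X '' (D.surf m).carrier)
        + 1 / 2 * pb.ip (fun x => D.rhoOld m x • (s.U x - D.velOld m x))
            (fun x => s.U x - D.velOld m x)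
        + 2 * D.τ m * (∫ x in pb.Ω, D.mu m x * frob (deform s.U x) (deform s.U x))
        + D.τ m * pb.β * pb.slip s.U s.U
      ≤ pb.energy (D.rhoOld m) (D.velOld m) (D.surf m).carrier
        + D.τ m * pb.ip (D.force m) s.U := by
  have hd0 : 0 < d := by omega
  obtain ⟨k, hS⟩ := D.velSpace_poly m hm
  obtain ⟨-, hΓ, -⟩ := hA
  obtain ⟨U, P, X, κ⟩ := s
  set Γ := D.surf m with hΓdef
  have hτ := D.τ_pos hm
  have hγ := pb.γ_pos
  obtain ⟨e1, e2, e3, e4⟩ := (D.isSolution_iff hS hd0 hΓ ⟨U, h.mem_U⟩ ⟨P, h.mem_P⟩ ⟨X, h.mem_X⟩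
    ⟨κ, h.mem_κ⟩).1 h
  have a1 := e1 ⟨U, h.mem_U⟩
  have a2 := e2 ⟨P, h.mem_P⟩
  have a3 := e3 ⟨κ, h.mem_κ⟩
  have a4 := e4 (⟨X, h.mem_X⟩ - identV Γ)
  have a5 := Surface.measure_image_sub_measure_le hd h.mem_X
  rw [a2, sub_zero, flowForm_self, momentumLoad_apply] at a1
  rw [map_sub, LinearMap.sub_apply] at a4
  rw [LinearMap.smul_apply, smul_eq_mul] at a3
  change _ ≤ Γ.dirichletForm ⟨X, h.mem_X⟩ (⟨X, h.mem_X⟩ - identV Γ) at a5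
  set c := Γ.normalForm (fun V hV => (hS V hV).continuousOn.mono hΓ) ⟨κ, h.mem_κ⟩ ⟨U, h.mem_U⟩
  set l₁ := Γ.lumpedForm ⟨X, h.mem_X⟩ ⟨κ, h.mem_κ⟩
  set l₀ := Γ.lumpedForm (identV Γ) ⟨κ, h.mem_κ⟩
  set g := Γ.dirichletForm ⟨X, h.mem_X⟩ (⟨X, h.mem_X⟩ - identV Γ)
  have hU := (hS U h.mem_U).pwSmooth.pwC
  have hW := D.pwC_velOld m
  have i1 := ((D.pwC_rho m).mul (hU.inner hU)).integrableOn
  have i2 := ((D.pwC_rhoOld m).mul (hU.inner hU)).integrableOn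
  have i3 := ((D.pwC_rhoOld m).mul (hW.inner hU)).integrableOn
  have i4 := ((D.pwC_rhoOld m).mul (hW.inner hW)).integrableOn
  have b1 : (∫ x in pb.Ω, D.inertia m x * inner ℝ (U x) (U x)) =
      1 / 2 * ((D.τ m)⁻¹ * ((∫ x in pb.Ω, D.rho m x * inner ℝ (U x) (U x)) +
        ∫ x in pb.Ω, D.rhoOld m x * inner ℝ (U x) (U x))) := by
    rw [← integral_add i1 i2, ← integral_const_mul, ← integral_const_mul]
    congr 1
    funext x
    rw [inertia]
    ring
  have b2 : pb.ip (fun x => D.rhoOld m x • (U x - D.velOld m x)) (fun x => U x - D.velOld m x) =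
      (∫ x in pb.Ω, D.rhoOld m x * inner ℝ (U x) (U x)) -
        2 * (∫ x in pb.Ω, D.rhoOld m x * inner ℝ (D.velOld m x) (U x)) +
        ∫ x in pb.Ω, D.rhoOld m x * inner ℝ (D.velOld m x) (D.velOld m x) := by
    rw [← integral_const_mul, ← integral_sub i2 (i3.const_mul 2)]
    refine Eq.trans ?_ (integral_add (i2.sub (i3.const_mul 2)) i4)
    rw [FlowProblem.ip]
    congr 1
    funext x
    rw [inner_smul_left, real_inner_sub_sub_self, real_inner_comm (D.velOld m x) (U x),
      conj_trivial]
    ring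
  have b3 : ∀ (r : Sp d → ℝ) (v w : Sp d → Sp d), pb.ip (fun x => r x • v x) w =
      ∫ x in pb.Ω, r x * inner ℝ (v x) (w x) := by
    intro r v w
    rw [FlowProblem.ip]
    congr 1
    funext x
    rw [inner_smul_left, conj_trivial]
  simp only [FlowProblem.energy]
  rw [b1, b3] at a1
  rw [b2, b3, b3]
  -- The power of surface tension equals minus the Dirichlet form against the displacement, divided
  -- by `τ`; by `a5` it pays for the growth of area.
  have hc : c = -((D.τ m)⁻¹ * g) := by
    have : c = (D.τ m)⁻¹ * (l₁ - l₀) := by linarith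
    rw [this, show l₁ - l₀ = -g by linarith]
    ring
  rw [hc] at a1
  have a6 := congrArg (fun y => D.τ m * y) a1
  field_simp at a6
  have a7 := mul_le_mul_of_nonneg_left a5 hγ.le
  nlinarith [a6, a7]

end Discretization

end

end TwoPhase

end

theorem theorem4p1 {d : ℕ} (hd : d = 2 ∨ d = 3) (pb : TwoPhase.FlowProblem d)
    (D : TwoPhase.Discretization pb)
    (hLBB : ∃ C₀ : ℝ, 0 < C₀ ∧ ∀ m < D.M, D.LBB m C₀)
    (hA : ∀ m < D.M, (D.surf m).AssumptionA pb.Ω)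
    (hcomp : ∀ m < D.M, (D.surf m).SpanOnComponents)
    (hω : ∀ m < D.M, ∀ q ∈ (D.surf m).complex.vertices, (D.surf m).vertexNormal q ≠ 0) :
    ∀ m < D.M,
      (∃! s : TwoPhase.State pb, D.IsSolution m s) ∧
      ∀ s : TwoPhase.State pb, D.IsSolution m s →
        pb.energy (D.rho m) s.U (s.X '' (D.surf m).carrier)
          + 1 / 2 * pb.ip (fun x => D.rhoOld m x • (s.U x - D.velOld m x))
              (fun x => s.U x - D.velOld m x)
          + 2 * D.τ m * (∫ x in pb.Ω, D.mu m x *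
              TwoPhase.frob (TwoPhase.deform s.U x) (TwoPhase.deform s.U x))
          + D.τ m * pb.β * pb.slip s.U s.U
        ≤ pb.energy (D.rhoOld m) (D.velOld m) (D.surf m).carrier
          + D.τ m * pb.ip (D.force m) s.U := by
  intro m hm
  obtain ⟨C₀, hC, hL⟩ := hLBB
  exact ⟨D.existsUnique_isSolution hd hm hC (hL m hm) (hA m hm) (hcomp m hm) (hω m hm),
    fun s hs => D.energy_le hd hm (hA m hm) hs⟩
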